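/- **Setting.** Let $\theta=g^{-1}dg$ be the left-invariant Maurer–Cartan form of $\mathrm{Sp}(2)$, the group of quaternionic unitary $2\times 2$ matrices. Define real left-invariant 1-forms by $\theta_{22}=\omega^1 i+\omega^2 j+\omega^3 k$ and $\theta_{12}=\tfrac12(e^1+e^2i+e^3j+e^4k)$, and put $\Omega_1=e^{12}-e^{34}$, $\Omega_2=e^{13}-e^{42}$, $\Omega_3=e^{14}-e^{23}$, so that $d\omega^i=-2\omega^{jk}+\tfrac12\Omega_i$ for cyclic $(i,j,k)$. Let $T_1,T_2,T_3$ be the basis of $\mathfrak{su}(2)$ with $[T_i,T_j]=2T_k$ for cyclic $(i,j,k)$. Let $X=\Lambda^2_-(S^4)$ be the bundle of anti-self-dual 2-forms on the round $S^4$. The complement of its zero section is identified $\mathrm{Sp}(2)$-equivariantly with $\mathbb{R}^+_s\times\mathbb{CP}^3$, $\mathbb{CP}^3=\mathrm{Sp}(2)/(\mathrm{Sp}(1)\times\mathrm{U}(1))$, by $(s,[g])\mapsto s\,g\cdot\Omega_1$. Forms on it are written on $\mathbb{R}^+\times\mathrm{Sp}(2)$. With $f=(1+s^2)^{-1/4}$,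 $dt=f\,ds$, $t(s)=\int_0^s(1+u^2)^{-1/4}du$, $a=2sf$ and $b=\sqrt2 f^{-1}$, the Bryant–Salamon metric and 4-form are $$g=dt^2+a^2\big((\omega^2)^2+(\omega^3)^2\big)+b^2\sum_{i=1}^4(e^i)^2,\qquad \psi=b^4e^{1234}-a^2b^2\,\omega^{23}\wedge\Omega_1-ab^2\,dt\wedge(\omega^2\wedge\Omega_2+\omega^3\wedge\Omega_3),$$ and $\psi$ extends smoothly to $X$. A connection $A$ is a $G_2$-instanton if $F_A\wedge\psi=0$; it is irreducible if its holonomy group is the whole structure group $\mathrm{SU}(2)$. Let $P_\lambda=\mathrm{Sp}(2)\times_\lambda\mathrm{SU}(2)\to\mathbb{CP}^3$ with $\lambda(h,e^{i\theta})=\mathrm{diag}(e^{i\theta},e^{-i\theta})$, and let $A_c=\omega^1\otimes T_1$ be its canonical invariant connection. Let $P=S^7\times\mathrm{Im}\,\mathbb{H}$, with the right action $(q,x)\cdot h=(qh,h^{-1}xh)$ of $\mathrm{SU}(2)=\mathrm{Sp}(1)$; this is the principal $\mathrm{SU}(2)$-bundle over $X=S^7\times_{\mathrm{Sp}(1)}\mathrm{Im}\,\mathbb{H}$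 pulled back from the Hopf bundle $S^7\to S^4$. **Theorem.** $P$ is a principal $\mathrm{SU}(2)$-bundle over $\Lambda^2_-(S^4)$. For each choice of sign, let $$A=A_c\pm(1+s^2)^{-1/2}\left(T_2\otimes\omega^2+T_3\otimes\omega^3\right)$$ on the pullback of $P_\lambda$ to $\mathbb{R}^+\times\mathbb{CP}^3$. Then: 1. There is an isomorphism, covering the identity, of the pullback of $P_\lambda$ with the restriction of $P$ to the complement of the zero section, under which $A$ extends to a smooth connection on $P$ over all of $\Lambda^2_-(S^4)$. The extended connection is a $G_2$-instanton and is irreducible. 2. On $\mathbb{R}^+\times\mathbb{CP}^3$, $F_A\wedge\psi=0$ and the curvature is $$F_A=\left(\frac{\Omega_1}{2}-\frac{2s^2}{1+s^2}\,\omega^{23}\right)\otimes T_1\pm\frac{1}{2\sqrt{1+s^2}}\left(\Omega_2\otimes T_2+\Omega_3\otimes T_3\right)\mp\frac{s}{(1+s^2)^{3/2}}\left(ds\wedge\omega^2\otimes T_2+ds\wedge\omega^3\otimes T_3\right).$$ 3. $A$ is asymptotic to $A_c$: as $s\to\infty$ the restrictions of $A$ to the slices $\{s\}\times\mathrm{Sp}(2)$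 converge to $A_c$ uniformly with all derivatives along the slice, and $|A-A_c|_g=O(t^{-3})$. -/

import Mathlib

open scoped Quaternion ContDiff Matrix

noncomputable section

namespace BryantSalamon

/-! ### Exterior algebra and curvature

The manifolds below are embedded in normed spaces.  A differential form on such a manifold is
given by a form on the ambient space and is only ever evaluated on tangent vectors; since `d` and
`∧` commute with restriction, this is the usual calculus of forms on the manifold. -/

section Forms

variable {V W₁ W₂ W₃ : Type*} [AddCommGroup V] [Module ℝ V] [AddCommGroup W₁] [Module ℝ W₁]
  [AddCommGroup W₂] [Module ℝ W₂] [AddCommGroup W₃] [Module ℝ W₃]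

/-- The wedge product of vector-valued alternating forms with respect to a bilinear pairing `B` of
the coefficients, normalised by `(a ∧ b)(u, v) = B (a u) (b v) - B (a v) (b u)` on one-forms. -/
def wedge (B : W₁ →ₗ[ℝ] W₂ →ₗ[ℝ] W₃) {p q : ℕ} (a : V [⋀^Fin p]→ₗ[ℝ] W₁)
    (b : V [⋀^Fin q]→ₗ[ℝ] W₂) : V [⋀^Fin (p + q)]→ₗ[ℝ] W₃ :=
  ((TensorProduct.lift B).compAlternatingMap (a.domCoprod b)).domDomCongr finSumFinEquiv

/-- The wedge product of real-valued forms. -/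
def rwedge {p q : ℕ} (a : V [⋀^Fin p]→ₗ[ℝ] ℝ) (b : V [⋀^Fin q]→ₗ[ℝ] ℝ) :
    V [⋀^Fin (p + q)]→ₗ[ℝ] ℝ :=
  wedge (LinearMap.mul ℝ ℝ) a b

/-- The wedge product of a vector-valued form with a real-valued form. -/
def vwedge {p q : ℕ} (a : V [⋀^Fin p]→ₗ[ℝ] W₁) (b : V [⋀^Fin q]→ₗ[ℝ] ℝ) :
    V [⋀^Fin (p + q)]→ₗ[ℝ] W₁ :=
  wedge (LinearMap.lsmul ℝ W₁).flip a b

/-- The vector-valued form `a ⊗ T`. -/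
def tens {p : ℕ} (a : V [⋀^Fin p]→ₗ[ℝ] ℝ) (T : W₁) : V [⋀^Fin p]→ₗ[ℝ] W₁ :=
  (LinearMap.toSpanSingleton ℝ W₁ T).compAlternatingMap a

end Forms

/-- A covector as an alternating form of degree one. -/
def oneForm {E F : Type*} [NormedAddCommGroup E] [NormedSpace ℝ E] [NormedAddCommGroup F]
    [NormedSpace ℝ F] (a : E →L[ℝ] F) : E [⋀^Fin 1]→ₗ[ℝ] F :=
  AlternatingMap.ofSubsingleton ℝ E F (0 : Fin 1) (a : E →ₗ[ℝ] F)

/-- The Lie algebra `𝔰𝔲(2) = 𝔰𝔭(1)` is the space of imaginary quaternions with the commutator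
bracket; this is the commutator as a bilinear map. -/
def bracket : ℍ →ₗ[ℝ] ℍ →ₗ[ℝ] ℍ := LinearMap.mul ℝ ℍ - (LinearMap.mul ℝ ℍ).flip

/-- The standard basis `T₁, T₂, T₃` of `𝔰𝔲(2)` (indices shifted by one), with
`[T₁, T₂] = 2 T₃` and cyclic permutations. -/
def T : Fin 3 → ℍ := ![⟨0, 1, 0, 0⟩, ⟨0, 0, 1, 0⟩, ⟨0, 0, 0, 1⟩]

/-- The curvature `F_A = dA + ½ [A ∧ A]` of an `𝔰𝔲(2)`-valued one-form `A`. -/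
def curvature {E : Type*} [NormedAddCommGroup E] [NormedSpace ℝ E] (A : E → E →L[ℝ] ℍ) (p : E) :
    E [⋀^Fin 2]→ₗ[ℝ] ℍ :=
  (extDeriv (fun x => ContinuousAlternatingMap.ofSubsingleton ℝ E ℍ (0 : Fin 1) (A x))
      p).toAlternatingMap
    + (1 / 2 : ℝ) • wedge bracket (oneForm (A p)) (oneForm (A p))

/-! ### The manifold `ℝ⁺ × Sp(2)` and its forms -/

/-- `2 × 2` quaternionic matrices, as a normed space. -/
abbrev Mat : Type := Fin 2 → Fin 2 → ℍ

/-- The group `Sp(2)` of quaternionic unitary `2 × 2` matrices. -/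
def Sp2 : Set Mat := {g | Matrix.of g ∈ unitary (Matrix (Fin 2) (Fin 2) ℍ)}

/-- The tangent space of `ℝ⁺ × Sp(2)` at `(s, g)`: pairs `(r, v)` with `g⁻¹ v ∈ 𝔰𝔭(2)`. -/
def tangentSp (p : ℝ × Mat) : Set (ℝ × Mat) :=
  {w | (Matrix.of p.2)ᴴ * Matrix.of w.2 + (Matrix.of w.2)ᴴ * Matrix.of p.2 = 0}

/-- Right multiplication of `g` by the block diagonal matrix `diag(h, z)`. -/
def mulDiag (g : Mat) (h z : ℍ) : Mat := fun a b => g a b * ![h, z] b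

/-- The entry `(a, b)` of the left-invariant Maurer-Cartan form `g⁻¹ dg`. -/
def maurerCartan (a b : Fin 2) (p : ℝ × Mat) : ℝ × Mat →L[ℝ] ℍ :=
  ∑ k : Fin 2, (ContinuousLinearMap.mul ℝ ℍ (star (p.2 k a))) ∘L
    ((ContinuousLinearMap.proj (R := ℝ) (φ := fun _ : Fin 2 => ℍ) b) ∘L
      (ContinuousLinearMap.proj (R := ℝ) (φ := fun _ : Fin 2 => (Fin 2 → ℍ)) k) ∘L
        (ContinuousLinearMap.snd ℝ ℝ Mat))

/-- The one-form `ds`. -/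
def ds : ℝ × Mat →L[ℝ] ℝ := ContinuousLinearMap.fst ℝ ℝ Mat

/-- The left-invariant one-forms `ω¹, ω², ω³` (indices shifted by one) dual to the standard basis
of the second factor of `𝔰𝔭(1) ⊕ 𝔰𝔭(1) ⊆ 𝔰𝔭(2)`. -/
def om (i : Fin 3) (p : ℝ × Mat) : ℝ × Mat →L[ℝ] ℝ := (innerSL ℝ (T i)) ∘L maurerCartan 1 1 p

/-- The left-invariant one-forms `e¹, …, e⁴` (indices shifted by one), which span the dual of the
off-diagonal part `𝔪₁` of `𝔰𝔭(2)`, normalised so that `dωⁱ = -2 ωʲᵏ + ½ Ωᵢ`. -/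
def e (i : Fin 4) (p : ℝ × Mat) : ℝ × Mat →L[ℝ] ℝ :=
  (2 : ℝ) • (innerSL ℝ ((![1, T 0, T 1, T 2] : Fin 4 → ℍ) i)) ∘L maurerCartan 0 1 p

/-- `eⁱ ∧ eʲ`. -/
def ee (i j : Fin 4) (p : ℝ × Mat) : (ℝ × Mat) [⋀^Fin 2]→ₗ[ℝ] ℝ :=
  rwedge (oneForm (e i p)) (oneForm (e j p))

/-- The two-forms `Ω₁ = e¹² - e³⁴`, `Ω₂ = e¹³ - e⁴²`, `Ω₃ = e¹⁴ - e²³` (indices shifted by one). -/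
def Om (i : Fin 3) (p : ℝ × Mat) : (ℝ × Mat) [⋀^Fin 2]→ₗ[ℝ] ℝ :=
  (![ee 0 1 p - ee 2 3 p, ee 0 2 p - ee 3 1 p, ee 0 3 p - ee 1 2 p] :
    Fin 3 → (ℝ × Mat) [⋀^Fin 2]→ₗ[ℝ] ℝ) i

/-- `ω²³`. -/
def om23 (p : ℝ × Mat) : (ℝ × Mat) [⋀^Fin 2]→ₗ[ℝ] ℝ :=
  rwedge (oneForm (om 1 p)) (oneForm (om 2 p))

/-! ### The Bryant-Salamon structure on `ℝ⁺ × Sp(2)` -/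

/-- `dt/ds = (1 + s²)^(-1/4)`. -/
def f (s : ℝ) : ℝ := (1 + s ^ 2) ^ (-(1 / 4) : ℝ)

/-- The geodesic distance `t(s)` to the zero section. -/
def geodesicDist (s : ℝ) : ℝ := ∫ u in (0 : ℝ)..s, f u

/-- `a(s) = 2 s (1 + s²)^(-1/4)`. -/
def acoef (s : ℝ) : ℝ := 2 * s * f s

/-- `b(s) = √2 (1 + s²)^(1/4)`. -/
def bcoef (s : ℝ) : ℝ := √2 * (f s)⁻¹

/-- The one-form `dt`. -/
def dt (p : ℝ × Mat) : ℝ × Mat →L[ℝ] ℝ := f p.1 • ds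

/-- The pullback to `ℝ⁺ × Sp(2)` of the metric
`dt² + a² ((ω²)² + (ω³)²) + b² ∑ (eⁱ)²`, as a quadratic form. -/
def metric (p w : ℝ × Mat) : ℝ :=
  (dt p w) ^ 2 + acoef p.1 ^ 2 * ((om 1 p w) ^ 2 + (om 2 p w) ^ 2)
    + bcoef p.1 ^ 2 * ∑ i : Fin 4, (e i p w) ^ 2

/-- The pullback to `ℝ⁺ × Sp(2)` of the four-form
`ψ = b⁴ e¹²³⁴ - a² b² ω²³ ∧ Ω₁ - a b² dt ∧ (ω² ∧ Ω₂ + ω³ ∧ Ω₃)`. -/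
def psi (p : ℝ × Mat) : (ℝ × Mat) [⋀^Fin 4]→ₗ[ℝ] ℝ :=
  bcoef p.1 ^ 4 • rwedge (ee 0 1 p) (ee 2 3 p)
    - (acoef p.1 ^ 2 * bcoef p.1 ^ 2) • rwedge (om23 p) (Om 0 p)
    - (acoef p.1 * bcoef p.1 ^ 2) • rwedge (oneForm (dt p))
        (rwedge (oneForm (om 1 p)) (Om 1 p) + rwedge (oneForm (om 2 p)) (Om 2 p))

/-! ### The connections on `ℝ⁺ × P_λ`, as one-forms on `ℝ⁺ × Sp(2)`

`P_λ = Sp(2) ×_λ SU(2)` is the bundle over `ℂP³ = Sp(2) / (Sp(1) × U(1))` given by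
`λ(h, e^{iθ}) = diag(e^{iθ}, e^{-iθ})`, that is, by `λ(h, z) = z` for a unit complex number `z`
viewed as a unit quaternion. -/

/-- The canonical invariant connection `A_c = ω¹ ⊗ T₁`. -/
def canonicalForm (p : ℝ × Mat) : ℝ × Mat →L[ℝ] ℍ := (om 0 p).smulRight (T 0)

/-- The connection `A_c + ε (1 + s²)^(-1/2) (T₂ ⊗ ω² + T₃ ⊗ ω³)`, where `ε = ±1`. -/
def instantonForm (ε : ℝ) (p : ℝ × Mat) : ℝ × Mat →L[ℝ] ℍ :=
  canonicalForm p + (ε * (1 + p.1 ^ 2) ^ (-(1 / 2) : ℝ)) •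
    ((om 1 p).smulRight (T 1) + (om 2 p).smulRight (T 2))

/-- The two-form
`(½ Ω₁ - 2s²/(1+s²) ω²³) ⊗ T₁ + ε / (2 √(1+s²)) (Ω₂ ⊗ T₂ + Ω₃ ⊗ T₃)
  - ε s / (1+s²)^(3/2) (ds ∧ ω² ⊗ T₂ + ds ∧ ω³ ⊗ T₃)`. -/
def instantonCurvature (ε : ℝ) (p : ℝ × Mat) : (ℝ × Mat) [⋀^Fin 2]→ₗ[ℝ] ℍ :=
  tens ((1 / 2 : ℝ) • Om 0 p - (2 * p.1 ^ 2 / (1 + p.1 ^ 2)) • om23 p) (T 0)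
    + (ε / (2 * √(1 + p.1 ^ 2))) • (tens (Om 1 p) (T 1) + tens (Om 2 p) (T 2))
    - (ε * p.1 / (1 + p.1 ^ 2) ^ (3 / 2 : ℝ)) •
        (tens (rwedge (oneForm ds) (oneForm (om 1 p))) (T 1)
          + tens (rwedge (oneForm ds) (oneForm (om 2 p))) (T 2))

/-! ### The manifold `Λ²₋(S⁴)` -/

/-- The total space of the bundle of anti-self-dual two-forms on the round sphere `S⁴ ⊆ ℝ⁵`:
pairs of a unit vector `y` and a two-form `β` on `y^⊥`, given by its skew-symmetric matrix on `ℝ⁵`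
(with `β y = 0`), such that `β(v₁, v₂) = -β(v₃, v₄)` for every positively oriented orthonormal
basis `v₁, …, v₄` of `y^⊥`, with `S⁴` oriented by its outer normal. -/
def LambdaMinus : Set ((Fin 5 → ℝ) × (Fin 5 → Fin 5 → ℝ)) :=
  {z | z.1 ⬝ᵥ z.1 = 1 ∧ (Matrix.of z.2)ᵀ = -Matrix.of z.2 ∧ Matrix.of z.2 *ᵥ z.1 = 0 ∧
    ∀ U ∈ Matrix.specialOrthogonalGroup (Fin 5) ℝ, U 0 = z.1 →
      (U * Matrix.of z.2 * Uᵀ) 1 2 = -(U * Matrix.of z.2 * Uᵀ) 3 4}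

/-! ### The `SU(2)`-bundle `P = S⁷ × Im ℍ` over `Λ²₋(S⁴)` -/

/-- The ambient space `ℍ² × ℍ` of `S⁷ × Im ℍ`. -/
abbrev Amb : Type := ℍ × ℍ × ℍ

/-- The manifold `P = S⁷ × Im ℍ`. -/
def P : Set Amb :=
  {p | Quaternion.normSq p.1 + Quaternion.normSq p.2.1 = 1 ∧ p.2.2.re = 0}

/-- The tangent space of `P` at `p`. -/
def tangentP (p : Amb) : Set Amb :=
  {v | (star p.1 * v.1 + star p.2.1 * v.2.1).re = 0 ∧ v.2.2.re = 0}

/-- The right action `(q, x) · h = (q h, h⁻¹ x h)` of `SU(2) = Sp(1)`, the group of unit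
quaternions. It is linear in `(q, x)`, so it also describes the action on tangent vectors. -/
def act (p : Amb) (h : unitary ℍ) : Amb :=
  (p.1 * h, p.2.1 * h, star (h : ℍ) * p.2.2 * h)

/-- The fundamental vector field of `ζ ∈ 𝔰𝔲(2)`. -/
def fundamental (p : Amb) (ζ : ℍ) : Amb :=
  (p.1 * ζ, p.2.1 * ζ, p.2.2 * ζ - ζ * p.2.2)

/-- The quaternionic coordinate of `y ∈ ℝ⁵ = ℝ ⊕ ℍ`. -/
def quat (y : Fin 5 → ℝ) : ℍ := ⟨y 1, y 2, y 3, y 4⟩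

/-- Clifford multiplication of `y ∈ ℝ⁵ = ℝ ⊕ ℍ` on `ℍ²`. -/
def cliff (y : Fin 5 → ℝ) (q : ℍ × ℍ) : ℍ × ℍ :=
  (-(y 0) • q.1 + quat y * q.2, star (quat y) * q.1 + y 0 • q.2)

/-- The quaternionic Hopf map `S⁷ → S⁴ ⊆ ℝ ⊕ ℍ`. -/
def hopf (q : ℍ × ℍ) : Fin 5 → ℝ :=
  ![Quaternion.normSq q.2 - Quaternion.normSq q.1, (2 * (q.1 * star q.2)).re,
    (2 * (q.1 * star q.2)).imI, (2 * (q.1 * star q.2)).imJ, (2 * (q.1 * star q.2)).imK]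

/-- The projection `P → Λ²₋(S⁴)`, sending `(q, x)` to the two-form
`β(u, w) = ⟨x, (u·q)^* (w·q)⟩` at the point `hopf q`. The point `(q, x)` lies at fibre distance
`s = |x|` from the zero section. -/
def proj (p : Amb) : (Fin 5 → ℝ) × (Fin 5 → Fin 5 → ℝ) :=
  (hopf (p.1, p.2.1), fun a b =>
    inner ℝ p.2.2
      (star (cliff (Pi.single a 1) (p.1, p.2.1)).1 * (cliff (Pi.single b 1) (p.1, p.2.1)).1
        + star (cliff (Pi.single a 1) (p.1, p.2.1)).2 * (cliff (Pi.single b 1) (p.1, p.2.1)).2))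

/-- `proj : P → Λ²₋(S⁴)` is a principal `SU(2)`-bundle: the projection is smooth and onto, the
action is free, its orbits are the fibres, and the vertical vectors are the kernel of the
differential of the projection. -/
structure IsPrincipalBundle : Prop where
  act_mem : ∀ p ∈ P, ∀ h : unitary ℍ, act p h ∈ P
  smooth : ContDiff ℝ ∞ proj
  image : proj '' P = LambdaMinus
  orbits : ∀ p ∈ P, ∀ p' ∈ P, proj p = proj p' ↔ ∃ h : unitary ℍ, p' = act p h
  free : ∀ p ∈ P, ∀ h : unitary ℍ, act p h = p → h = 1
  vertical : ∀ p ∈ P, ∀ v ∈ tangentP p,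
    fderiv ℝ proj p v = 0 ↔ ∃ ζ : ℍ, ζ.re = 0 ∧ v = fundamental p ζ

/-- A smooth connection on `P`: an `𝔰𝔲(2)`-valued one-form on `P` which is equivariant and
reproduces the generators of the fundamental vector fields. -/
structure Connection where
  form : Amb → Amb →L[ℝ] ℍ
  smooth : ContDiff ℝ ∞ form
  imaginary : ∀ p ∈ P, ∀ v ∈ tangentP p, (form p v).re = 0
  equivariant : ∀ p ∈ P, ∀ v ∈ tangentP p, ∀ h : unitary ℍ,
    form (act p h) (act v h) = star (h : ℍ) * form p v * h
  fundamental : ∀ p ∈ P, ∀ ζ : ℍ, ζ.re = 0 → form p (fundamental p ζ) = ζ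

/-! ### The four-form of the Bryant-Salamon structure on all of `Λ²₋(S⁴)`, pulled back to `P` -/

/-- The one-form `q^* dq` on `P`, the connection form of the Hopf bundle `S⁷ → S⁴`. -/
def hopfForm (p : Amb) : Amb →L[ℝ] ℍ :=
  (ContinuousLinearMap.mul ℝ ℍ (star p.1)) ∘L ContinuousLinearMap.fst ℝ ℍ (ℍ × ℍ)
    + (ContinuousLinearMap.mul ℝ ℍ (star p.2.1)) ∘L
      (ContinuousLinearMap.fst ℝ ℍ ℍ ∘L ContinuousLinearMap.snd ℝ ℍ (ℍ × ℍ))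

/-- The component `i` of the covariant differential `Dx = dx + [q^* dq, x]` of the tautological
section of `Λ²₋`. -/
def Dx (i : Fin 3) (p : Amb) : Amb →L[ℝ] ℝ :=
  (innerSL ℝ (T i)) ∘L
    ((ContinuousLinearMap.snd ℝ ℍ ℍ ∘L ContinuousLinearMap.snd ℝ ℍ (ℍ × ℍ))
      + ((ContinuousLinearMap.mul ℝ ℍ).flip p.2.2 - ContinuousLinearMap.mul ℝ ℍ p.2.2) ∘L
        hopfForm p)

/-- The horizontal two-forms `Ωᵢ` on `P`: the curvature of `q^* dq` is `½ ∑ Ωᵢ ⊗ Tᵢ`. -/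
def OmP (i : Fin 3) (p : Amb) : Amb [⋀^Fin 2]→ₗ[ℝ] ℝ :=
  (2 : ℝ) • ((innerSL ℝ (T i) : ℍ →L[ℝ] ℝ) : ℍ →ₗ[ℝ] ℝ).compAlternatingMap (curvature hopfForm p)

/-- The pullback to `P` of the four-form `ψ` on `Λ²₋(S⁴)`,
`-⅔ (1 + |x|²) ∑ Ωᵢ ∧ Ωᵢ - 2 ∑ Dxʲ ∧ Dxᵏ ∧ Ωᵢ`, the second sum over cyclic permutations `(i, j, k)`
of `(1, 2, 3)`. -/
def psiP (p : Amb) : Amb [⋀^Fin 4]→ₗ[ℝ] ℝ :=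
  (-(2 / 3) * (1 + ‖p.2.2‖ ^ 2) : ℝ) • ∑ i : Fin 3, rwedge (OmP i p) (OmP i p)
    - (2 : ℝ) • ∑ i : Fin 3,
      rwedge (rwedge (oneForm (Dx (i + 1) p)) (oneForm (Dx (i + 2) p))) (OmP i p)

/-- The `G₂`-instanton equation `F_A ∧ ψ = 0` on all of `Λ²₋(S⁴)`. -/
def Connection.IsG2Instanton (A : Connection) : Prop :=
  ∀ p ∈ P, ∀ v : Fin 6 → Amb, (∀ i, v i ∈ tangentP p) →
    vwedge (curvature A.form p) (psiP p) v = 0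

/-- Two points of `P` are joined by a `C¹` curve in `P` which is horizontal for the connection. -/
def Connection.HorizontallyJoined (A : Connection) (p p' : Amb) : Prop :=
  ∃ γ : ℝ → Amb, ContDiff ℝ 1 γ ∧ γ 0 = p ∧ γ 1 = p' ∧
    ∀ τ ∈ Set.Icc (0 : ℝ) 1, γ τ ∈ P ∧ A.form (γ τ) (deriv γ τ) = 0

/-- The holonomy group at `p`: those `h` for which `p` and `p · h` are joined by a piecewise `C¹`
horizontal curve. -/
def Connection.holonomy (A : Connection) (p : Amb) : Set (unitary ℍ) :=
  {h | Relation.ReflTransGen A.HorizontallyJoined p (act p h)}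

/-- A connection is irreducible if its holonomy group is the whole group `SU(2)`, that is, if it
does not reduce to a proper subgroup. -/
def Connection.IsIrreducible (A : Connection) : Prop :=
  ∀ p ∈ P, A.holonomy p = Set.univ

/-! ### Restriction to the complement of the zero section -/

/-- An isomorphism of the bundle `ℝ⁺ × P_λ → ℝ⁺ × ℂP³` with the restriction of `P` to the
complement `ℝ⁺ × ℂP³` of the zero section of `Λ²₋(S⁴)`. It is given by its values
`j(s, g)` at the points `(s, [g, 1])` of `ℝ⁺ × P_λ`, where `(s, [g]) ∈ ℝ⁺ × ℂP³` is the point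
`s · g · Ω₁` of `Λ²₋(S⁴)`. -/
structure IsBundleIso (j : ℝ × Mat → Amb) : Prop where
  smooth : ContDiffOn ℝ ∞ j (Set.Ioi 0 ×ˢ Set.univ)
  mem : ∀ s : ℝ, 0 < s → ∀ g ∈ Sp2, j (s, g) ∈ P
  equivariant : ∀ s : ℝ, 0 < s → ∀ g ∈ Sp2, ∀ h z : unitary ℍ, Commute (z : ℍ) (T 0) →
    j (s, mulDiag g h z) = act (j (s, g)) z
  covers : ∀ s : ℝ, 0 < s → ∀ g ∈ Sp2, proj (j (s, g)) = proj (g 0 1, g 1 1, s • T 0)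

end BryantSalamon

end

open BryantSalamon

namespace BryantSalamon

/-! ### Wedge products: naturality, bilinearity and low-degree formulas. -/

section Wedge

open TensorProduct

variable {V V' W₁ W₂ W₃ : Type*} [AddCommGroup V] [Module ℝ V] [AddCommGroup V'] [Module ℝ V']
  [AddCommGroup W₁] [Module ℝ W₁]
  [AddCommGroup W₂] [Module ℝ W₂] [AddCommGroup W₃] [Module ℝ W₃]

/-! On `P` let θ = q^*dq be the Hopf connection, x the tautological section, Dx = dx + [θ, x] and u
= |x|². Both signs come from the single connection `connForm` = θ + c(u)[x, Dx]. Along x = sT₁ one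
finds [x, Dx] = 4s²(ω²T₂ + ω³T₃), so the coefficient of ω²T₂ + ω³T₃ in the connection is 1 +
4s²c(s²). Requiring it to be 1/r with r = √(1+s²) forces c = -1/(4r(1+r)), which is smooth in u at u
= 0; hence the extension over the zero section. Conjugation by T₁ fixes T₁ and negates T₂ and T₃, so
the other sign is the same connection seen through another bundle isomorphism (`connForm_bundleIso`,
`exists_conjSign`).

The instanton equation reduces to algebra in degree six. With C = 1 + |x|², ψ is -⅔C ∑ Ωᵢ² - 2 ∑
Dxʲ∧Dxᵏ∧Ωᵢ, and each two-form Dxʲ∧Dxᵏ - CΩᵢ wedges with it to zero (`instantonElt_mul_psiElt`). The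
curvature is a combination of these three forms with coefficients in Im ℍ: this is vector algebra in
ℝ³ (`instanton_algebra`) together with the differential relations satisfied by c
(`connCoef_identities`). The same model forms, in the coframe `spA`, `spD`, describe ψ and the
curvature on ℝ⁺ × Sp(2) (`psi_eq_psiForm`, `instantonCurvature_eq_sum`).

For irreducibility, radial segments and great circles orthogonal to the Hopf fibres over the zero
section are horizontal. If n is quaternionically orthogonal to q it is also orthogonal to qh, so q →
n → qh realises every h in the holonomy group.

That `P` is a principal bundle onto Λ²₋ rests on two facts: x ↦ β is isometric up to scale
(`sum_betaEntries_mul`), and anti-self-duality in all oriented frames is the linear equation *(y∧β)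
= -β (`conj_skewMat_eq_dual`, `dualEntries_eq_neg`). The asymptotics follow because A - A_c is a
scalar function of s times a form independent of s. -/

theorem domCoprod_compLinearMap {ιa ιb : Type*} [Fintype ιa] [Fintype ιb] [DecidableEq ιa]
    [DecidableEq ιb] (a : V [⋀^ιa]→ₗ[ℝ] W₁) (b : V [⋀^ιb]→ₗ[ℝ] W₂) (L : V' →ₗ[ℝ] V) :
    (a.domCoprod b).compLinearMap L = (a.compLinearMap L).domCoprod (b.compLinearMap L) := by
  ext v
  simp only [AlternatingMap.compLinearMap_apply, AlternatingMap.domCoprod_apply, sum_apply]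
  refine Finset.sum_congr rfl fun σ _ => ?_
  induction σ using Quotient.inductionOn'
  rfl

/-- The identities between forms hold on tangent vectors only, so they are proved after pulling back
along the inclusion of the tangent space; this makes that compatible with products. -/
theorem wedge_compLinearMap (B : W₁ →ₗ[ℝ] W₂ →ₗ[ℝ] W₃) {p q : ℕ} (a : V [⋀^Fin p]→ₗ[ℝ] W₁)
    (b : V [⋀^Fin q]→ₗ[ℝ] W₂) (L : V' →ₗ[ℝ] V) :
    (wedge B a b).compLinearMap L = wedge B (a.compLinearMap L) (b.compLinearMap L) := by
  unfold wedge
  rw [← domCoprod_compLinearMap]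
  rfl

theorem wedge_eq_domCoprod' (B : W₁ →ₗ[ℝ] W₂ →ₗ[ℝ] W₃) {p q : ℕ} (a : V [⋀^Fin p]→ₗ[ℝ] W₁)
    (b : V [⋀^Fin q]→ₗ[ℝ] W₂) :
    wedge B a b = ((TensorProduct.lift B).compAlternatingMap
      (AlternatingMap.domCoprod' (a ⊗ₜ b))).domDomCongr finSumFinEquiv := rfl

theorem wedge_add_left (B : W₁ →ₗ[ℝ] W₂ →ₗ[ℝ] W₃) {p q : ℕ} (a a' : V [⋀^Fin p]→ₗ[ℝ] W₁)
    (b : V [⋀^Fin q]→ₗ[ℝ] W₂) : wedge B (a + a') b = wedge B a b + wedge B a' b := by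
  simp only [wedge_eq_domCoprod', TensorProduct.add_tmul, map_add]
  ext v; simp

theorem wedge_add_right (B : W₁ →ₗ[ℝ] W₂ →ₗ[ℝ] W₃) {p q : ℕ} (a : V [⋀^Fin p]→ₗ[ℝ] W₁)
    (b b' : V [⋀^Fin q]→ₗ[ℝ] W₂) : wedge B a (b + b') = wedge B a b + wedge B a b' := by
  simp only [wedge_eq_domCoprod', TensorProduct.tmul_add, map_add]
  ext v; simp

theorem wedge_smul_left (B : W₁ →ₗ[ℝ] W₂ →ₗ[ℝ] W₃) {p q : ℕ} (c : ℝ) (a : V [⋀^Fin p]→ₗ[ℝ] W₁)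
    (b : V [⋀^Fin q]→ₗ[ℝ] W₂) : wedge B (c • a) b = c • wedge B a b := by
  simp only [wedge_eq_domCoprod', ← TensorProduct.smul_tmul', map_smul]
  ext v; simp

theorem wedge_smul_right (B : W₁ →ₗ[ℝ] W₂ →ₗ[ℝ] W₃) {p q : ℕ} (c : ℝ) (a : V [⋀^Fin p]→ₗ[ℝ] W₁)
    (b : V [⋀^Fin q]→ₗ[ℝ] W₂) : wedge B a (c • b) = c • wedge B a b := by
  simp only [wedge_eq_domCoprod', TensorProduct.tmul_smul, map_smul]
  ext v; simp

/-- The wedge product as a bilinear map. -/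
noncomputable def wedgeₗ (B : W₁ →ₗ[ℝ] W₂ →ₗ[ℝ] W₃) (p q : ℕ) :
    (V [⋀^Fin p]→ₗ[ℝ] W₁) →ₗ[ℝ] (V [⋀^Fin q]→ₗ[ℝ] W₂) →ₗ[ℝ] V [⋀^Fin (p + q)]→ₗ[ℝ] W₃ :=
  LinearMap.mk₂ ℝ (wedge B) (wedge_add_left B) (wedge_smul_left B) (wedge_add_right B)
    (wedge_smul_right B)

theorem wedge_one_one_apply (B : W₁ →ₗ[ℝ] W₂ →ₗ[ℝ] W₃) (a : V [⋀^Fin 1]→ₗ[ℝ] W₁)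
    (b : V [⋀^Fin 1]→ₗ[ℝ] W₂) (v : Fin 2 → V) :
    wedge B a b v = B (a ![v 0]) (b ![v 1]) - B (a ![v 1]) (b ![v 0]) := by
  -- For two one-forms the factorials are 1, so the shuffle sum is the full alternating sum over the
  -- two permutations.
  have h := MultilinearMap.domCoprod_alternization_eq a b
  simp only [Fintype.card_fin, Nat.factorial_one, mul_one, one_smul] at h
  simp only [wedge, ← h]
  simp only [AlternatingMap.domDomCongr_apply, LinearMap.compAlternatingMap_apply,
    MultilinearMap.alternatization_apply, map_sum]
  rw [← Equiv.sum_comp (Equiv.permCongr finSumFinEquiv.symm)]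
  rw [show (Finset.univ : Finset (Equiv.Perm (Fin 2))) = {1, Equiv.swap 0 1} by decide]
  rw [Finset.sum_pair (by decide)]
  have h0 : ∀ u : Fin 1 → V, u = ![u 0] := fun u => by ext i; fin_cases i; rfl
  have e1 : (Equiv.permCongr finSumFinEquiv.symm) (1 : Equiv.Perm (Fin (1 + 1))) = 1 := by
    ext i; simp
  have e2 : Equiv.Perm.sign ((Equiv.permCongr finSumFinEquiv.symm)
    (Equiv.swap (0 : Fin (1 + 1)) 1)) = -1 := by
      rw [Equiv.Perm.sign_permCongr, Equiv.Perm.sign_swap (by decide)]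
  erw [e1, e2]
  simp only [Equiv.Perm.sign_one, one_smul, MultilinearMap.domDomCongr_apply,
    MultilinearMap.domCoprod_apply, Units.neg_smul, map_neg, TensorProduct.lift.tmul,
    AlternatingMap.coe_multilinearMap]
  have f1 : (fun i : Fin 1 => (v ∘ finSumFinEquiv) ((1 : Equiv.Perm (Fin 1 ⊕ Fin 1)) (Sum.inl i)))
    = ![v 0] := by funext i; fin_cases i; rfl
  have f2 : (fun i : Fin 1 => (v ∘ finSumFinEquiv) ((1 : Equiv.Perm (Fin 1 ⊕ Fin 1)) (Sum.inr i)))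
    = ![v 1] := by funext i; fin_cases i; rfl
  have f3 : (fun i : Fin 1 => (v ∘ finSumFinEquiv)
    ((finSumFinEquiv.symm.permCongr (Equiv.swap (0 : Fin (1 + 1)) 1)) (Sum.inl i)))
    = ![v 1] := by funext i; fin_cases i; rfl
  have f4 : (fun i : Fin 1 => (v ∘ finSumFinEquiv)
    ((finSumFinEquiv.symm.permCongr (Equiv.swap (0 : Fin (1 + 1)) 1)) (Sum.inr i)))
    = ![v 0] := by funext i; fin_cases i; rfl
  erw [f1, f2, f3, f4]
  rw [sub_eq_add_neg]

theorem rwedge_compLinearMap {p q : ℕ} (a : V [⋀^Fin p]→ₗ[ℝ] ℝ)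
    (b : V [⋀^Fin q]→ₗ[ℝ] ℝ) (L : V' →ₗ[ℝ] V) :
    (rwedge a b).compLinearMap L = rwedge (a.compLinearMap L) (b.compLinearMap L) :=
  wedge_compLinearMap _ a b L

theorem vwedge_compLinearMap {p q : ℕ} (a : V [⋀^Fin p]→ₗ[ℝ] W₁)
    (b : V [⋀^Fin q]→ₗ[ℝ] ℝ) (L : V' →ₗ[ℝ] V) :
    (vwedge a b).compLinearMap L = vwedge (a.compLinearMap L) (b.compLinearMap L) :=
  wedge_compLinearMap _ a b L

theorem rwedge_one_one_apply (a b : V [⋀^Fin 1]→ₗ[ℝ] ℝ) (v : Fin 2 → V) :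
    rwedge a b v = a ![v 0] * b ![v 1] - a ![v 1] * b ![v 0] :=
  wedge_one_one_apply _ a b v

theorem vwedge_tens {p q : ℕ} (a : V [⋀^Fin p]→ₗ[ℝ] ℝ) (b : V [⋀^Fin q]→ₗ[ℝ] ℝ) (T : W₁) :
    vwedge (tens a T) b = tens (rwedge a b) T := by
  unfold vwedge rwedge tens wedge
  ext v
  simp only [AlternatingMap.domDomCongr_apply, LinearMap.compAlternatingMap_apply,
    AlternatingMap.domCoprod_apply, sum_apply, map_sum, LinearMap.toSpanSingleton_apply]
  refine Finset.sum_congr rfl fun σ _ => ?_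
  induction σ using Quotient.inductionOn' with | h σ => ?_
  simp only [AlternatingMap.domCoprod.summand_mk'']
  rcases Int.units_eq_one_or (Equiv.Perm.sign σ) with h | h <;>
    simp [h, mul_smul, smul_comm (a _) (b _)]

theorem vwedge_sum {ι : Type*} (s : Finset ι) {p q : ℕ} (a : ι → V [⋀^Fin p]→ₗ[ℝ] W₁)
    (b : V [⋀^Fin q]→ₗ[ℝ] ℝ) : vwedge (∑ i ∈ s, a i) b = ∑ i ∈ s, vwedge (a i) b := by
  have := congrArg (fun f => f b)
    (map_sum (wedgeₗ (V := V) (LinearMap.lsmul ℝ W₁).flip p q) a s)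
  simp only [LinearMap.sum_apply] at this
  exact this

/-! ### Decomposable forms and computation in the exterior algebra. -/

theorem det_pi_apply {n : ℕ} (α : Fin n → Module.Dual ℝ V) (v : Fin n → V) :
    Matrix.detRowAlternating (fun j => LinearMap.pi α (v j)) =
      Matrix.detRowAlternating.compLinearMap
        (LinearMap.pi fun j => Module.Dual.eval ℝ V (v j)) α :=
  (Matrix.det_transpose (Matrix.of fun i j => α j (v i))).symm

/-- The wedge product of `n` covectors, `v ↦ det (αᵢ(vⱼ))`, as an alternating map of the
covectors. -/
noncomputable def decomposable (V : Type*) [AddCommGroup V] [Module ℝ V] (n : ℕ) :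
    (Module.Dual ℝ V) [⋀^Fin n]→ₗ[ℝ] (V [⋀^Fin n]→ₗ[ℝ] ℝ) where
  toFun α := Matrix.detRowAlternating.compLinearMap (LinearMap.pi α)
  map_update_add' α i x y := by
    ext v
    simp only [AlternatingMap.compLinearMap_apply, AlternatingMap.add_apply]
    -- After transposing the matrix the covectors are its rows, and linearity of the determinant in
    -- rows applies.
    exact (det_pi_apply _ v).trans ((AlternatingMap.map_update_add _ α i x y).trans
      (congrArg₂ (· + ·) (det_pi_apply _ v).symm (det_pi_apply _ v).symm))
  map_update_smul' α i c x := by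
    ext v
    simp only [AlternatingMap.compLinearMap_apply, AlternatingMap.smul_apply]
    exact (det_pi_apply _ v).trans ((AlternatingMap.map_update_smul _ α i c x).trans
      (congrArg (c • ·) (det_pi_apply _ v).symm))
  map_eq_zero_of_eq' α i j hij hne := by
    ext v
    exact Matrix.det_zero_of_column_eq hne fun k => congrArg (fun f => f (v k)) hij

theorem decomposable_apply {n : ℕ} (α : Fin n → Module.Dual ℝ V) (v : Fin n → V) :
    decomposable V n α v = (Matrix.of fun i j => α j (v i)).det := rfl

theorem decomposable_eq_alternatization {n : ℕ} (α : Fin n → Module.Dual ℝ V) :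
    decomposable V n α = MultilinearMap.alternatization
      ((MultilinearMap.mkPiAlgebra ℝ (Fin n) ℝ).compLinearMap α) := by
  ext v
  rw [decomposable_apply, Matrix.det_apply, MultilinearMap.alternatization_apply]
  rfl

theorem alternatization_domDomCongr' {ι κ : Type*} [Fintype ι] [Fintype κ] [DecidableEq ι]
    [DecidableEq κ] (σ : ι ≃ κ) (m : MultilinearMap ℝ (fun _ : ι => V) W₁) :
    (MultilinearMap.alternatization m).domDomCongr σ =
      MultilinearMap.alternatization (m.domDomCongr σ) := by
  ext v
  simp only [AlternatingMap.domDomCongr_apply, MultilinearMap.alternatization_apply]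
  rw [← Equiv.sum_comp (Equiv.permCongr σ)]
  refine Finset.sum_congr rfl fun τ _ => ?_
  simp [Equiv.Perm.sign_permCongr, Function.comp_def]

theorem compAlternatingMap_alternatization {ι : Type*} [Fintype ι] [DecidableEq ι]
    (f : W₁ →ₗ[ℝ] W₂) (m : MultilinearMap ℝ (fun _ : ι => V) W₁) :
    f.compAlternatingMap (MultilinearMap.alternatization m) =
      MultilinearMap.alternatization (f.compMultilinearMap m) := by
  ext v
  simp [MultilinearMap.alternatization_apply, Units.smul_def]

/-- No factorials occur, because the `domCoprod` of two alternatizations is the alternatization of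
their tensor product. -/
theorem rwedge_decomposable {p q : ℕ} (α : Fin p → Module.Dual ℝ V) (β : Fin q → Module.Dual ℝ V) :
    rwedge (decomposable V p α) (decomposable V q β) =
      decomposable V (p + q) (Fin.append α β) := by
  unfold rwedge wedge
  simp only [decomposable_eq_alternatization, ← MultilinearMap.domCoprod_alternization]
  rw [compAlternatingMap_alternatization, alternatization_domDomCongr']
  congr 1
  ext v
  simp [Fin.prod_univ_add]

/-- The form of degree `n` defined by an element of the exterior algebra of the dual space. -/
noncomputable def toForm (V : Type*) [AddCommGroup V] [Module ℝ V] (n : ℕ) :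
    ExteriorAlgebra ℝ (Module.Dual ℝ V) →ₗ[ℝ] V [⋀^Fin n]→ₗ[ℝ] ℝ :=
  ExteriorAlgebra.liftAlternating (fun i => if h : i = n then h ▸ decomposable V i else 0)

theorem toForm_ιMulti {n : ℕ} (α : Fin n → Module.Dual ℝ V) :
    toForm V n (ExteriorAlgebra.ιMulti ℝ n α) = decomposable V n α := by
  simp [toForm]

/-- `x` is a homogeneous element of the exterior algebra which represents the form `a`. -/
def Represents {n : ℕ} (x : ExteriorAlgebra ℝ (Module.Dual ℝ V)) (a : V [⋀^Fin n]→ₗ[ℝ] ℝ) : Prop :=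
  x ∈ Submodule.span ℝ (Set.range (ExteriorAlgebra.ιMulti ℝ n (M := Module.Dual ℝ V))) ∧
    toForm V n x = a

namespace Represents

variable {n p q : ℕ} {x y : ExteriorAlgebra ℝ (Module.Dual ℝ V)}

theorem add {a b : V [⋀^Fin n]→ₗ[ℝ] ℝ} (hx : Represents x a) (hy : Represents y b) :
    Represents (x + y) (a + b) :=
  ⟨add_mem hx.1 hy.1, by rw [map_add, hx.2, hy.2]⟩

theorem sub {a b : V [⋀^Fin n]→ₗ[ℝ] ℝ} (hx : Represents x a) (hy : Represents y b) :
    Represents (x - y) (a - b) :=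
  ⟨sub_mem hx.1 hy.1, by rw [map_sub, hx.2, hy.2]⟩

theorem smul {a : V [⋀^Fin n]→ₗ[ℝ] ℝ} (c : ℝ) (hx : Represents x a) :
    Represents (c • x) (c • a) :=
  ⟨Submodule.smul_mem _ _ hx.1, by rw [map_smul, hx.2]⟩

theorem sum {ι : Type*} (s : Finset ι) {x : ι → ExteriorAlgebra ℝ (Module.Dual ℝ V)}
    {a : ι → V [⋀^Fin n]→ₗ[ℝ] ℝ} (h : ∀ i ∈ s, Represents (x i) (a i)) :
    Represents (∑ i ∈ s, x i) (∑ i ∈ s, a i) :=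
  ⟨sum_mem fun i hi => (h i hi).1, by
    rw [map_sum]; exact Finset.sum_congr rfl fun i hi => (h i hi).2⟩

theorem eq {a b : V [⋀^Fin n]→ₗ[ℝ] ℝ} (hx : Represents x a) (hy : Represents y b) (h : x = y) :
    a = b := by
  rw [← hx.2, ← hy.2, h]

theorem zero : Represents (V := V) 0 (0 : V [⋀^Fin n]→ₗ[ℝ] ℝ) := ⟨zero_mem _, map_zero _⟩

/-- Reduces identities of wedge products, with their shuffle sums and reindexing of `Fin (p + q)`,
to ring identities in `ExteriorAlgebra`. Homogeneity is part of `Represents` because `toForm`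
annihilates the other degrees; the proof is span induction down to products of covectors. -/
theorem mul {a : V [⋀^Fin p]→ₗ[ℝ] ℝ} {b : V [⋀^Fin q]→ₗ[ℝ] ℝ} (hx : Represents x a)
    (hy : Represents y b) : Represents (x * y) (rwedge a b) := by
  obtain ⟨hx, rfl⟩ := hx
  obtain ⟨hy, rfl⟩ := hy
  have key : ∀ (α : Fin p → Module.Dual ℝ V) (β : Fin q → Module.Dual ℝ V),
      ExteriorAlgebra.ιMulti ℝ p α * ExteriorAlgebra.ιMulti ℝ q β =
        ExteriorAlgebra.ιMulti ℝ (p + q) (Fin.append α β) := fun α β => by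
    simp only [ExteriorAlgebra.ιMulti_apply]
    rw [← List.prod_append, ← List.ofFn_fin_append]
    congr 2
    funext i
    refine Fin.addCases (fun i => ?_) (fun i => ?_) i <;> simp
  induction hx using Submodule.span_induction with
  | mem x hx =>
    obtain ⟨α, rfl⟩ := hx
    induction hy using Submodule.span_induction with
    | mem y hy =>
      obtain ⟨β, rfl⟩ := hy
      rw [key]
      refine ⟨Submodule.subset_span ⟨_, rfl⟩, ?_⟩
      rw [toForm_ιMulti, toForm_ιMulti, toForm_ιMulti, rwedge_decomposable]
    | zero => 
      rw [mul_zero, map_zero]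
      convert zero using 1
      exact map_zero (wedgeₗ (LinearMap.mul ℝ ℝ) p q _)
    | add y y' _ _ h h' =>
      rw [mul_add, map_add]
      convert h.add h' using 1
      exact wedge_add_right _ _ _ _
    | smul c y _ h =>
      rw [mul_smul_comm, map_smul]
      convert h.smul c using 1
      exact wedge_smul_right _ _ _ _
  | zero =>
    rw [zero_mul, map_zero]
    convert zero using 1
    exact LinearMap.map_zero₂ (wedgeₗ (LinearMap.mul ℝ ℝ) p q) _
  | add y y' _ _ h h' =>
    rw [add_mul, map_add]
    convert h.add h' using 1
    exact wedge_add_left _ _ _ _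
  | smul c y _ h =>
    rw [smul_mul_assoc, map_smul]
    convert h.smul c using 1
    exact wedge_smul_left _ _ _ _

theorem one (α : Module.Dual ℝ V) :
    Represents (ExteriorAlgebra.ι ℝ α) (AlternatingMap.ofSubsingleton ℝ V ℝ (0 : Fin 1) α) := by
  have h : ExteriorAlgebra.ι ℝ α = ExteriorAlgebra.ιMulti ℝ 1 (fun _ => α) := by
    simp [ExteriorAlgebra.ιMulti_apply]
  rw [h]
  refine ⟨Submodule.subset_span ⟨_, rfl⟩, ?_⟩
  rw [toForm_ιMulti]
  ext v
  simp [decomposable_apply]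

end Represents

/-! ### The algebraic instanton identity -/

section Algebra

variable {M : Type*} [AddCommGroup M] [Module ℝ M]

open ExteriorAlgebra

theorem ι_swap (x y : M) : ι ℝ x * ι ℝ y = -(ι ℝ y * ι ℝ x) :=
  eq_neg_of_add_eq_zero_left (ι_add_mul_swap x y)

theorem ι_swap_assoc (x y : M) (z : ExteriorAlgebra ℝ M) :
    ι ℝ x * (ι ℝ y * z) = -(ι ℝ y * (ι ℝ x * z)) := by
  rw [← mul_assoc, ι_swap, neg_mul, mul_assoc]

theorem ι_sq_assoc (x : M) (z : ExteriorAlgebra ℝ M) : ι ℝ x * (ι ℝ x * z) = 0 := by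
  rw [← mul_assoc, ι_sq_zero, zero_mul]

/-- Elements of even degree are central: moving a vector past two others changes the sign twice. -/
theorem commute_ι_mul_ι (x y z w : M) : Commute (ι ℝ x * ι ℝ y) (ι ℝ z * ι ℝ w) := by
  have h : ∀ z : M, Commute (ι ℝ x * ι ℝ y) (ι ℝ z) := fun z => by
    unfold Commute SemiconjBy
    rw [mul_assoc, ι_swap y z, mul_neg, ι_swap_assoc x z, neg_neg]
  exact (h z).mul_right (h w)

/-- The elements `Ω₁, Ω₂, Ω₃` of the exterior algebra defined by four vectors. -/
noncomputable def asdElt (a : Fin 4 → M) : Fin 3 → ExteriorAlgebra ℝ M :=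
  ![ι ℝ (a 0) * ι ℝ (a 1) - ι ℝ (a 2) * ι ℝ (a 3), ι ℝ (a 0) * ι ℝ (a 2) - ι ℝ (a 3) * ι ℝ (a 1),
    ι ℝ (a 0) * ι ℝ (a 3) - ι ℝ (a 1) * ι ℝ (a 2)]

/-- The bivectors `d₂d₃, d₃d₁, d₁d₂`. -/
noncomputable def bivec (d : Fin 3 → M) (i : Fin 3) : ExteriorAlgebra ℝ M :=
  ι ℝ (d (i + 1)) * ι ℝ (d (i + 2))

/-- The element of the exterior algebra defining the four-form of the `G₂`-structure. -/
noncomputable def psiElt (c : ℝ) (a : Fin 4 → M) (d : Fin 3 → M) : ExteriorAlgebra ℝ M :=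
  (-(2 / 3) * c : ℝ) • ∑ i : Fin 3, asdElt a i * asdElt a i
    - (2 : ℝ) • ∑ i : Fin 3, bivec d i * asdElt a i

/-- The three elements are orthogonal of equal length for the wedge pairing, which is all that the
instanton identity uses about them. The rewriting rules sort each monomial into increasing order. -/
theorem asdElt_mul (a : Fin 4 → M) (i j : Fin 3) :
    asdElt a i * asdElt a j = if i = j then
      (-2 : ℝ) • (ι ℝ (a 0) * (ι ℝ (a 1) * (ι ℝ (a 2) * ι ℝ (a 3)))) else 0 := by
  fin_cases i <;> fin_cases j <;>
  simp [asdElt, mul_sub, sub_mul, mul_add, add_mul, mul_assoc, ι_sq_assoc,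
    ι_swap (a 2) (a 1), ι_swap (a 3) (a 1), ι_swap (a 3) (a 2),
    ι_swap_assoc (a 1) (a 0), ι_swap_assoc (a 2) (a 0), ι_swap_assoc (a 3) (a 0),
    ι_swap_assoc (a 2) (a 1), ι_swap_assoc (a 3) (a 1), ι_swap_assoc (a 3) (a 2)] <;>
  module

/-- Four factors taken from three vectors contain a repetition. -/
theorem bivec_mul_bivec (d : Fin 3 → M) (i j : Fin 3) : bivec d i * bivec d j = 0 := by
  fin_cases i <;> fin_cases j <;>
  simp [bivec, mul_assoc, ι_sq_assoc, ι_swap (d 2) (d 0),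
    ι_swap (d 2) (d 1), ι_swap_assoc (d 1) (d 0), ι_swap_assoc (d 2) (d 0), ι_swap_assoc (d 2) (d 1)]

theorem commute_bivec_asdElt (a : Fin 4 → M) (d : Fin 3 → M) (i j : Fin 3) :
    Commute (bivec d i) (asdElt a j) := by
  fin_cases j <;>
  exact (commute_ι_mul_ι _ _ _ _).sub_right (commute_ι_mul_ι _ _ _ _)

/-- Six factors from four vectors. Expansion is avoided: all squares agree, so the square can be
taken at an index different from `i`, where orthogonality applies. -/
theorem asdElt_mul_sq (a : Fin 4 → M) (i j : Fin 3) :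
    asdElt a i * (asdElt a j * asdElt a j) = 0 := by
  by_cases h : i = j
  · obtain ⟨k, hk⟩ : ∃ k, j ≠ k := exists_ne j |>.imp fun k hk => hk.symm
    have e : asdElt a j * asdElt a j = asdElt a k * asdElt a k := by
      rw [asdElt_mul a j j, if_pos rfl, asdElt_mul a k k, if_pos rfl]
    rw [e, ← mul_assoc, asdElt_mul a i k, if_neg (h ▸ hk), zero_mul]
  · rw [← mul_assoc, asdElt_mul a i j, if_neg h, zero_mul]

/-- Only multiples of `bivec d i * (asdElt a i * asdElt a i)` survive. The first factor contributes
-(2/3)c · 3 = -2c, since the three squares are equal, and the second (-c)(-2) = 2c. -/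
theorem instantonElt_mul_psiElt (c : ℝ) (a : Fin 4 → M) (d : Fin 3 → M) (i : Fin 3) :
    (bivec d i - c • asdElt a i) * psiElt c a d = 0 := by
  have h1 : ∑ j : Fin 3, bivec d i * (asdElt a j * asdElt a j) =
      (3 : ℝ) • (bivec d i * (asdElt a i * asdElt a i)) := by
    simp only [asdElt_mul, if_true, Finset.sum_const, Finset.card_univ, Fintype.card_fin]
    rw [← Nat.cast_smul_eq_nsmul ℝ]; norm_num
  have h2 : ∑ j : Fin 3, bivec d i * (bivec d j * asdElt a j) = 0 :=
    Finset.sum_eq_zero fun j _ => by rw [← mul_assoc, bivec_mul_bivec, zero_mul]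
  have h3 : ∑ j : Fin 3, asdElt a i * (asdElt a j * asdElt a j) = 0 :=
    Finset.sum_eq_zero fun j _ => asdElt_mul_sq a i j
  have h4 : ∑ j : Fin 3, asdElt a i * (bivec d j * asdElt a j) =
      bivec d i * (asdElt a i * asdElt a i) := by
    rw [Finset.sum_eq_single i]
    · rw [← mul_assoc, ← (commute_bivec_asdElt a d i i).eq, mul_assoc]
    · intro j _ hj
      rw [← mul_assoc, ← (commute_bivec_asdElt a d j i).eq, mul_assoc, asdElt_mul,
        if_neg hj.symm, mul_zero]
    · simp
  rw [psiElt, sub_mul, mul_sub, mul_sub, smul_mul_assoc, smul_mul_assoc]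
  simp only [mul_smul_comm, Finset.mul_sum, h1, h2, h3, h4]
  module

end Algebra

theorem vwedge_eq_zero_of_represents {c : ℝ} {a : Fin 4 → Module.Dual ℝ V}
    {d : Fin 3 → Module.Dual ℝ V} {φ : Fin 3 → V [⋀^Fin 2]→ₗ[ℝ] ℝ} {ψ : V [⋀^Fin 4]→ₗ[ℝ] ℝ}
    (hφ : ∀ i, Represents (bivec d i - c • asdElt a i) (φ i)) (hψ : Represents (psiElt c a d) ψ)
    (B : Fin 3 → W₁) : vwedge (∑ i, tens (φ i) (B i)) ψ = 0 := by
  rw [vwedge_sum]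
  refine Finset.sum_eq_zero fun i _ => ?_
  rw [vwedge_tens]
  have h : rwedge (φ i) ψ = 0 :=
    ((hφ i).mul hψ).eq Represents.zero (instantonElt_mul_psiElt c a d i)
  rw [h]
  ext v
  simp [tens]

end Wedge

/-! ### The bundle `P → Λ²₋(S⁴)` in coordinates -/

section Coordinates

theorem quaternion_inner_eq (x y : ℍ) :
    inner ℝ x y = x.re * y.re + x.imI * y.imI + x.imJ * y.imJ + x.imK * y.imK := by
  rw [Quaternion.inner_def]; simp [Quaternion.re_mul]

theorem quat_re (y : Fin 5 → ℝ) : (quat y).re = y 1 := rfl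
theorem quat_imI (y : Fin 5 → ℝ) : (quat y).imI = y 2 := rfl
theorem quat_imJ (y : Fin 5 → ℝ) : (quat y).imJ = y 3 := rfl
theorem quat_imK (y : Fin 5 → ℝ) : (quat y).imK = y 4 := rfl

/-- The skew-symmetric `5 × 5` matrix with the given entries above the diagonal. -/
def skewMat (c : Fin 10 → ℝ) : Matrix (Fin 5) (Fin 5) ℝ :=
  !![0, c 0, c 1, c 2, c 3; -c 0, 0, c 4, c 5, c 6; -c 1, -c 4, 0, c 7, c 8;
    -c 2, -c 5, -c 7, 0, c 9; -c 3, -c 6, -c 8, -c 9, 0]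

/-- The entries of a matrix above the diagonal. -/
def upperEntries (B : Matrix (Fin 5) (Fin 5) ℝ) : Fin 10 → ℝ :=
  ![B 0 1, B 0 2, B 0 3, B 0 4, B 1 2, B 1 3, B 1 4, B 2 3, B 2 4, B 3 4]

theorem skewMat_upperEntries {B : Matrix (Fin 5) (Fin 5) ℝ} (h : Bᵀ = -B) :
    skewMat (upperEntries B) = B := by
  have h' : ∀ i j, B j i = -B i j := fun i j => congrFun (congrFun h i) j
  have h0 : ∀ i, B i i = 0 := fun i => by linarith [h' i i]
  ext i j
  fin_cases i <;> fin_cases j <;> simp [skewMat, upperEntries, h0] <;> exact (h' _ _).symm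

theorem skewMat_transpose (c : Fin 10 → ℝ) : (skewMat c)ᵀ = -skewMat c := by
  ext i j
  fin_cases i <;> fin_cases j <;> simp [skewMat]

/-- The entries above the diagonal of the two-form `⟨x, (u·q)^* (w·q)⟩`, where `q = (a, b)`. -/
def betaEntries (a b x : ℍ) : Fin 10 → ℝ :=
  ![
    x.imI * (-(2 * a.re * b.imI) + 2 * a.imI * b.re + 2 * a.imJ * b.imK - 2 * a.imK * b.imJ) + x.imJ * (-(2 * a.re * b.imJ) - 2 * a.imI * b.imK + 2 * a.imJ * b.re + 2 * a.imK * b.imI) + x.imK * (-(2 * a.re * b.imK) + 2 * a.imI * b.imJ - 2 * a.imJ * b.imI + 2 * a.imK * b.re),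
    x.imI * (-(2 * a.re * b.re) - 2 * a.imI * b.imI + 2 * a.imJ * b.imJ + 2 * a.imK * b.imK) + x.imJ * (2 * a.re * b.imK - 2 * a.imI * b.imJ - 2 * a.imJ * b.imI + 2 * a.imK * b.re) + x.imK * (-(2 * a.re * b.imJ) - 2 * a.imI * b.imK - 2 * a.imJ * b.re - 2 * a.imK * b.imI),
    x.imI * (-(2 * a.re * b.imK) - 2 * a.imI * b.imJ - 2 * a.imJ * b.imI - 2 * a.imK * b.re) + x.imJ * (-(2 * a.re * b.re) + 2 * a.imI * b.imI - 2 * a.imJ * b.imJ + 2 * a.imK * b.imK) + x.imK * (2 * a.re * b.imI + 2 * a.imI * b.re - 2 * a.imJ * b.imK - 2 * a.imK * b.imJ),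
    x.imI * (2 * a.re * b.imJ - 2 * a.imI * b.imK + 2 * a.imJ * b.re - 2 * a.imK * b.imI) + x.imJ * (-(2 * a.re * b.imI) - 2 * a.imI * b.re - 2 * a.imJ * b.imK - 2 * a.imK * b.imJ) + x.imK * (-(2 * a.re * b.re) + 2 * a.imI * b.imI + 2 * a.imJ * b.imJ - 2 * a.imK * b.imK),
    x.imI * (-(a.re ^ 2) - a.imI ^ 2 + a.imJ ^ 2 + a.imK ^ 2 + b.re ^ 2 + b.imI ^ 2 - b.imJ ^ 2 - b.imK ^ 2) + x.imJ * (2 * a.re * a.imK - 2 * a.imI * a.imJ - 2 * b.re * b.imK + 2 * b.imI * b.imJ) + x.imK * (-(2 * a.re * a.imJ) - 2 * a.imI * a.imK + 2 * b.re * b.imJ + 2 * b.imI * b.imK),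
    x.imI * (-(2 * a.re * a.imK) - 2 * a.imI * a.imJ + 2 * b.re * b.imK + 2 * b.imI * b.imJ) + x.imJ * (-(a.re ^ 2) + a.imI ^ 2 - a.imJ ^ 2 + a.imK ^ 2 + b.re ^ 2 - b.imI ^ 2 + b.imJ ^ 2 - b.imK ^ 2) + x.imK * (2 * a.re * a.imI - 2 * a.imJ * a.imK - 2 * b.re * b.imI + 2 * b.imJ * b.imK),
    x.imI * (2 * a.re * a.imJ - 2 * a.imI * a.imK - 2 * b.re * b.imJ + 2 * b.imI * b.imK) + x.imJ * (-(2 * a.re * a.imI) - 2 * a.imJ * a.imK + 2 * b.re * b.imI + 2 * b.imJ * b.imK) + x.imK * (-(a.re ^ 2) + a.imI ^ 2 + a.imJ ^ 2 - a.imK ^ 2 + b.re ^ 2 - b.imI ^ 2 - b.imJ ^ 2 + b.imK ^ 2),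
    x.imI * (2 * a.re * a.imJ - 2 * a.imI * a.imK + 2 * b.re * b.imJ - 2 * b.imI * b.imK) + x.imJ * (-(2 * a.re * a.imI) - 2 * a.imJ * a.imK - 2 * b.re * b.imI - 2 * b.imJ * b.imK) + x.imK * (-(a.re ^ 2) + a.imI ^ 2 + a.imJ ^ 2 - a.imK ^ 2 - b.re ^ 2 + b.imI ^ 2 + b.imJ ^ 2 - b.imK ^ 2),
    x.imI * (2 * a.re * a.imK + 2 * a.imI * a.imJ + 2 * b.re * b.imK + 2 * b.imI * b.imJ) + x.imJ * (a.re ^ 2 - a.imI ^ 2 + a.imJ ^ 2 - a.imK ^ 2 + b.re ^ 2 - b.imI ^ 2 + b.imJ ^ 2 - b.imK ^ 2) + x.imK * (-(2 * a.re * a.imI) + 2 * a.imJ * a.imK - 2 * b.re * b.imI + 2 * b.imJ * b.imK),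
    x.imI * (-(a.re ^ 2) - a.imI ^ 2 + a.imJ ^ 2 + a.imK ^ 2 - b.re ^ 2 - b.imI ^ 2 + b.imJ ^ 2 + b.imK ^ 2) + x.imJ * (2 * a.re * a.imK - 2 * a.imI * a.imJ + 2 * b.re * b.imK - 2 * b.imI * b.imJ) + x.imK * (-(2 * a.re * a.imJ) - 2 * a.imI * a.imK - 2 * b.re * b.imJ - 2 * b.imI * b.imK)]

set_option maxHeartbeats 1000000 in
-- Interchanging u and w conjugates (u·q)^*(w·q), so its imaginary part is skew; an imaginary x sees
-- only that part.
theorem proj_snd (p : Amb) (hx : p.2.2.re = 0) :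
    (proj p).2 = skewMat (betaEntries p.1 p.2.1 p.2.2) := by
  ext i j
  simp only [proj, quaternion_inner_eq, hx, zero_mul, zero_add]
  fin_cases i <;> fin_cases j <;>
  · simp [cliff, quat_re, quat_imI, quat_imJ, quat_imK, skewMat, betaEntries]
    try ring

theorem hopf_eq (a b : ℍ) : hopf (a, b) =
    ![b.re ^ 2 + b.imI ^ 2 + b.imJ ^ 2 + b.imK ^ 2 - (a.re ^ 2 + a.imI ^ 2 + a.imJ ^ 2 + a.imK ^ 2),
      2 * (a.re * b.re + a.imI * b.imI + a.imJ * b.imJ + a.imK * b.imK),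
      2 * (-(a.re * b.imI) + a.imI * b.re - a.imJ * b.imK + a.imK * b.imJ),
      2 * (-(a.re * b.imJ) + a.imI * b.imK + a.imJ * b.re - a.imK * b.imI),
      2 * (-(a.re * b.imK) - a.imI * b.imJ + a.imJ * b.imI + a.imK * b.re)] := by
  have h : (2 : ℍ) * (a * star b) = (2 : ℝ) • (a * star b) := by
    rw [two_smul, two_mul]
  simp only [hopf, h, Quaternion.normSq_def']
  ext i
  fin_cases i <;> simp <;> try ring

end Coordinates

/-! ### Smoothness, invariance, orbits and freeness for the projection of `P`. -/

section PrincipalBundle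

/-- Quaternionic conjugation as a continuous linear map. -/
noncomputable def starCLM : ℍ →L[ℝ] ℍ :=
  LinearMap.toContinuousLinearMap
    { toFun := star
      map_add' := star_add
      map_smul' := fun c q => Quaternion.star_smul c q }

theorem contDiff_quaternion_star {E : Type*} [NormedAddCommGroup E] [NormedSpace ℝ E] {n : ℕ∞ω}
    {φ : E → ℍ} (h : ContDiff ℝ n φ) : ContDiff ℝ n (fun x => star (φ x)) :=
  starCLM.contDiff.comp h

theorem contDiff_quaternion_re {E : Type*} [NormedAddCommGroup E] [NormedSpace ℝ E] {n : ℕ∞ω}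
    {φ : E → ℍ} (h : ContDiff ℝ n φ) : ContDiff ℝ n (fun x => (φ x).re) := by
  have : ContDiff ℝ n (fun x => inner ℝ (1 : ℍ) (φ x)) := contDiff_const.inner ℝ h
  simpa [quaternion_inner_eq] using this

theorem inner_T (i : Fin 3) (q : ℍ) : inner ℝ (T i) q = ![q.imI, q.imJ, q.imK] i := by
  rw [quaternion_inner_eq]
  fin_cases i <;> simp [T]

theorem contDiff_quaternion_im {E : Type*} [NormedAddCommGroup E] [NormedSpace ℝ E] {n : ℕ∞ω}
    {φ : E → ℍ} (h : ContDiff ℝ n φ) (i : Fin 3) :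
    ContDiff ℝ n (fun x => ![(φ x).imI, (φ x).imJ, (φ x).imK] i) := by
  simp only [← inner_T]
  exact contDiff_const.inner ℝ h

theorem contDiff_normSq {E : Type*} [NormedAddCommGroup E] [NormedSpace ℝ E] {n : ℕ∞ω}
    {φ : E → ℍ} (h : ContDiff ℝ n φ) : ContDiff ℝ n (fun x => Quaternion.normSq (φ x)) := by
  simp only [← Quaternion.inner_self]
  exact h.inner ℝ h

theorem contDiff_proj : ContDiff ℝ ∞ proj := by
  have h1 : ContDiff ℝ ∞ (fun p : Amb => p.1) := contDiff_fst
  have h2 : ContDiff ℝ ∞ (fun p : Amb => p.2.1) := contDiff_fst.comp contDiff_snd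
  have h3 : ContDiff ℝ ∞ (fun p : Amb => p.2.2) := contDiff_snd.comp contDiff_snd
  have h4 : ContDiff ℝ ∞ (fun p : Amb => 2 * (p.1 * star p.2.1)) :=
    contDiff_const.mul (h1.mul (contDiff_quaternion_star h2))
  refine ContDiff.prodMk (contDiff_pi.2 fun i => ?_) (contDiff_pi.2 fun i => contDiff_pi.2 fun j => ?_)
  · fin_cases i
    · exact (contDiff_normSq h2).sub (contDiff_normSq h1)
    · exact contDiff_quaternion_re h4
    · exact contDiff_quaternion_im h4 0
    · exact contDiff_quaternion_im h4 1
    · exact contDiff_quaternion_im h4 2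
  · have hc : ∀ y, ContDiff ℝ ∞ (fun p : Amb => cliff y (p.1, p.2.1)) := fun y =>
      ((h1.const_smul _).add (contDiff_const.mul h2)).prodMk
        ((contDiff_const.mul h1).add (h2.const_smul _))
    exact h3.inner ℝ (((contDiff_quaternion_star (hc _).fst).mul (hc _).fst).add
      ((contDiff_quaternion_star (hc _).snd).mul (hc _).snd))

theorem cliff_mul (y : Fin 5 → ℝ) (a b h : ℍ) :
    cliff y (a * h, b * h) = ((cliff y (a, b)).1 * h, (cliff y (a, b)).2 * h) := by
  simp [cliff, add_mul, mul_assoc]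

theorem star_mul_self_unitary (h : unitary ℍ) : star (h : ℍ) * h = 1 :=
  Unitary.coe_star_mul_self h

theorem mul_star_self_unitary (h : unitary ℍ) : (h : ℍ) * star (h : ℍ) = 1 :=
  Unitary.coe_mul_star_self h

theorem normSq_unitary (h : unitary ℍ) : Quaternion.normSq (h : ℍ) = 1 := by
  have := Quaternion.self_mul_star (h : ℍ)
  rw [mul_star_self_unitary] at this
  exact Quaternion.coe_injective this.symm

theorem hopf_mul (a b : ℍ) (h : unitary ℍ) : hopf (a * h, b * h) = hopf (a, b) := by
  have e : a * h * star (b * (h : ℍ)) = a * star b := by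
    rw [star_mul, mul_assoc, ← mul_assoc (h : ℍ), mul_star_self_unitary, one_mul]
  simp only [hopf, e, map_mul, normSq_unitary, mul_one]

theorem re_mul_comm (x y : ℍ) : (x * y).re = (y * x).re := by
  simp [Quaternion.re_mul]; ring

theorem inner_conj (x y : ℍ) (h : unitary ℍ) :
    inner ℝ (star (h : ℍ) * x * h) (star (h : ℍ) * y * h) = inner ℝ x y := by
  simp only [Quaternion.inner_def, star_mul, star_star]
  rw [show star (h : ℍ) * x * h * (star (h : ℍ) * (star y * h)) = star (h : ℍ) * (x * star y * h) by
    rw [mul_assoc _ (h : ℍ), ← mul_assoc (h : ℍ), mul_star_self_unitary, one_mul]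
    simp only [mul_assoc]]
  rw [re_mul_comm, mul_assoc, mul_star_self_unitary, mul_one]

theorem proj_act (p : Amb) (h : unitary ℍ) : proj (act p h) = proj p := by
  refine Prod.ext (hopf_mul _ _ h) ?_
  funext i j
  simp only [proj, act, cliff_mul, star_mul]
  rw [← inner_conj p.2.2 _ h]
  congr 1
  simp only [mul_add, add_mul, mul_assoc]

theorem re_conj (x : ℍ) (h : unitary ℍ) : (star (h : ℍ) * x * h).re = x.re := by
  rw [re_mul_comm, ← mul_assoc, mul_star_self_unitary, one_mul]

theorem act_mem_P {p : Amb} (hp : p ∈ P) (h : unitary ℍ) : act p h ∈ P := by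
  refine ⟨?_, ?_⟩
  · simp only [act, map_mul, normSq_unitary, mul_one]; exact hp.1
  · simp only [act]; rw [re_conj]; exact hp.2

/-- Up to the scale 2|q|⁴ the map x ↦ β is an isometric embedding of Im ℍ, so x is recovered by
pairing with the images of the basis. This gives injectivity, and the factor 1/2 in
`exists_betaEntries_eq`. -/
theorem sum_betaEntries_mul (a b x : ℍ) (i : Fin 3) :
    ∑ n, betaEntries a b x n * betaEntries a b (T i) n =
      2 * (Quaternion.normSq a + Quaternion.normSq b) ^ 2 * ![x.imI, x.imJ, x.imK] i := by
  fin_cases i <;>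
  · simp [Fin.sum_univ_succ, betaEntries, T, Quaternion.normSq_def']
    ring

theorem skewMat_injective : Function.Injective skewMat := fun c c' h => by
  have h' : ∀ i j, skewMat c i j = skewMat c' i j := fun i j => congrFun (congrFun h i) j
  funext n
  fin_cases n
  exacts [h' 0 1, h' 0 2, h' 0 3, h' 0 4, h' 1 2, h' 1 3, h' 1 4, h' 2 3, h' 2 4, h' 3 4]

theorem betaEntries_injective {a b x x' : ℍ} (hq : Quaternion.normSq a + Quaternion.normSq b = 1)
    (hx : x.re = 0) (hx' : x'.re = 0) (h : betaEntries a b x = betaEntries a b x') : x = x' := by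
  have key : ∀ i : Fin 3, ![x.imI, x.imJ, x.imK] i = ![x'.imI, x'.imJ, x'.imK] i := fun i => by
    have h1 := sum_betaEntries_mul a b x i
    have h2 := sum_betaEntries_mul a b x' i
    rw [h, h2, hq] at h1
    linarith
  exact Quaternion.ext _ _ (hx.trans hx'.symm) (key 0) (key 1) (key 2)

theorem hopf_eq_iff {a b a' b' : ℍ} (hq : Quaternion.normSq a + Quaternion.normSq b = 1)
    (hq' : Quaternion.normSq a' + Quaternion.normSq b' = 1) (h : hopf (a, b) = hopf (a', b')) :
    Quaternion.normSq a = Quaternion.normSq a' ∧ Quaternion.normSq b = Quaternion.normSq b' ∧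
      a * star b = a' * star b' := by
  have h0 : Quaternion.normSq b - Quaternion.normSq a =
    Quaternion.normSq b' - Quaternion.normSq a' := congrFun h 0
  have h2 : (2 : ℍ) * (a * star b) = 2 * (a' * star b') :=
    Quaternion.ext _ _ (congrFun h 1) (congrFun h 2) (congrFun h 3) (congrFun h 4)
  refine ⟨by linarith, by linarith, ?_⟩
  rw [two_mul, two_mul, ← two_smul ℝ, ← two_smul ℝ] at h2
  exact smul_right_injective ℍ (two_ne_zero : (2 : ℝ) ≠ 0) h2

theorem self_mul_star_mul (a b : ℍ) : a * (star a * b) = Quaternion.normSq a • b := by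
  rw [← mul_assoc, Quaternion.self_mul_star, Quaternion.coe_mul_eq_smul]

theorem exists_act_of_proj_eq {p p' : Amb} (hp : p ∈ P) (hp' : p' ∈ P) (h : proj p = proj p') :
    ∃ h : unitary ℍ, p' = act p h := by
  obtain ⟨ha, hb, hab⟩ := hopf_eq_iff hp.1 hp'.1 (congrArg Prod.fst h)
  have hba : p.2.1 * star p.1 = p'.2.1 * star p'.1 := by
    simpa using congrArg star hab
  -- If q' = qh then h = q^*q', because q^*q = 1; this is the only candidate for the group element.
  obtain ⟨k, hk⟩ : ∃ k : ℍ, k = star p.1 * p'.1 + star p.2.1 * p'.2.1 := ⟨_, rfl⟩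
  have h1 : p.1 * k = p'.1 := by
    rw [hk, mul_add, self_mul_star_mul, ← mul_assoc p.1, hab, mul_assoc, Quaternion.star_mul_self,
      Quaternion.mul_coe_eq_smul, ha, ← add_smul, hp'.1, one_smul]
  have h2 : p.2.1 * k = p'.2.1 := by
    rw [hk, mul_add, self_mul_star_mul, ← mul_assoc p.2.1, hba, mul_assoc, Quaternion.star_mul_self,
      Quaternion.mul_coe_eq_smul, hb, ← add_smul, hp'.1, one_smul]
  have hk1 : Quaternion.normSq k = 1 := by
    have := hp'.1
    rw [← h1, ← h2, map_mul, map_mul, ← add_mul, hp.1, one_mul] at this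
    exact this
  have hku : k ∈ unitary ℍ := by
    rw [Unitary.mem_iff, Quaternion.self_mul_star, Quaternion.star_mul_self, hk1]
    exact ⟨rfl, rfl⟩
  refine ⟨⟨k, hku⟩, ?_⟩
  -- The q-components now agree, and the x-components agree because β determines x once q is fixed.
  have hact := act_mem_P hp ⟨k, hku⟩
  have hproj : proj (act p ⟨k, hku⟩) = proj p' := (proj_act _ _).trans h
  refine Prod.ext h1.symm (Prod.ext h2.symm ?_)
  have h3 := congrArg Prod.snd hproj
  rw [proj_snd _ hact.2, proj_snd _ hp'.2] at h3
  have h4 : betaEntries (act p ⟨k, hku⟩).1 (act p ⟨k, hku⟩).2.1 (act p ⟨k, hku⟩).2.2 =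
      betaEntries p'.1 p'.2.1 p'.2.2 := skewMat_injective h3
  have e1 : (act p ⟨k, hku⟩).1 = p'.1 := h1
  have e2 : (act p ⟨k, hku⟩).2.1 = p'.2.1 := h2
  rw [e1, e2] at h4
  exact (betaEntries_injective hp'.1 hact.2 hp'.2 h4).symm

theorem act_free {p : Amb} (hp : p ∈ P) {h : unitary ℍ} (hh : act p h = p) : h = 1 := by
  have h1 : p.1 * h = p.1 := congrArg Prod.fst hh
  have h2 : p.2.1 * h = p.2.1 := congrArg (fun q => q.2.1) hh
  have h3 : (Quaternion.normSq p.1 + Quaternion.normSq p.2.1) • (h : ℍ) =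
      (Quaternion.normSq p.1 + Quaternion.normSq p.2.1) • 1 := by
    simp only [add_smul, ← Quaternion.coe_mul_eq_smul, ← Quaternion.star_mul_self, mul_assoc, h1,
      h2, mul_one]
  rw [hp.1, one_smul, one_smul] at h3
  exact Subtype.ext h3

/-- On vectors with imaginary last component the projection is polynomial, quadratic in q and linear
in x. On a line it is therefore a cubic, and its derivative is the linear coefficient. -/
theorem fderiv_apply_of_line {E F : Type*} [NormedAddCommGroup E] [NormedSpace ℝ E]
    [NormedAddCommGroup F] [NormedSpace ℝ F] {φ : E → F} {p v : E} (hφ : DifferentiableAt ℝ φ p)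
    {D D₂ D₃ : F} (h : ∀ t : ℝ, φ (p + t • v) = φ p + t • D + t ^ 2 • D₂ + t ^ 3 • D₃) :
    fderiv ℝ φ p v = D := by
  rw [← hφ.lineDeriv_eq_fderiv, lineDeriv]
  simp only [h]
  have h1 : HasDerivAt (fun t : ℝ => φ p + t • D + t ^ 2 • D₂ + t ^ 3 • D₃)
      (0 + (1 : ℝ) • D + (2 * (0 : ℝ) ^ 1 * 1) • D₂ + (3 * (0 : ℝ) ^ 2 * 1) • D₃) 0 := by
    refine HasDerivAt.add (HasDerivAt.add (HasDerivAt.add (hasDerivAt_const _ _) ?_) ?_) ?_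
    · exact (hasDerivAt_id (0 : ℝ)).smul_const D
    · exact (HasDerivAt.pow (hasDerivAt_id (0 : ℝ)) 2).smul_const D₂
    · exact (HasDerivAt.pow (hasDerivAt_id (0 : ℝ)) 3).smul_const D₃
  rw [h1.deriv]
  simp

end PrincipalBundle

/-! ### Vertical vectors: the kernel of the differential of the projection. -/

section Vertical

/-- The differential of the Hopf map. -/
noncomputable def hopfDeriv (a b a' b' : ℍ) : Fin 5 → ℝ :=
  hopf (a + a', b + b') - hopf (a, b) - hopf (a', b')

/-- The polarisation of the quadratic map `(a, b) ↦ betaEntries a b x`. -/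
noncomputable def betaPolar (a b a' b' x : ℍ) : Fin 10 → ℝ :=
  betaEntries (a + a') (b + b') x - betaEntries a b x - betaEntries a' b' x

theorem hopf_line (a b a' b' : ℍ) (t : ℝ) : hopf (a + t • a', b + t • b') =
    hopf (a, b) + t • hopfDeriv a b a' b' + t ^ 2 • hopf (a', b') := by
  simp only [hopfDeriv, hopf_eq]
  ext i
  fin_cases i <;> simp <;> ring

set_option maxHeartbeats 1000000 in
theorem betaEntries_line (a b x a' b' x' : ℍ) (t : ℝ) :
    betaEntries (a + t • a') (b + t • b') (x + t • x') =
      betaEntries a b x + t • (betaEntries a b x' + betaPolar a b a' b' x)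
        + t ^ 2 • (betaPolar a b a' b' x' + betaEntries a' b' x) + t ^ 3 • betaEntries a' b' x' := by
  simp only [betaPolar]
  ext i
  fin_cases i <;> simp [betaEntries] <;> ring

theorem skewMat_add (c c' : Fin 10 → ℝ) : skewMat (c + c') = skewMat c + skewMat c' := by
  ext i j
  fin_cases i <;> fin_cases j <;> simp [skewMat] <;> ring

theorem skewMat_smul (t : ℝ) (c : Fin 10 → ℝ) : skewMat (t • c) = t • skewMat c := by
  ext i j
  fin_cases i <;> fin_cases j <;> simp [skewMat]

theorem skewMat_zero : skewMat 0 = 0 := by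
  simpa using skewMat_smul 0 0

theorem fderiv_proj {p v : Amb} (hp : p.2.2.re = 0) (hv : v.2.2.re = 0) :
    fderiv ℝ proj p v = (hopfDeriv p.1 p.2.1 v.1 v.2.1,
      skewMat (betaEntries p.1 p.2.1 v.2.2 + betaPolar p.1 p.2.1 v.1 v.2.1 p.2.2)) := by
  refine fderiv_apply_of_line (contDiff_proj.differentiable (by simp) p)
    (D₂ := (hopf (v.1, v.2.1),
      skewMat (betaPolar p.1 p.2.1 v.1 v.2.1 v.2.2 + betaEntries v.1 v.2.1 p.2.2)))
    (D₃ := (0, skewMat (betaEntries v.1 v.2.1 v.2.2))) fun t => ?_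
  refine Prod.ext ?_ ?_
  · simp only [Prod.fst_add, Prod.smul_fst, smul_zero, add_zero]
    exact hopf_line p.1 p.2.1 v.1 v.2.1 t
  · rw [proj_snd _ (by simp [hp, hv])]
    simp only [Prod.fst_add, Prod.snd_add, Prod.smul_fst, Prod.smul_snd]
    rw [betaEntries_line, skewMat_add, skewMat_add, skewMat_add, skewMat_smul, skewMat_smul,
      skewMat_smul, proj_snd _ hp]
    rfl

theorem hopfDeriv_mul (a b ζ : ℍ) (hζ : ζ.re = 0) : hopfDeriv a b (a * ζ) (b * ζ) = 0 := by
  simp only [hopfDeriv, hopf_eq]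
  ext i
  fin_cases i <;> simp [hζ] <;> ring

set_option maxHeartbeats 2000000 in
-- Infinitesimal form of the invariance `proj_act`: varying q by qζ is compensated by varying x by
-- [x, ζ].
theorem betaPolar_mul (a b x ζ : ℍ) (hζ : ζ.re = 0) (hx : x.re = 0) :
    betaEntries a b (x * ζ - ζ * x) + betaPolar a b (a * ζ) (b * ζ) x = 0 := by
  simp only [betaPolar]
  ext i
  fin_cases i <;> simp [betaEntries, hζ, hx] <;> ring

theorem fundamental_mem_tangentP {p : Amb} (hp : p ∈ P) {ζ : ℍ} (hζ : ζ.re = 0) :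
    fundamental p ζ ∈ tangentP p := by
  refine ⟨?_, ?_⟩
  · simp only [fundamental, ← mul_assoc, Quaternion.star_mul_self, ← add_mul,
      ← Quaternion.coe_add, hp.1]
    simpa using hζ
  · simp only [fundamental, Quaternion.re_sub, re_mul_comm ζ, sub_self]

theorem fderiv_proj_fundamental {p : Amb} (hp : p ∈ P) {ζ : ℍ} (hζ : ζ.re = 0) :
    fderiv ℝ proj p (fundamental p ζ) = 0 := by
  rw [fderiv_proj hp.2 (fundamental_mem_tangentP hp hζ).2]
  simp only [fundamental, hopfDeriv_mul _ _ _ hζ, betaPolar_mul _ _ _ _ hζ hp.2]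
  exact Prod.ext rfl skewMat_zero

theorem hopfDeriv_eq_zero {a b a' b' : ℍ} (h : hopfDeriv a b a' b' = 0) :
    (star a * a').re = (star b * b').re ∧ a * star b' + a' * star b = 0 := by
  have h' : ∀ i, hopfDeriv a b a' b' i = 0 := fun i => congrFun h i
  simp only [hopfDeriv, hopf_eq] at h'
  have h0 := h' 0
  have h1 := h' 1
  have h2 := h' 2
  have h3 := h' 3
  have h4 := h' 4
  simp at h0 h1 h2 h3 h4
  refine ⟨?_, Quaternion.ext _ _ ?_ ?_ ?_ ?_⟩ <;> simp <;> linarith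

theorem vertical_iff {p v : Amb} (hp : p ∈ P) (hv : v ∈ tangentP p) :
    fderiv ℝ proj p v = 0 ↔ ∃ ζ : ℍ, ζ.re = 0 ∧ v = fundamental p ζ := by
  constructor
  · intro h
    have hh := h
    rw [fderiv_proj hp.2 hv.2] at h
    obtain ⟨hr, hc⟩ := hopfDeriv_eq_zero (congrArg Prod.fst h)
    have hs := hv.1
    rw [Quaternion.re_add, hr] at hs
    have hb : (star p.2.1 * v.2.1).re = 0 := by linarith
    have ha : (star p.1 * v.1).re = 0 := by rw [hr, hb]
    have im_star : ∀ z : ℍ, z.re = 0 → star z = -z := fun z hz =>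
      Quaternion.ext _ _ (by simp [hz]) (by simp) (by simp) (by simp)
    have ha' : star v.1 * p.1 = -(star p.1 * v.1) := by rw [← im_star _ ha]; simp
    have hb' : star v.2.1 * p.2.1 = -(star p.2.1 * v.2.1) := by rw [← im_star _ hb]; simp
    have hc' : p.2.1 * star v.1 + v.2.1 * star p.1 = 0 := by
      have := congrArg star hc
      simp only [star_add, star_mul, star_star, star_zero] at this
      rw [add_comm]; exact this
    -- As for the orbits, v = qζ forces ζ = q^*v. It is imaginary because the two summands have
    -- equal real parts by the first Hopf coordinate and opposite ones by tangency.
    obtain ⟨ζ, hζ⟩ : ∃ ζ : ℍ, ζ = star p.1 * v.1 + star p.2.1 * v.2.1 := ⟨_, rfl⟩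
    have hζ0 : ζ.re = 0 := by rw [hζ, Quaternion.re_add, ha, hb, add_zero]
    have h1 : p.1 * ζ = v.1 := by
      have : p.1 * (star p.2.1 * v.2.1) = Quaternion.normSq p.2.1 • v.1 := by
        rw [← neg_neg (star p.2.1 * v.2.1), ← hb', mul_neg, ← mul_assoc,
          eq_neg_of_add_eq_zero_left hc, neg_mul, neg_neg, mul_assoc, Quaternion.star_mul_self,
          Quaternion.mul_coe_eq_smul]
      rw [hζ, mul_add, self_mul_star_mul, this, ← add_smul, hp.1, one_smul]
    have h2 : p.2.1 * ζ = v.2.1 := by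
      have : p.2.1 * (star p.1 * v.1) = Quaternion.normSq p.1 • v.2.1 := by
        rw [← neg_neg (star p.1 * v.1), ← ha', mul_neg, ← mul_assoc,
          eq_neg_of_add_eq_zero_left hc', neg_mul, neg_neg, mul_assoc, Quaternion.star_mul_self,
          Quaternion.mul_coe_eq_smul]
      rw [hζ, mul_add, self_mul_star_mul, this, ← add_smul, hp.1, one_smul]
    refine ⟨ζ, hζ0, ?_⟩
    -- What remains after subtracting the fundamental vector points along the fibre of Λ²₋, where β
    -- is linear and injective.
    obtain ⟨η, hη⟩ : ∃ η : ℍ, η = v.2.2 - (fundamental p ζ).2.2 := ⟨_, rfl⟩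
    have hsub : v - fundamental p ζ = (0, 0, η) := by
      refine Prod.ext ?_ (Prod.ext ?_ hη.symm)
      · exact sub_eq_zero.2 h1.symm
      · exact sub_eq_zero.2 h2.symm
    have hη0 : η.re = 0 := by
      rw [hη, Quaternion.re_sub, hv.2, (fundamental_mem_tangentP hp hζ0).2, sub_zero]
    have hd : fderiv ℝ proj p (0, 0, η) = 0 := by
      rw [← hsub, map_sub, hh, fderiv_proj_fundamental hp hζ0, sub_zero]
    rw [fderiv_proj hp.2 hη0] at hd
    have hd' := congrArg Prod.snd hd
    have hz : betaPolar p.1 p.2.1 0 0 p.2.2 = 0 := by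
      ext n
      fin_cases n <;> simp [betaPolar, betaEntries]
    have hz' : betaEntries p.1 p.2.1 0 = 0 := by
      ext n
      fin_cases n <;> simp [betaEntries]
    simp only [hz, add_zero] at hd'
    have : η = 0 := betaEntries_injective hp.1 hη0 rfl
      (hz' ▸ skewMat_injective (hd'.trans skewMat_zero.symm))
    rw [this] at hsub
    exact sub_eq_zero.1 hsub
  · rintro ⟨ζ, hζ, rfl⟩
    exact fderiv_proj_fundamental hp hζ

end Vertical

/-! ### Anti-self-duality of the projected forms, by complementary minors. -/

section Image

/-- The entries above the diagonal of the two-form `*(y ∧ β)`. -/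
noncomputable def dualEntries (y : Fin 5 → ℝ) (c : Fin 10 → ℝ) : Fin 10 → ℝ :=
  ![y 2 * c 9 - y 3 * c 8 + y 4 * c 7, -(y 1 * c 9 - y 3 * c 6 + y 4 * c 5),
    y 1 * c 8 - y 2 * c 6 + y 4 * c 4, -(y 1 * c 7 - y 2 * c 5 + y 3 * c 4),
    y 0 * c 9 - y 3 * c 3 + y 4 * c 2, -(y 0 * c 8 - y 2 * c 3 + y 4 * c 1),
    y 0 * c 7 - y 2 * c 2 + y 3 * c 1, y 0 * c 6 - y 1 * c 3 + y 4 * c 0,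
    -(y 0 * c 5 - y 1 * c 2 + y 3 * c 0), y 0 * c 4 - y 1 * c 1 + y 2 * c 0]

/-- The determinant of a `3 × 3` minor. -/
noncomputable def minor (y u w : Fin 5 → ℝ) (i j k : Fin 5) : ℝ :=
  y i * (u j * w k - u k * w j) - y j * (u i * w k - u k * w i) + y k * (u i * w j - u j * w i)

set_option maxHeartbeats 4000000 in
-- Laplace expansion along the rows `u` and `w`, pairing their 2 × 2 minors with the complementary 3
-- × 3 minors.
theorem det_laplace (y u w r s : Fin 5 → ℝ) :
    (Matrix.of ![y, u, w, r, s]).det =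
      (u 0 * w 1 - u 1 * w 0) * minor y r s 2 3 4 - (u 0 * w 2 - u 2 * w 0) * minor y r s 1 3 4
      + (u 0 * w 3 - u 3 * w 0) * minor y r s 1 2 4 - (u 0 * w 4 - u 4 * w 0) * minor y r s 1 2 3
      + (u 1 * w 2 - u 2 * w 1) * minor y r s 0 3 4 - (u 1 * w 3 - u 3 * w 1) * minor y r s 0 2 4
      + (u 1 * w 4 - u 4 * w 1) * minor y r s 0 2 3 + (u 2 * w 3 - u 3 * w 2) * minor y r s 0 1 4
      - (u 2 * w 4 - u 4 * w 2) * minor y r s 0 1 3 + (u 3 * w 4 - u 4 * w 3) * minor y r s 0 1 2 := by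
  simp [Matrix.det_succ_row_zero, Fin.sum_univ_succ, minor, Fin.succAbove]
  ring

/-- Multiplication by `Uᵀ`, of determinant one, turns the rows `U 0`, `U 3`, `U 4` into standard
basis vectors and leaves a 2 × 2 determinant. -/
theorem complementary_minor {U : Matrix (Fin 5) (Fin 5) ℝ}
    (hU : U ∈ Matrix.specialOrthogonalGroup (Fin 5) ℝ) (u w : Fin 5 → ℝ) :
    (Matrix.of ![U 0, u, w, U 3, U 4]).det =
      (u ⬝ᵥ U 1) * (w ⬝ᵥ U 2) - (u ⬝ᵥ U 2) * (w ⬝ᵥ U 1) := by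
  rw [Matrix.mem_specialOrthogonalGroup_iff, Matrix.mem_orthogonalGroup_iff] at hU
  have h : ∀ i j, U i ⬝ᵥ U j = if i = j then 1 else 0 := fun i j =>
    (congrFun (congrFun hU.1 i) j).trans (Matrix.one_apply)
  have hM : Matrix.of ![U 0, u, w, U 3, U 4] * Uᵀ = Matrix.of ![![1, 0, 0, 0, 0],
      fun j => u ⬝ᵥ U j, fun j => w ⬝ᵥ U j, ![0, 0, 0, 1, 0], ![0, 0, 0, 0, 1]] := by
    ext i j
    have e : (Matrix.of ![U 0, u, w, U 3, U 4] * Uᵀ) i j = (![U 0, u, w, U 3, U 4] i) ⬝ᵥ U j := rfl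
    rw [e]
    fin_cases i
    · fin_cases j <;> simp [h]
    · rfl
    · rfl
    · fin_cases j <;> simp [h]
    · fin_cases j <;> simp [h]
  have hdet := congrArg Matrix.det hM
  rw [Matrix.det_mul, Matrix.det_transpose, hU.2, mul_one, det_laplace (![1, 0, 0, 0, 0])] at hdet
  rw [hdet]
  simp [minor]

theorem conj_skewMat_apply (U : Matrix (Fin 5) (Fin 5) ℝ) (c : Fin 10 → ℝ) (i j : Fin 5) :
    (U * skewMat c * Uᵀ) i j =
      c 0 * (U i 0 * U j 1 - U i 1 * U j 0) + c 1 * (U i 0 * U j 2 - U i 2 * U j 0)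
      + c 2 * (U i 0 * U j 3 - U i 3 * U j 0) + c 3 * (U i 0 * U j 4 - U i 4 * U j 0)
      + c 4 * (U i 1 * U j 2 - U i 2 * U j 1) + c 5 * (U i 1 * U j 3 - U i 3 * U j 1)
      + c 6 * (U i 1 * U j 4 - U i 4 * U j 1) + c 7 * (U i 2 * U j 3 - U i 3 * U j 2)
      + c 8 * (U i 2 * U j 4 - U i 4 * U j 2) + c 9 * (U i 3 * U j 4 - U i 4 * U j 3) := by
  simp [Matrix.mul_apply, Fin.sum_univ_succ, skewMat]
  ring

/-- Invariance of the Hodge star under rotations: β(v₁, v₂) equals *(y∧β)(v₃, v₄) in an oriented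
frame beginning with y. It replaces the condition over all frames in `LambdaMinus` by the linear
equation `dualEntries y c = -c`. -/
theorem conj_skewMat_eq_dual {U : Matrix (Fin 5) (Fin 5) ℝ}
    (hU : U ∈ Matrix.specialOrthogonalGroup (Fin 5) ℝ) (c : Fin 10 → ℝ) :
    (U * skewMat c * Uᵀ) 1 2 = (U * skewMat (dualEntries (U 0) c) * Uᵀ) 3 4 := by
  rw [conj_skewMat_apply, conj_skewMat_apply]
  have h (a b : Fin 5) : (Matrix.of ![U 0, Pi.single a 1, Pi.single b 1, U 3, U 4]).det =
      U 1 a * U 2 b - U 1 b * U 2 a := by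
    rw [complementary_minor hU]
    simp [mul_comm]
  have h01 := h 0 1
  have h02 := h 0 2
  have h03 := h 0 3
  have h04 := h 0 4
  have h12 := h 1 2
  have h13 := h 1 3
  have h14 := h 1 4
  have h23 := h 2 3
  have h24 := h 2 4
  have h34 := h 3 4
  rw [det_laplace] at h01 h02 h03 h04 h12 h13 h14 h23 h24 h34
  simp [minor] at h01 h02 h03 h04 h12 h13 h14 h23 h24 h34
  rw [← h01, ← h02, ← h03, ← h04, ← h12, ← h13, ← h14, ← h23, ← h24, ← h34]
  simp [dualEntries]
  ring

theorem dualEntries_betaEntries (a b x : ℍ) : dualEntries (hopf (a, b)) (betaEntries a b x) =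
    -((Quaternion.normSq a + Quaternion.normSq b) • betaEntries a b x) := by
  rw [hopf_eq]
  ext n
  fin_cases n <;> simp [dualEntries, betaEntries, Quaternion.normSq_def'] <;> ring

theorem skewMat_betaEntries_mulVec (a b x : ℍ) :
    skewMat (betaEntries a b x) *ᵥ hopf (a, b) = 0 := by
  rw [hopf_eq]
  ext n
  fin_cases n <;>
  simp [skewMat, betaEntries, Matrix.mulVec, dotProduct, Fin.sum_univ_succ] <;> ring

theorem hopf_dotProduct_self (a b : ℍ) : hopf (a, b) ⬝ᵥ hopf (a, b) =
    (Quaternion.normSq a + Quaternion.normSq b) ^ 2 := by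
  rw [hopf_eq]
  simp [dotProduct, Fin.sum_univ_succ, Quaternion.normSq_def']
  ring

theorem proj_mem_LambdaMinus {p : Amb} (hp : p ∈ P) : proj p ∈ LambdaMinus := by
  have e : Matrix.of (proj p).2 = skewMat (betaEntries p.1 p.2.1 p.2.2) := proj_snd p hp.2
  refine ⟨?_, ?_, ?_, fun U hU h0 => ?_⟩
  · exact (hopf_dotProduct_self _ _).trans (by rw [hp.1, one_pow])
  · rw [e, skewMat_transpose]
  · rw [e]; exact skewMat_betaEntries_mulVec _ _ _
  · have h1 : U 0 = hopf (p.1, p.2.1) := h0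
    rw [e, conj_skewMat_eq_dual hU, h1, dualEntries_betaEntries, hp.1, one_smul,
      show -betaEntries p.1 p.2.1 p.2.2 = (-1 : ℝ) • betaEntries p.1 p.2.1 p.2.2 by simp,
      skewMat_smul]
    simp

end Image

/-! ### Surjectivity onto Λ²₋(S⁴). -/

section Surjective

theorem exists_specialOrthogonal_row {y : Fin 5 → ℝ} (hy : y ⬝ᵥ y = 1) :
    ∃ U ∈ Matrix.specialOrthogonalGroup (Fin 5) ℝ, U 0 = y := by
  have hon : Orthonormal ℝ (({0} : Set (Fin 5)).domRestrict
      (fun _ => (WithLp.toLp 2 y : EuclideanSpace ℝ (Fin 5)))) := by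
    refine ⟨fun i => ?_, fun i j hij => ?_⟩
    · have h : ‖(WithLp.toLp 2 y : EuclideanSpace ℝ (Fin 5))‖ ^ 2 = 1 := by
        rw [EuclideanSpace.norm_sq_eq, ← hy]
        simp [dotProduct, sq]
      exact (pow_eq_one_iff_of_nonneg (norm_nonneg _) two_ne_zero).1 h
    · exact absurd (Subtype.ext (i.2.trans j.2.symm)) hij
  obtain ⟨b, hb⟩ := hon.exists_orthonormalBasis_extension_of_card_eq (by simp)
  have hb0 : b 0 = WithLp.toLp 2 y := hb 0 rfl
  obtain ⟨M, hM⟩ : ∃ M : Matrix (Fin 5) (Fin 5) ℝ, M = Matrix.of fun i j => b i j := ⟨_, rfl⟩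
  have hMM : M * Mᵀ = 1 := by
    ext i j
    have := orthonormal_iff_ite.1 b.orthonormal i j
    rw [EuclideanSpace.inner_eq_star_dotProduct] at this
    rw [Matrix.one_apply, ← this, hM, Matrix.mul_apply]
    simp [dotProduct, mul_comm]
  have hM0 : M 0 = y := by
    rw [hM]; funext j; exact congrArg (fun v : EuclideanSpace ℝ (Fin 5) => v j) hb0
  have hdet : M.det = 1 ∨ M.det = -1 := by
    have := congrArg Matrix.det hMM
    rw [Matrix.det_mul, Matrix.det_transpose, Matrix.det_one] at this
    exact mul_self_eq_one_iff.1 this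
  rcases hdet with h | h
  · exact ⟨M, Matrix.mem_specialOrthogonalGroup_iff.2
      ⟨(Matrix.mem_orthogonalGroup_iff _ _).2 hMM, h⟩, hM0⟩
  -- If the determinant is -1, negating the last row corrects it and leaves row 0 alone.
  · have hD : Matrix.diagonal ![(1 : ℝ), 1, 1, 1, -1] * (Matrix.diagonal ![(1 : ℝ), 1, 1, 1, -1])ᵀ
        = 1 := by
      rw [Matrix.diagonal_transpose, Matrix.diagonal_mul_diagonal, ← Matrix.diagonal_one]
      congr 1; funext i; fin_cases i <;> simp
    refine ⟨Matrix.diagonal ![1, 1, 1, 1, -1] * M, Matrix.mem_specialOrthogonalGroup_iff.2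
      ⟨(Matrix.mem_orthogonalGroup_iff _ _).2 ?_, ?_⟩, ?_⟩
    · rw [Matrix.transpose_mul, Matrix.mul_assoc, ← Matrix.mul_assoc M, hMM, Matrix.one_mul, hD]
    · rw [Matrix.det_mul, h, Matrix.det_diagonal]
      simp [Fin.prod_univ_succ]
    · funext j
      rw [Matrix.diagonal_mul, ← hM0]
      simp

/-- Positions 1 and 2 stay free, and exchanging their values corrects the sign. Such reorderings of
a frame put any two directions orthogonal to y in places 3 and 4 and preserve the orientation. -/
theorem exists_even_perm : ∀ c d : Fin 5, c ≠ 0 → d ≠ 0 → c ≠ d →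
    ∃ σ : Equiv.Perm (Fin 5), σ 0 = 0 ∧ σ 3 = c ∧ σ 4 = d ∧ Equiv.Perm.sign σ = 1 := by
  decide +kernel

theorem skewMat_dualEntries_mulVec (y : Fin 5 → ℝ) (c : Fin 10 → ℝ) :
    skewMat (dualEntries y c) *ᵥ y = 0 := by
  ext n
  fin_cases n <;>
  simp [skewMat, dualEntries, Matrix.mulVec, dotProduct, Fin.sum_univ_succ] <;> ring

theorem submatrix_mem_specialOrthogonal {U : Matrix (Fin 5) (Fin 5) ℝ}
    (hU : U ∈ Matrix.specialOrthogonalGroup (Fin 5) ℝ) {σ : Equiv.Perm (Fin 5)}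
    (hσ : Equiv.Perm.sign σ = 1) :
    U.submatrix σ id ∈ Matrix.specialOrthogonalGroup (Fin 5) ℝ := by
  rw [Matrix.mem_specialOrthogonalGroup_iff, Matrix.mem_orthogonalGroup_iff] at hU ⊢
  refine ⟨?_, ?_⟩
  · ext i j
    have := congrFun (congrFun hU.1 (σ i)) (σ j)
    rw [Matrix.one_apply] at this ⊢
    simpa [Matrix.mul_apply] using this
  · rw [Matrix.det_permute, hσ, hU.2]; simp

/-- The skew form β + *(y∧β) vanishes on the last two vectors of every oriented frame starting with
y. Reordering frames makes it vanish on all pairs of one frame orthogonal to y, and y lies in its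
kernel. -/
theorem dualEntries_eq_neg {y : Fin 5 → ℝ} {c : Fin 10 → ℝ} (hy : y ⬝ᵥ y = 1)
    (h0 : skewMat c *ᵥ y = 0)
    (h : ∀ U ∈ Matrix.specialOrthogonalGroup (Fin 5) ℝ, U 0 = y →
      (U * skewMat c * Uᵀ) 1 2 = -(U * skewMat c * Uᵀ) 3 4) : dualEntries y c = -c := by
  obtain ⟨B, hB⟩ : ∃ B, B = skewMat (c + dualEntries y c) := ⟨_, rfl⟩
  have h34 : ∀ U ∈ Matrix.specialOrthogonalGroup (Fin 5) ℝ, U 0 = y → (U * B * Uᵀ) 3 4 = 0 :=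
    fun U hU hU0 => by
      have h1 := h U hU hU0
      rw [conj_skewMat_eq_dual hU, hU0] at h1
      rw [hB, skewMat_add, Matrix.mul_add, Matrix.add_mul, Matrix.add_apply, h1]
      ring
  have hBy : B *ᵥ y = 0 := by
    rw [hB, skewMat_add, Matrix.add_mulVec, h0, skewMat_dualEntries_mulVec, add_zero]
  have hBT : Bᵀ = -B := hB ▸ skewMat_transpose _
  obtain ⟨U, hU, hU0⟩ := exists_specialOrthogonal_row hy
  obtain ⟨C, hC⟩ : ∃ C, C = U * B * Uᵀ := ⟨_, rfl⟩
  have hCT : ∀ i j, C j i = -C i j := fun i j => by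
    have : Cᵀ = -C := by
      rw [hC, Matrix.transpose_mul, Matrix.transpose_mul, hBT, Matrix.transpose_transpose]
      simp [Matrix.mul_assoc]
    exact congrFun (congrFun this i) j
  have hC0 : ∀ i, C i 0 = 0 := fun i => by
    have e : C i 0 = (U i) ⬝ᵥ (B *ᵥ U 0) := by
      rw [hC, Matrix.mul_assoc]; rfl
    rw [e, hU0, hBy, dotProduct_zero]
  have hCz : C = 0 := by
    ext i j
    rw [Matrix.zero_apply]
    by_cases hj : j = 0
    · rw [hj, hC0]
    by_cases hi : i = 0
    · rw [hi, hCT, hC0, neg_zero]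
    by_cases hij : i = j
    · have := hCT i j; rw [← hij] at this ⊢; linarith
    obtain ⟨σ, hσ0, hσ3, hσ4, hσ⟩ := exists_even_perm i j hi hj hij
    have := h34 _ (submatrix_mem_specialOrthogonal hU hσ) (by
      funext k; simp [hσ0, hU0])
    rw [hC, ← hσ3, ← hσ4]
    rw [← this]
    simp [Matrix.mul_apply]
  have hUU : Uᵀ * U = 1 := by
    have := (Matrix.mem_specialOrthogonalGroup_iff.1 hU).1
    exact (Matrix.mem_orthogonalGroup_iff' _ _).1 this
  have hBz : B = 0 := by
    have : Uᵀ * C * U = B := by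
      rw [hC]
      calc Uᵀ * (U * B * Uᵀ) * U = (Uᵀ * U) * B * (Uᵀ * U) := by simp only [Matrix.mul_assoc]
        _ = B := by rw [hUU, Matrix.one_mul, Matrix.mul_one]
    rw [← this, hCz]; simp
  rw [hB] at hBz
  exact eq_neg_of_add_eq_zero_right (skewMat_injective (hBz.trans skewMat_zero.symm))

/-- Each Hopf fibre has a point whose second coordinate is a real r: the equations r² - |a|² = y₀,
r² + |a|² = 1 and 2ra = `quat y` give r² = (1 + y₀)/2 and a. At y₀ = -1, where r = 0, the point (1,
0) is used. -/
theorem exists_hopf_eq {y : Fin 5 → ℝ} (hy : y ⬝ᵥ y = 1) :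
    ∃ (a : ℍ) (r : ℝ), Quaternion.normSq a + r ^ 2 = 1 ∧ hopf (a, (r : ℍ)) = y := by
  have hs : y 0 ^ 2 + y 1 ^ 2 + y 2 ^ 2 + y 3 ^ 2 + y 4 ^ 2 = 1 := by
    rw [← hy]; simp [dotProduct, Fin.sum_univ_succ]; ring
  by_cases h0 : y 0 = -1
  · have h1 : y 1 = 0 := by nlinarith [sq_nonneg (y 1), sq_nonneg (y 2), sq_nonneg (y 3), sq_nonneg (y 4)]
    have h2 : y 2 = 0 := by nlinarith [sq_nonneg (y 1), sq_nonneg (y 2), sq_nonneg (y 3), sq_nonneg (y 4)]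
    have h3 : y 3 = 0 := by nlinarith [sq_nonneg (y 1), sq_nonneg (y 2), sq_nonneg (y 3), sq_nonneg (y 4)]
    have h4 : y 4 = 0 := by nlinarith [sq_nonneg (y 1), sq_nonneg (y 2), sq_nonneg (y 3), sq_nonneg (y 4)]
    refine ⟨1, 0, by simp, ?_⟩
    rw [hopf_eq]
    ext n
    fin_cases n <;> simp [h0, h1, h2, h3, h4]
  · have hpos : 0 < 1 + y 0 := by
      have h1 : -1 ≤ y 0 := by nlinarith [sq_nonneg (y 1), sq_nonneg (y 2), sq_nonneg (y 3), sq_nonneg (y 4)]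
      have := lt_of_le_of_ne h1 (Ne.symm h0)
      linarith
    obtain ⟨r, hr, hr2⟩ : ∃ r : ℝ, 0 < r ∧ r ^ 2 = (1 + y 0) / 2 :=
      ⟨√((1 + y 0) / 2), Real.sqrt_pos.2 (by linarith), Real.sq_sqrt (by linarith)⟩
    have hq : Quaternion.normSq ((1 / (2 * r)) • quat y) = (1 - y 0) / 2 := by
      rw [Quaternion.normSq_smul, Quaternion.normSq_def', quat_re, quat_imI, quat_imJ, quat_imK,
        show y 1 ^ 2 + y 2 ^ 2 + y 3 ^ 2 + y 4 ^ 2 = (1 - y 0) * (1 + y 0) by linarith, div_pow,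
        mul_pow, hr2]
      field_simp
    refine ⟨(1 / (2 * r)) • quat y, r, by rw [hq, hr2]; ring, ?_⟩
    have h0' : hopf ((1 / (2 * r)) • quat y, (r : ℍ)) 0 = y 0 := by
      simp only [hopf, Matrix.cons_val_zero, hq]
      rw [Quaternion.normSq_coe, hr2]; ring
    ext n
    by_cases hn : n = 0
    · rw [hn, h0']
    · rw [hopf_eq]
      fin_cases n
      · exact absurd rfl hn
      all_goals
        simp [quat_re, quat_imI, quat_imJ, quat_imK]
        field_simp

set_option maxHeartbeats 4000000 in
theorem exists_betaEntries_eq {a : ℍ} {r : ℝ} (hq : Quaternion.normSq a + r ^ 2 = 1)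
    {c : Fin 10 → ℝ} (h0 : skewMat c *ᵥ hopf (a, (r : ℍ)) = 0)
    (h : dualEntries (hopf (a, (r : ℍ))) c = -c) :
    ∃ x : ℍ, x.re = 0 ∧ betaEntries a r x = c := by
  -- The coefficients of the orthogonal projection of `c` onto the image of Im ℍ, with the scale of
  -- `sum_betaEntries_mul` at |q| = 1.
  refine ⟨⟨0, (1 / 2) * ∑ n, c n * betaEntries a r (T 0) n,
    (1 / 2) * ∑ n, c n * betaEntries a r (T 1) n, (1 / 2) * ∑ n, c n * betaEntries a r (T 2) n⟩,
    rfl, ?_⟩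
  have hy : hopf (a, (r : ℍ)) = ![r ^ 2 - (a.re ^ 2 + a.imI ^ 2 + a.imJ ^ 2 + a.imK ^ 2),
      2 * (a.re * r), 2 * (a.imI * r), 2 * (a.imJ * r), 2 * (a.imK * r)] := by
    rw [hopf_eq]
    ext n
    fin_cases n <;> simp
  rw [hy] at h0 h
  rw [Quaternion.normSq_def'] at hq
  have e0 := congrFun h0 0
  have e1 := congrFun h0 1
  have e2 := congrFun h0 2
  have e3 := congrFun h0 3
  have e4 := congrFun h0 4
  have d0 := congrFun h 0
  have d1 := congrFun h 1
  have d2 := congrFun h 2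
  have d3 := congrFun h 3
  have d4 := congrFun h 4
  have d5 := congrFun h 5
  have d6 := congrFun h 6
  have d7 := congrFun h 7
  have d8 := congrFun h 8
  have d9 := congrFun h 9
  simp [skewMat, Matrix.mulVec, dotProduct, Fin.sum_univ_succ] at e0 e1 e2 e3 e4
  simp [dualEntries] at d0 d1 d2 d3 d4 d5 d6 d7 d8 d9
  ext n
  fin_cases n <;> simp [betaEntries, T, Fin.sum_univ_succ]
  -- The ten entries follow one pattern. For the pair (i, j) the defect is ½(yᵢ · row j - yⱼ · row
  -- i) of the equation βy = 0, minus ½|q|² times the duality equation, plus a multiple of |q|² = 1.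
  · linear_combination 1 / 2 * (r ^ 2 - (a.re ^ 2 + a.imI ^ 2 + a.imJ ^ 2 + a.imK ^ 2)) * e1 - 1 / 2 * (2 * (a.re * r)) * e0 - 1 / 2 * (a.re ^ 2 + a.imI ^ 2 + a.imJ ^ 2 + a.imK ^ 2 + r ^ 2) * d0
      + 1 / 2 * c 0 * (a.re ^ 2 + a.imI ^ 2 + a.imJ ^ 2 + a.imK ^ 2 + r ^ 2 + 2) * hq
  · linear_combination 1 / 2 * (r ^ 2 - (a.re ^ 2 + a.imI ^ 2 + a.imJ ^ 2 + a.imK ^ 2)) * e2 - 1 / 2 * (2 * (a.imI * r)) * e0 - 1 / 2 * (a.re ^ 2 + a.imI ^ 2 + a.imJ ^ 2 + a.imK ^ 2 + r ^ 2) * d1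
      + 1 / 2 * c 1 * (a.re ^ 2 + a.imI ^ 2 + a.imJ ^ 2 + a.imK ^ 2 + r ^ 2 + 2) * hq
  · linear_combination 1 / 2 * (r ^ 2 - (a.re ^ 2 + a.imI ^ 2 + a.imJ ^ 2 + a.imK ^ 2)) * e3 - 1 / 2 * (2 * (a.imJ * r)) * e0 - 1 / 2 * (a.re ^ 2 + a.imI ^ 2 + a.imJ ^ 2 + a.imK ^ 2 + r ^ 2) * d2
      + 1 / 2 * c 2 * (a.re ^ 2 + a.imI ^ 2 + a.imJ ^ 2 + a.imK ^ 2 + r ^ 2 + 2) * hq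
  · linear_combination 1 / 2 * (r ^ 2 - (a.re ^ 2 + a.imI ^ 2 + a.imJ ^ 2 + a.imK ^ 2)) * e4 - 1 / 2 * (2 * (a.imK * r)) * e0 - 1 / 2 * (a.re ^ 2 + a.imI ^ 2 + a.imJ ^ 2 + a.imK ^ 2 + r ^ 2) * d3
      + 1 / 2 * c 3 * (a.re ^ 2 + a.imI ^ 2 + a.imJ ^ 2 + a.imK ^ 2 + r ^ 2 + 2) * hq
  · linear_combination 1 / 2 * (2 * (a.re * r)) * e2 - 1 / 2 * (2 * (a.imI * r)) * e1 - 1 / 2 * (a.re ^ 2 + a.imI ^ 2 + a.imJ ^ 2 + a.imK ^ 2 + r ^ 2) * d4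
      + 1 / 2 * c 4 * (a.re ^ 2 + a.imI ^ 2 + a.imJ ^ 2 + a.imK ^ 2 + r ^ 2 + 2) * hq
  · linear_combination 1 / 2 * (2 * (a.re * r)) * e3 - 1 / 2 * (2 * (a.imJ * r)) * e1 - 1 / 2 * (a.re ^ 2 + a.imI ^ 2 + a.imJ ^ 2 + a.imK ^ 2 + r ^ 2) * d5
      + 1 / 2 * c 5 * (a.re ^ 2 + a.imI ^ 2 + a.imJ ^ 2 + a.imK ^ 2 + r ^ 2 + 2) * hq
  · linear_combination 1 / 2 * (2 * (a.re * r)) * e4 - 1 / 2 * (2 * (a.imK * r)) * e1 - 1 / 2 * (a.re ^ 2 + a.imI ^ 2 + a.imJ ^ 2 + a.imK ^ 2 + r ^ 2) * d6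
      + 1 / 2 * c 6 * (a.re ^ 2 + a.imI ^ 2 + a.imJ ^ 2 + a.imK ^ 2 + r ^ 2 + 2) * hq
  · linear_combination 1 / 2 * (2 * (a.imI * r)) * e3 - 1 / 2 * (2 * (a.imJ * r)) * e2 - 1 / 2 * (a.re ^ 2 + a.imI ^ 2 + a.imJ ^ 2 + a.imK ^ 2 + r ^ 2) * d7
      + 1 / 2 * c 7 * (a.re ^ 2 + a.imI ^ 2 + a.imJ ^ 2 + a.imK ^ 2 + r ^ 2 + 2) * hq
  · linear_combination 1 / 2 * (2 * (a.imI * r)) * e4 - 1 / 2 * (2 * (a.imK * r)) * e2 - 1 / 2 * (a.re ^ 2 + a.imI ^ 2 + a.imJ ^ 2 + a.imK ^ 2 + r ^ 2) * d8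
      + 1 / 2 * c 8 * (a.re ^ 2 + a.imI ^ 2 + a.imJ ^ 2 + a.imK ^ 2 + r ^ 2 + 2) * hq
  · linear_combination 1 / 2 * (2 * (a.imJ * r)) * e4 - 1 / 2 * (2 * (a.imK * r)) * e3 - 1 / 2 * (a.re ^ 2 + a.imI ^ 2 + a.imJ ^ 2 + a.imK ^ 2 + r ^ 2) * d9
      + 1 / 2 * c 9 * (a.re ^ 2 + a.imI ^ 2 + a.imJ ^ 2 + a.imK ^ 2 + r ^ 2 + 2) * hq

theorem image_proj : proj '' P = LambdaMinus := by
  refine Set.Subset.antisymm ?_ fun z hz => ?_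
  · rintro _ ⟨p, hp, rfl⟩
    exact proj_mem_LambdaMinus hp
  · obtain ⟨hy, hT, hz0, hU⟩ := hz
    rw [← skewMat_upperEntries hT] at hz0 hU
    obtain ⟨a, r, hq, hh⟩ := exists_hopf_eq hy
    have hd := dualEntries_eq_neg hy hz0 hU
    rw [← hh] at hz0 hd
    obtain ⟨x, hx, hb⟩ := exists_betaEntries_eq hq hz0 hd
    have hP : ((a, (r : ℍ), x) : Amb) ∈ P := ⟨by rw [Quaternion.normSq_coe]; exact hq, hx⟩
    refine ⟨(a, (r : ℍ), x), hP, Prod.ext hh ?_⟩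
    rw [proj_snd _ hP.2, hb, skewMat_upperEntries hT]
    rfl

theorem isPrincipalBundle : IsPrincipalBundle where
  act_mem := fun _ hp h => act_mem_P hp h
  smooth := contDiff_proj
  image := image_proj
  orbits := fun p hp p' hp' => ⟨exists_act_of_proj_eq hp hp', by
    rintro ⟨h, rfl⟩; exact (proj_act p h).symm⟩
  free := fun _ hp _ hh => act_free hp hh
  vertical := fun _ hp _ hv => vertical_iff hp hv

end Surjective

/-! ### Curvature -/

section Curvature

variable {E : Type*} [NormedAddCommGroup E] [NormedSpace ℝ E]

theorem oneForm_apply {F : Type*} [NormedAddCommGroup F] [NormedSpace ℝ F] (a : E →L[ℝ] F)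
    (v : Fin 1 → E) : oneForm a v = a (v 0) := rfl

theorem bracket_apply (x y : ℍ) : bracket x y = x * y - y * x := rfl

theorem curvature_apply {A : E → E →L[ℝ] ℍ} {p : E} (hA : DifferentiableAt ℝ A p)
    (v : Fin 2 → E) : curvature A p v =
      fderiv ℝ A p (v 0) (v 1) - fderiv ℝ A p (v 1) (v 0)
        + (A p (v 0) * A p (v 1) - A p (v 1) * A p (v 0)) := by
  have hd : DifferentiableAt ℝ
      (fun x => ContinuousAlternatingMap.ofSubsingleton ℝ E ℍ (0 : Fin 1) (A x)) p :=
    (ContinuousAlternatingMap.ofSubsingletonLIE (𝕜 := ℝ) (E := E) (F := ℍ)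
      (0 : Fin 1)).differentiableAt.comp p hA
  have hf : ∀ w : E, fderiv ℝ (fun x => A x w) p = (fderiv ℝ A p).flip w := fun w => by
    refine ContinuousLinearMap.ext fun u => ?_
    rw [fderiv_clm_apply hA (differentiableAt_const w)]
    simp
  rw [curvature, AlternatingMap.add_apply, AlternatingMap.smul_apply, wedge_one_one_apply]
  congr 1
  · have := extDeriv_apply hd v
    refine Eq.trans this ?_
    simp only [ContinuousAlternatingMap.ofSubsingleton_apply_apply]
    simp only [hf]
    simp [Fin.removeNth, sub_eq_add_neg]
  · simp only [oneForm_apply, bracket_apply, Matrix.cons_val_zero]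
    module

theorem fderiv_apply_eq_of_hasDerivAt {F : Type*} [NormedAddCommGroup F] [NormedSpace ℝ F]
    {A : E → E →L[ℝ] F} {p v w : E} {d : F} (hA : DifferentiableAt ℝ A p)
    (h : HasDerivAt (fun t : ℝ => A (p + t • v) w) d 0) : fderiv ℝ A p v w = d := by
  have h1 := hA.hasFDerivAt.hasLineDerivAt v
  have h2 : HasDerivAt (fun t : ℝ => A (p + t • v) w) (fderiv ℝ A p v w) 0 := by
    have := HasDerivAt.clm_apply h1 (hasDerivAt_const (0 : ℝ) w)
    simpa using this
  exact h2.unique h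

end Curvature

/-! ### The connection form θ + c(|x|²)[x, Dx]: smoothness and curvature. -/

section ConnectionForm

theorem hopfForm_apply (p v : Amb) : hopfForm p v = star p.1 * v.1 + star p.2.1 * v.2.1 := rfl

/-- The covariant differential `Dx = dx + [q^* dq, x]`. -/
noncomputable def covDeriv (p : Amb) : Amb →L[ℝ] ℍ :=
  (ContinuousLinearMap.snd ℝ ℍ ℍ ∘L ContinuousLinearMap.snd ℝ ℍ (ℍ × ℍ))
    + ((ContinuousLinearMap.mul ℝ ℍ).flip p.2.2 - ContinuousLinearMap.mul ℝ ℍ p.2.2) ∘L hopfForm p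

theorem covDeriv_apply (p v : Amb) :
    covDeriv p v = v.2.2 + (hopfForm p v * p.2.2 - p.2.2 * hopfForm p v) := rfl

theorem Dx_apply (i : Fin 3) (p v : Amb) : Dx i p v = inner ℝ (T i) (covDeriv p v) := rfl

/-- The coefficient of `[x, Dx]` in the connection form, as a function of `|x|²`. -/
noncomputable def connCoef (u : ℝ) : ℝ := -(4 * √(1 + u) * (1 + √(1 + u)))⁻¹

/-- The connection form `q^* dq + c(|x|²) [x, Dx]`. -/
noncomputable def connForm (p : Amb) : Amb →L[ℝ] ℍ :=
  hopfForm p + connCoef (‖p.2.2‖ ^ 2) •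
    (ContinuousLinearMap.mul ℝ ℍ p.2.2 - (ContinuousLinearMap.mul ℝ ℍ).flip p.2.2) ∘L covDeriv p

theorem connForm_apply (p v : Amb) : connForm p v =
    hopfForm p v + connCoef (‖p.2.2‖ ^ 2) • (p.2.2 * covDeriv p v - covDeriv p v * p.2.2) := rfl

theorem hasDerivAt_connCoef {u : ℝ} (hu : 0 ≤ u) : HasDerivAt connCoef
    ((1 + 2 * √(1 + u)) / (8 * √(1 + u) ^ 3 * (1 + √(1 + u)) ^ 2)) u := by
  have h1 : 0 < 1 + u := by linarith
  have hr : 0 < √(1 + u) := Real.sqrt_pos.2 h1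
  have hs : HasDerivAt (fun u : ℝ => √(1 + u)) (1 / (2 * √(1 + u))) u := by
    have := (hasDerivAt_id u).const_add 1 |>.sqrt h1.ne'
    simpa using this
  have hne : 4 * √(1 + u) * (1 + √(1 + u)) ≠ 0 := by positivity
  have h := (((hs.const_mul 4).mul (hs.const_add 1)).inv hne).neg
  refine h.congr_deriv ?_
  simp only [Pi.mul_apply]
  field_simp
  ring

theorem contDiff_hopfForm : ContDiff ℝ ∞ hopfForm := by
  have h1 : ContDiff ℝ ∞ (fun p : Amb => star p.1) := contDiff_quaternion_star contDiff_fst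
  have h2 : ContDiff ℝ ∞ (fun p : Amb => star p.2.1) :=
    contDiff_quaternion_star (contDiff_fst.comp contDiff_snd)
  exact (((ContinuousLinearMap.mul ℝ ℍ).contDiff.comp h1).clm_comp contDiff_const).add
    (((ContinuousLinearMap.mul ℝ ℍ).contDiff.comp h2).clm_comp contDiff_const)

theorem contDiff_covDeriv : ContDiff ℝ ∞ covDeriv := by
  have h3 : ContDiff ℝ ∞ (fun p : Amb => p.2.2) := contDiff_snd.comp contDiff_snd
  exact contDiff_const.add ((((ContinuousLinearMap.mul ℝ ℍ).flip.contDiff.comp h3).sub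
    ((ContinuousLinearMap.mul ℝ ℍ).contDiff.comp h3)).clm_comp contDiff_hopfForm)

/-- The coefficient depends on |x|², not on |x|, and its denominator never vanishes, so nothing
singular happens on the zero section. -/
theorem contDiff_connForm : ContDiff ℝ ∞ connForm := by
  have h3 : ContDiff ℝ ∞ (fun p : Amb => p.2.2) := contDiff_snd.comp contDiff_snd
  have hn : ContDiff ℝ ∞ (fun p : Amb => 1 + ‖p.2.2‖ ^ 2) := contDiff_const.add (h3.norm_sq ℝ)
  have hr : ContDiff ℝ ∞ (fun p : Amb => √(1 + ‖p.2.2‖ ^ 2)) := hn.sqrt fun p => by positivity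
  have hc : ContDiff ℝ ∞ (fun p : Amb => connCoef (‖p.2.2‖ ^ 2)) :=
    (((contDiff_const.mul hr).mul (contDiff_const.add hr)).inv fun p => by
      change 4 * √(1 + ‖p.2.2‖ ^ 2) * (1 + √(1 + ‖p.2.2‖ ^ 2)) ≠ 0
      positivity).neg
  exact contDiff_hopfForm.add (hc.smul ((((ContinuousLinearMap.mul ℝ ℍ).contDiff.comp h3).sub
    ((ContinuousLinearMap.mul ℝ ℍ).flip.contDiff.comp h3)).clm_comp contDiff_covDeriv))

theorem hasDerivAt_hopfForm_line (p v w : Amb) (t₀ : ℝ) :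
    HasDerivAt (fun t : ℝ => hopfForm (p + t • v) w)
      (star v.1 * w.1 + star v.2.1 * w.2.1) t₀ := by
  have h : (fun t : ℝ => hopfForm (p + t • v) w) = fun t : ℝ =>
      hopfForm p w + t • (star v.1 * w.1 + star v.2.1 * w.2.1) := by
    funext t
    simp only [hopfForm_apply, Prod.fst_add, Prod.snd_add, Prod.smul_fst, Prod.smul_snd, star_add,
      Quaternion.star_smul, add_mul, smul_mul_assoc, smul_add]
    abel
  rw [h]
  simpa using (((hasDerivAt_id t₀).smul_const (star v.1 * w.1 + star v.2.1 * w.2.1)).const_add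
    (hopfForm p w))

theorem fderiv_hopfForm (p v w : Amb) :
    fderiv ℝ hopfForm p v w = star v.1 * w.1 + star v.2.1 * w.2.1 :=
  fderiv_apply_eq_of_hasDerivAt (contDiff_hopfForm.differentiable (by simp) p)
    (hasDerivAt_hopfForm_line p v w 0)

theorem curvature_hopfForm_apply (p : Amb) (v : Fin 2 → Amb) : curvature hopfForm p v =
    (star (v 0).1 * (v 1).1 + star (v 0).2.1 * (v 1).2.1)
      - (star (v 1).1 * (v 0).1 + star (v 1).2.1 * (v 0).2.1)
      + (hopfForm p (v 0) * hopfForm p (v 1) - hopfForm p (v 1) * hopfForm p (v 0)) := by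
  rw [curvature_apply (contDiff_hopfForm.differentiable (by simp) p), fderiv_hopfForm,
    fderiv_hopfForm]

theorem hasDerivAt_line_x (p v : Amb) : HasDerivAt (fun t : ℝ => (p + t • v).2.2) v.2.2 0 := by
  simpa using (((hasDerivAt_id (0 : ℝ)).smul_const v.2.2).const_add p.2.2)

theorem hasDerivAt_covDeriv_line (p v w : Amb) :
    HasDerivAt (fun t : ℝ => covDeriv (p + t • v) w)
      (((star v.1 * w.1 + star v.2.1 * w.2.1) * p.2.2 + hopfForm p w * v.2.2)
        - (v.2.2 * hopfForm p w + p.2.2 * (star v.1 * w.1 + star v.2.1 * w.2.1))) 0 := by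
  have hx := hasDerivAt_line_x p v
  have hθ := hasDerivAt_hopfForm_line p v w 0
  have h := ((hθ.mul hx).sub (hx.mul hθ)).const_add w.2.2
  refine h.congr_deriv ?_
  simp

theorem fderiv_connForm (p v w : Amb) : fderiv ℝ connForm p v w =
    (star v.1 * w.1 + star v.2.1 * w.2.1)
      + (deriv connCoef (‖p.2.2‖ ^ 2) * (2 * inner ℝ p.2.2 v.2.2)) •
        (p.2.2 * covDeriv p w - covDeriv p w * p.2.2)
      + connCoef (‖p.2.2‖ ^ 2) •
        ((v.2.2 * covDeriv p w + p.2.2 *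
          (((star v.1 * w.1 + star v.2.1 * w.2.1) * p.2.2 + hopfForm p w * v.2.2)
            - (v.2.2 * hopfForm p w + p.2.2 * (star v.1 * w.1 + star v.2.1 * w.2.1))))
        - ((((star v.1 * w.1 + star v.2.1 * w.2.1) * p.2.2 + hopfForm p w * v.2.2)
            - (v.2.2 * hopfForm p w + p.2.2 * (star v.1 * w.1 + star v.2.1 * w.2.1))) * p.2.2
          + covDeriv p w * v.2.2)) := by
  refine fderiv_apply_eq_of_hasDerivAt (contDiff_connForm.differentiable (by simp) p) ?_
  have hx := hasDerivAt_line_x p v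
  have hθ := hasDerivAt_hopfForm_line p v w 0
  have hD := hasDerivAt_covDeriv_line p v w
  have hn := hx.norm_sq
  have hc : HasDerivAt (fun t : ℝ => connCoef (‖(p + t • v).2.2‖ ^ 2)) _ 0 :=
    HasDerivAt.comp (0 : ℝ) (h₂ := connCoef)
      (hasDerivAt_connCoef (sq_nonneg ‖(p + (0 : ℝ) • v).2.2‖)) hn
  have h := hθ.add (hc.smul ((hx.mul hD).sub (hD.mul hx)))
  refine h.congr_deriv ?_
  rw [(hasDerivAt_connCoef (sq_nonneg ‖p.2.2‖)).deriv]
  simp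
  abel

/-- The curvature of the connection `q^* dq + c [x, Dx]`. -/
theorem curvature_connForm_apply (p : Amb) (v : Fin 2 → Amb) {F ξ η : ℍ}
    (hF : F = curvature hopfForm p v) (hξ : ξ = covDeriv p (v 0)) (hη : η = covDeriv p (v 1)) :
    curvature connForm p v = F
      + deriv connCoef (‖p.2.2‖ ^ 2) • ((2 * inner ℝ p.2.2 (v 0).2.2) • (p.2.2 * η - η * p.2.2)
        - (2 * inner ℝ p.2.2 (v 1).2.2) • (p.2.2 * ξ - ξ * p.2.2))
      + connCoef (‖p.2.2‖ ^ 2) • ((2 : ℝ) • (ξ * η - η * ξ)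
        + (p.2.2 * (F * p.2.2 - p.2.2 * F) - (F * p.2.2 - p.2.2 * F) * p.2.2))
      + connCoef (‖p.2.2‖ ^ 2) ^ 2 •
        ((p.2.2 * ξ - ξ * p.2.2) * (p.2.2 * η - η * p.2.2)
          - (p.2.2 * η - η * p.2.2) * (p.2.2 * ξ - ξ * p.2.2)) := by
  rw [curvature_apply (contDiff_connForm.differentiable (by simp) p), fderiv_connForm,
    fderiv_connForm, connForm_apply, connForm_apply, ← hξ, ← hη]
  rw [curvature_hopfForm_apply] at hF
  rw [covDeriv_apply] at hξ hη
  -- The rest is an identity between noncommuting letters, with θ(vᵢ) and dx(vᵢ) as independent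
  -- quantities.
  generalize connCoef (‖p.2.2‖ ^ 2) = c
  generalize deriv connCoef (‖p.2.2‖ ^ 2) = c'
  generalize star (v 0).1 * (v 1).1 + star (v 0).2.1 * (v 1).2.1 = S at *
  generalize star (v 1).1 * (v 0).1 + star (v 1).2.1 * (v 0).2.1 = S' at *
  generalize hopfForm p (v 0) = α at *
  generalize hopfForm p (v 1) = β at *
  generalize 2 * inner ℝ p.2.2 (v 0).2.2 = m
  generalize 2 * inner ℝ p.2.2 (v 1).2.2 = m'
  generalize (v 0).2.2 = y at *
  generalize (v 1).2.2 = y' at *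
  generalize p.2.2 = x at *
  -- Eliminating dx = Dx - [θ, x] makes the stray terms in θ cancel.
  obtain rfl : y = ξ - (α * x - x * α) := by rw [hξ]; abel
  obtain rfl : y' = η - (β * x - x * β) := by rw [hη]; abel
  subst hF
  clear hξ hη
  simp only [mul_sub, sub_mul, mul_add, add_mul, smul_sub, smul_add, mul_smul_comm,
    smul_mul_assoc, mul_assoc, smul_smul]
  module

end ConnectionForm

/-! ### The instanton equation on `P` -/

section Model

variable {V V' : Type*} [AddCommGroup V] [Module ℝ V] [AddCommGroup V'] [Module ℝ V']

/-- A covector as a one-form. -/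
def covec (α : Module.Dual ℝ V) : V [⋀^Fin 1]→ₗ[ℝ] ℝ :=
  AlternatingMap.ofSubsingleton ℝ V ℝ (0 : Fin 1) α

theorem covec_apply (α : Module.Dual ℝ V) (v : Fin 1 → V) : covec α v = α (v 0) := rfl

/-- The two-forms `Ω₁, Ω₂, Ω₃` defined by four covectors. -/
noncomputable def asdForm (a : Fin 4 → Module.Dual ℝ V) : Fin 3 → V [⋀^Fin 2]→ₗ[ℝ] ℝ :=
  ![rwedge (covec (a 0)) (covec (a 1)) - rwedge (covec (a 2)) (covec (a 3)),
    rwedge (covec (a 0)) (covec (a 2)) - rwedge (covec (a 3)) (covec (a 1)),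
    rwedge (covec (a 0)) (covec (a 3)) - rwedge (covec (a 1)) (covec (a 2))]

/-- The two-forms `d₂ ∧ d₃, d₃ ∧ d₁, d₁ ∧ d₂`. -/
noncomputable def bivForm (d : Fin 3 → Module.Dual ℝ V) (i : Fin 3) : V [⋀^Fin 2]→ₗ[ℝ] ℝ :=
  rwedge (covec (d (i + 1))) (covec (d (i + 2)))

/-- The four-form of the `G₂`-structure defined by a coframe. -/
noncomputable def psiForm (c : ℝ) (a : Fin 4 → Module.Dual ℝ V) (d : Fin 3 → Module.Dual ℝ V) :
    V [⋀^Fin 4]→ₗ[ℝ] ℝ :=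
  (-(2 / 3) * c : ℝ) • ∑ i : Fin 3, rwedge (asdForm a i) (asdForm a i)
    - (2 : ℝ) • ∑ i : Fin 3, rwedge (bivForm d i) (asdForm a i)

theorem represents_asdForm (a : Fin 4 → Module.Dual ℝ V) (i : Fin 3) :
    Represents (asdElt a i) (asdForm a i) := by
  have h : ∀ i j, Represents (ExteriorAlgebra.ι ℝ (a i) * ExteriorAlgebra.ι ℝ (a j))
      (rwedge (covec (a i)) (covec (a j))) := fun i j => (Represents.one _).mul (Represents.one _)
  fin_cases i
  · exact (h 0 1).sub (h 2 3)
  · exact (h 0 2).sub (h 3 1)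
  · exact (h 0 3).sub (h 1 2)

theorem represents_bivForm (d : Fin 3 → Module.Dual ℝ V) (i : Fin 3) :
    Represents (bivec d i) (bivForm d i) :=
  (Represents.one _).mul (Represents.one _)

theorem represents_psiForm (c : ℝ) (a : Fin 4 → Module.Dual ℝ V) (d : Fin 3 → Module.Dual ℝ V) :
    Represents (psiElt c a d) (psiForm c a d) :=
  ((Represents.sum _ fun i _ => (represents_asdForm a i).mul (represents_asdForm a i)).smul _).sub
    ((Represents.sum _ fun i _ => (represents_bivForm d i).mul (represents_asdForm a i)).smul _)

theorem vwedge_psiForm_eq_zero {W : Type*} [AddCommGroup W] [Module ℝ W] (c : ℝ)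
    (a : Fin 4 → Module.Dual ℝ V) (d : Fin 3 → Module.Dual ℝ V) (B : Fin 3 → W) :
    vwedge (∑ i, tens (bivForm d i - c • asdForm a i) (B i)) (psiForm c a d) = 0 :=
  vwedge_eq_zero_of_represents
    (fun i => (represents_bivForm d i).sub ((represents_asdForm a i).smul c))
    (represents_psiForm c a d) B

theorem compLinearMap_sum {ι : Type*} (s : Finset ι) {n : ℕ} (φ : ι → V [⋀^Fin n]→ₗ[ℝ] ℝ)
    (L : V' →ₗ[ℝ] V) :
    (∑ i ∈ s, φ i).compLinearMap L = ∑ i ∈ s, (φ i).compLinearMap L := by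
  classical
  induction s using Finset.induction_on with
  | empty => rfl
  | insert i s hi ih =>
    rw [Finset.sum_insert hi, Finset.sum_insert hi, AlternatingMap.add_compLinearMap, ih]

theorem psiP_compLinearMap {p : Amb} {L : V →ₗ[ℝ] Amb} {a : Fin 4 → Module.Dual ℝ V}
    {d : Fin 3 → Module.Dual ℝ V} (ha : ∀ i, (OmP i p).compLinearMap L = asdForm a i)
    (hd : ∀ i v, Dx i p (L v) = d i v) :
    (psiP p).compLinearMap L = psiForm (1 + ‖p.2.2‖ ^ 2) a d := by
  have hd' : ∀ i, (oneForm (Dx i p)).compLinearMap L = covec (d i) := fun i => by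
    ext v
    exact hd i (v 0)
  have e : (psiP p).compLinearMap L =
      (-(2 / 3) * (1 + ‖p.2.2‖ ^ 2) : ℝ) •
        ∑ i : Fin 3, (rwedge (OmP i p) (OmP i p)).compLinearMap L
      - (2 : ℝ) • ∑ i : Fin 3, (rwedge (rwedge (oneForm (Dx (i + 1) p)) (oneForm (Dx (i + 2) p)))
        (OmP i p)).compLinearMap L := by
    rw [← compLinearMap_sum, ← compLinearMap_sum]
    rfl
  rw [e]
  simp only [rwedge_compLinearMap, ha, hd']
  rfl

end Model

/-! ### Adapted frames and the algebra of the curvature on `P`. -/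

section InstantonOnP

/-- `(a, b)` and `(n₁, n₂)` are the columns of a quaternionic unitary matrix. -/
structure IsFrame (a b n₁ n₂ : ℍ) : Prop where
  fst : a * star a + n₁ * star n₁ = 1
  mixed : a * star b + n₁ * star n₂ = 0
  snd : b * star b + n₂ * star n₂ = 1

/-- For the unitary matrix g with these columns, insert gg^* = 1 between v^* and w. -/
theorem IsFrame.star_mul_add_star_mul {a b n₁ n₂ : ℍ} (h : IsFrame a b n₁ n₂) (v₁ v₂ w₁ w₂ : ℍ) :
    star v₁ * w₁ + star v₂ * w₂ =
      star (star a * v₁ + star b * v₂) * (star a * w₁ + star b * w₂)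
        + star (star n₁ * v₁ + star n₂ * v₂) * (star n₁ * w₁ + star n₂ * w₂) := by
  have h' : b * star a + n₂ * star n₁ = 0 := by simpa using congrArg star h.mixed
  calc star v₁ * w₁ + star v₂ * w₂ = star v₁ * (a * star a + n₁ * star n₁) * w₁
      + star v₁ * (a * star b + n₁ * star n₂) * w₂
      + star v₂ * (b * star a + n₂ * star n₁) * w₁
      + star v₂ * (b * star b + n₂ * star n₂) * w₂ := by
        rw [h.fst, h.mixed, h', h.snd]; simp
    _ = _ := by
      simp only [star_add, star_mul, star_star]
      noncomm_ring

theorem exists_isFrame {a b : ℍ} (h : Quaternion.normSq a + Quaternion.normSq b = 1) :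
    ∃ n₁ n₂, IsFrame a b n₁ n₂ ∧ Quaternion.normSq n₁ + Quaternion.normSq n₂ = 1 ∧
      star a * n₁ + star b * n₂ = 0 := by
  by_cases hb : b = 0
  · subst hb
    rw [map_zero, add_zero] at h
    exact ⟨0, 1, ⟨by rw [Quaternion.self_mul_star, h]; simp, by simp, by simp⟩, by simp, by simp⟩
  · have hb0 : Quaternion.normSq b ≠ 0 := Quaternion.normSq_ne_zero.2 hb
    have hbp : 0 < Quaternion.normSq b := lt_of_le_of_ne Quaternion.normSq_nonneg hb0.symm
    obtain ⟨r, hr, hr2⟩ : ∃ r : ℝ, 0 < r ∧ r ^ 2 = Quaternion.normSq b :=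
      ⟨√(Quaternion.normSq b), Real.sqrt_pos.2 hbp, Real.sq_sqrt hbp.le⟩
    have hn : Quaternion.normSq (-(r⁻¹ • (b * star a))) = Quaternion.normSq a := by
      rw [Quaternion.normSq_neg, Quaternion.normSq_smul, map_mul, Quaternion.normSq_star, ← hr2]
      field_simp
    -- With r = |b|, the vector (r, -ba^*/r) is orthogonal to (a, b), and its length is one.
    refine ⟨(r : ℍ), -(r⁻¹ • (b * star a)), ⟨?_, ?_, ?_⟩, ?_, ?_⟩
    · rw [Quaternion.self_mul_star, Quaternion.self_mul_star, Quaternion.normSq_coe, hr2,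
        ← Quaternion.coe_add, h, Quaternion.coe_one]
    · rw [star_neg, Quaternion.star_smul, star_mul, star_star, mul_neg, mul_smul_comm,
        Quaternion.coe_mul_eq_smul, smul_smul, inv_mul_cancel₀ hr.ne', one_smul, add_neg_cancel]
    · rw [Quaternion.self_mul_star, Quaternion.self_mul_star, hn, ← Quaternion.coe_add, add_comm, h,
        Quaternion.coe_one]
    · rw [hn, Quaternion.normSq_coe, hr2, add_comm, h]
    · rw [mul_neg, mul_smul_comm, ← mul_assoc, Quaternion.star_mul_self,
        Quaternion.coe_mul_eq_smul, smul_smul, ← hr2, Quaternion.mul_coe_eq_smul,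
        show r⁻¹ * r ^ 2 = r by field_simp, add_neg_cancel]

theorem star_eq_neg_of_re {x : ℍ} (h : x.re = 0) : star x = -x :=
  Quaternion.ext _ _ (by simp [h]) (by simp) (by simp) (by simp)

/-- The component `q ↦ n^* q` of a tangent vector. -/
noncomputable def frameForm (n₁ n₂ : ℍ) : Amb →ₗ[ℝ] ℍ where
  toFun v := star n₁ * v.1 + star n₂ * v.2.1
  map_add' v w := by simp only [Prod.fst_add, Prod.snd_add, mul_add]; abel
  map_smul' c v := by simp

/-- In the frame (q, n), dθ splits into a part along q and a part along n. Since θ is imaginary, the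
bracket term cancels the first, which shows that the curvature is horizontal. -/
theorem curvature_hopfForm_eq_frame {p : Amb} {n₁ n₂ : ℍ} (h : IsFrame p.1 p.2.1 n₁ n₂)
    {v : Fin 2 → Amb} (hv : ∀ i, (hopfForm p (v i)).re = 0) :
    curvature hopfForm p v = star (frameForm n₁ n₂ (v 0)) * frameForm n₁ n₂ (v 1)
      - star (frameForm n₁ n₂ (v 1)) * frameForm n₁ n₂ (v 0) := by
  rw [curvature_hopfForm_apply, h.star_mul_add_star_mul (v 0).1 (v 0).2.1 (v 1).1 (v 1).2.1,
    h.star_mul_add_star_mul (v 1).1 (v 1).2.1 (v 0).1 (v 0).2.1]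
  change star (hopfForm p (v 0)) * hopfForm p (v 1)
      + star (frameForm n₁ n₂ (v 0)) * frameForm n₁ n₂ (v 1)
      - (star (hopfForm p (v 1)) * hopfForm p (v 0)
        + star (frameForm n₁ n₂ (v 1)) * frameForm n₁ n₂ (v 0))
      + (hopfForm p (v 0) * hopfForm p (v 1) - hopfForm p (v 1) * hopfForm p (v 0)) = _
  rw [star_eq_neg_of_re (hv 0), star_eq_neg_of_re (hv 1)]
  noncomm_ring

/-- The covectors `e¹, …, e⁴` defined by a quaternion-valued linear form. -/
noncomputable def quatCovec {V : Type*} [AddCommGroup V] [Module ℝ V] (ν : V →ₗ[ℝ] ℍ) :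
    Fin 4 → Module.Dual ℝ V :=
  fun i => (2 : ℝ) • ((innerSL ℝ ((![1, T 0, T 1, T 2] : Fin 4 → ℍ) i) : ℍ →ₗ[ℝ] ℝ) ∘ₗ ν)

theorem quatCovec_apply {V : Type*} [AddCommGroup V] [Module ℝ V] (ν : V →ₗ[ℝ] ℍ) (v : V)
    (i : Fin 4) :
    quatCovec ν i v = 2 * ![(ν v).re, (ν v).imI, (ν v).imJ, (ν v).imK] i := by
  simp only [quatCovec, LinearMap.smul_apply, LinearMap.comp_apply, smul_eq_mul]
  congr 1
  change inner ℝ ((![1, T 0, T 1, T 2] : Fin 4 → ℍ) i) (ν v) = _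
  rw [quaternion_inner_eq]
  fin_cases i <;> simp [T]

/-- The imaginary components of ν^*∧ν form a triple of type Ωᵢ. Each eⁱ is twice a component of ν,
giving a factor 4, of which the commutator supplies 2. -/
theorem asdForm_quatCovec {V : Type*} [AddCommGroup V] [Module ℝ V] (ν : V →ₗ[ℝ] ℍ)
    (v : Fin 2 → V) (i : Fin 3) : asdForm (quatCovec ν) i v =
      2 * inner ℝ (T i) (star (ν (v 0)) * ν (v 1) - star (ν (v 1)) * ν (v 0)) := by
  rw [inner_T]
  fin_cases i <;> simp [asdForm, rwedge_one_one_apply, covec_apply, quatCovec_apply] <;> ring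

theorem OmP_apply (i : Fin 3) (p : Amb) (v : Fin 2 → Amb) :
    OmP i p v = 2 * inner ℝ (T i) (curvature hopfForm p v) := rfl

/-- The tangent space of `P` as a subspace. -/
noncomputable def tangentSubmodule (p : Amb) : Submodule ℝ Amb where
  carrier := tangentP p
  add_mem' {v w} hv hw := by
    refine ⟨?_, by simp [hv.2, hw.2]⟩
    have h1 : (hopfForm p v).re = 0 := hv.1
    have h2 : (hopfForm p w).re = 0 := hw.1
    change (hopfForm p (v + w)).re = 0
    rw [map_add, Quaternion.re_add, h1, h2, add_zero]
  zero_mem' := by simp [tangentP]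
  smul_mem' c v hv := by
    refine ⟨?_, by simp [hv.2]⟩
    have h1 : (hopfForm p v).re = 0 := hv.1
    change (hopfForm p (c • v)).re = 0
    rw [map_smul, Quaternion.re_smul, h1, smul_zero]

theorem covDeriv_re {p v : Amb} (hv : v ∈ tangentP p) : (covDeriv p v).re = 0 := by
  rw [covDeriv_apply, Quaternion.re_add, hv.2, Quaternion.re_sub, re_mul_comm, sub_self, add_zero]

theorem inner_commutator (x y : ℍ) : inner ℝ x (y * x - x * y) = 0 := by
  rw [quaternion_inner_eq]
  simp
  ring

theorem T_re (j : Fin 3) : (T j).re = 0 := by fin_cases j <;> rfl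
theorem T_imI (j : Fin 3) : (T j).imI = ![1, 0, 0] j := by fin_cases j <;> rfl
theorem T_imJ (j : Fin 3) : (T j).imJ = ![0, 1, 0] j := by fin_cases j <;> rfl
theorem T_imK (j : Fin 3) : (T j).imK = ![0, 0, 1] j := by fin_cases j <;> rfl

/-- On Im ℍ = ℝ³ the commutator is twice the cross product. The left side is then (1 + 4c|x|²)F -
4c(x·F)x + (4c + 4c'|x|²) ξ×η + (8c² - 4c')(x·(ξ×η))x, and the four hypotheses match these
coefficients with those of K₀Tⱼ + K₁xⱼx. -/
theorem instanton_algebra {x F ξ η : ℍ} (hx : x.re = 0) (hF : F.re = 0) (hξ : ξ.re = 0)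
    (hη : η.re = 0) {c c' K₀ K₁ : ℝ} (h₀ : -2 * (1 + ‖x‖ ^ 2) * K₀ = 1 + 4 * c * ‖x‖ ^ 2)
    (h₁ : -2 * (1 + ‖x‖ ^ 2) * K₁ = -4 * c) (hK₀ : K₀ = 4 * c + 4 * c' * ‖x‖ ^ 2)
    (hK₁ : K₁ = 8 * c ^ 2 - 4 * c') :
    F + c' • ((2 * inner ℝ x ξ) • (x * η - η * x) - (2 * inner ℝ x η) • (x * ξ - ξ * x))
      + c • ((2 : ℝ) • (ξ * η - η * ξ) + (x * (F * x - x * F) - (F * x - x * F) * x))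
      + c ^ 2 • ((x * ξ - ξ * x) * (x * η - η * x) - (x * η - η * x) * (x * ξ - ξ * x)) =
    ∑ j : Fin 3, (inner ℝ (T (j + 1)) ξ * inner ℝ (T (j + 2)) η
        - inner ℝ (T (j + 1)) η * inner ℝ (T (j + 2)) ξ
        - (1 + ‖x‖ ^ 2) * (2 * inner ℝ (T j) F)) • (K₀ • T j + (K₁ * inner ℝ (T j) x) • x) := by
  have hn : ‖x‖ ^ 2 = x.imI ^ 2 + x.imJ ^ 2 + x.imK ^ 2 := by
    rw [← real_inner_self_eq_norm_sq, quaternion_inner_eq, hx]; ring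
  rw [hn] at h₀ h₁ hK₀ ⊢
  simp only [inner_T, quaternion_inner_eq x]
  have s0 : ((0 : Fin 3) + 1) = 1 := rfl
  have s1 : ((0 : Fin 3) + 2) = 2 := rfl
  have s2 : ((1 : Fin 3) + 1) = 2 := rfl
  have s3 : ((1 : Fin 3) + 2) = 0 := rfl
  have s4 : ((2 : Fin 3) + 1) = 0 := rfl
  have s5 : ((2 : Fin 3) + 2) = 1 := rfl
  refine Quaternion.ext _ _ ?_ ?_ ?_ ?_ <;>
    simp [Fin.sum_univ_three, s0, s1, s2, s3, s4, s5, T_re, T_imI, T_imJ, T_imK, hx, hF, hξ, hη]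
  · ring
  · linear_combination (-F.imI) * h₀
      - (x.imI * F.imI + x.imJ * F.imJ + x.imK * F.imK) * x.imI * h₁
      - (ξ.imJ * η.imK - η.imJ * ξ.imK) * hK₀
      - (x.imI * (ξ.imJ * η.imK - η.imJ * ξ.imK) + x.imJ * (ξ.imK * η.imI - η.imK * ξ.imI)
        + x.imK * (ξ.imI * η.imJ - η.imI * ξ.imJ)) * x.imI * hK₁
  · linear_combination (-F.imJ) * h₀
      - (x.imI * F.imI + x.imJ * F.imJ + x.imK * F.imK) * x.imJ * h₁
      - (ξ.imK * η.imI - η.imK * ξ.imI) * hK₀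
      - (x.imI * (ξ.imJ * η.imK - η.imJ * ξ.imK) + x.imJ * (ξ.imK * η.imI - η.imK * ξ.imI)
        + x.imK * (ξ.imI * η.imJ - η.imI * ξ.imJ)) * x.imJ * hK₁
  · linear_combination (-F.imK) * h₀
      - (x.imI * F.imI + x.imJ * F.imJ + x.imK * F.imK) * x.imK * h₁
      - (ξ.imI * η.imJ - η.imI * ξ.imJ) * hK₀
      - (x.imI * (ξ.imJ * η.imK - η.imJ * ξ.imK) + x.imJ * (ξ.imK * η.imI - η.imK * ξ.imI)
        + x.imK * (ξ.imI * η.imJ - η.imI * ξ.imJ)) * x.imK * hK₁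

end InstantonOnP

/-- Four equations in two unknowns. Eliminating K₀ and K₁ leaves two relations between c and its
derivative, which this ansatz needs for the instanton equation. -/
theorem connCoef_identities {u : ℝ} (hu : 0 ≤ u) : ∃ K₀ K₁ : ℝ,
    -2 * (1 + u) * K₀ = 1 + 4 * connCoef u * u ∧ -2 * (1 + u) * K₁ = -4 * connCoef u ∧
    K₀ = 4 * connCoef u + 4 * deriv connCoef u * u ∧
    K₁ = 8 * connCoef u ^ 2 - 4 * deriv connCoef u := by
  rw [(hasDerivAt_connCoef hu).deriv, connCoef]
  obtain ⟨r, hr, hr2⟩ : ∃ r : ℝ, 0 < r ∧ √(1 + u) = r :=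
    ⟨√(1 + u), Real.sqrt_pos.2 (by linarith), rfl⟩
  obtain rfl : u = r ^ 2 - 1 := by rw [← hr2, Real.sq_sqrt (by linarith)]; ring
  rw [hr2]
  -- Both values are read off from the first two equations, using 1 + 4cu = 1/r.
  refine ⟨-(2 * r ^ 3)⁻¹, -(2 * r ^ 3 * (1 + r))⁻¹, ?_, ?_, ?_, ?_⟩ <;> field_simp <;> ring

theorem frameForm_commutator_re (y z : ℍ) : (star y * z - star z * y).re = 0 := by
  simp
  ring

/-- The components of the covariant differential as covectors on the tangent space. -/
noncomputable def DxDual (p : Amb) (i : Fin 3) : Module.Dual ℝ (tangentSubmodule p) :=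
  (Dx i p : Amb →ₗ[ℝ] ℝ) ∘ₗ (tangentSubmodule p).subtype

theorem OmP_compLinearMap {p : Amb} {n₁ n₂ : ℍ} (h : IsFrame p.1 p.2.1 n₁ n₂) (i : Fin 3) :
    (OmP i p).compLinearMap (tangentSubmodule p).subtype =
      asdForm (quatCovec (frameForm n₁ n₂ ∘ₗ (tangentSubmodule p).subtype)) i := by
  refine AlternatingMap.ext fun v => ?_
  rw [asdForm_quatCovec]
  exact congrArg (fun F => 2 * inner ℝ (T i) F)
    (curvature_hopfForm_eq_frame h (v := fun i => ((v i : Amb))) fun i => (v i).2.1)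

theorem curvature_connForm_compLinearMap {p : Amb} (hp : p ∈ P) {n₁ n₂ : ℍ}
    (h : IsFrame p.1 p.2.1 n₁ n₂) : ∃ B : Fin 3 → ℍ,
    (curvature connForm p).compLinearMap (tangentSubmodule p).subtype =
      ∑ j, tens (bivForm (DxDual p) j - (1 + ‖p.2.2‖ ^ 2) •
        asdForm (quatCovec (frameForm n₁ n₂ ∘ₗ (tangentSubmodule p).subtype)) j) (B j) := by
  obtain ⟨K₀, K₁, h₀, h₁, hK₀, hK₁⟩ := connCoef_identities (sq_nonneg ‖p.2.2‖)
  refine ⟨fun j => K₀ • T j + (K₁ * inner ℝ (T j) p.2.2) • p.2.2, AlternatingMap.ext fun v => ?_⟩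
  have hF := curvature_hopfForm_eq_frame h (v := fun i => ((v i : Amb))) fun i => (v i).2.1
  -- The derivative of |x|² may be computed with Dx, since [θ, x] is orthogonal to x.
  have hi : ∀ w : Amb, inner ℝ p.2.2 w.2.2 = inner ℝ p.2.2 (covDeriv p w) := fun w => by
    rw [covDeriv_apply, inner_add_right, inner_commutator, add_zero]
  rw [AlternatingMap.compLinearMap_apply]
  refine (curvature_connForm_apply p _ hF.symm rfl rfl).trans ?_
  rw [hi, hi]
  refine (instanton_algebra hp.2 (frameForm_commutator_re _ _) (covDeriv_re (v 0).2)
    (covDeriv_re (v 1).2) h₀ h₁ hK₀ hK₁).trans ?_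
  have hs : ∀ φ : Fin 3 → (tangentSubmodule p) [⋀^Fin 2]→ₗ[ℝ] ℍ,
      (∑ j, φ j) v = ∑ j, φ j v := fun φ => by
    simp only [Fin.sum_univ_three, AlternatingMap.add_apply]
  rw [hs]
  refine Finset.sum_congr rfl fun j _ => ?_
  change _ = (bivForm (DxDual p) j v - (1 + ‖p.2.2‖ ^ 2) * asdForm
    (quatCovec (frameForm n₁ n₂ ∘ₗ (tangentSubmodule p).subtype)) j v) •
      (K₀ • T j + (K₁ * inner ℝ (T j) p.2.2) • p.2.2)
  rw [asdForm_quatCovec, bivForm, rwedge_one_one_apply]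
  rfl

set_option maxRecDepth 10000 in
theorem vwedge_curvature_connForm {p : Amb} (hp : p ∈ P) {v : Fin 6 → Amb}
    (hv : ∀ i, v i ∈ tangentP p) : vwedge (curvature connForm p) (psiP p) v = 0 := by
  obtain ⟨n₁, n₂, h, -, -⟩ := exists_isFrame hp.1
  obtain ⟨B, hB⟩ := curvature_connForm_compLinearMap hp h
  have h0 := vwedge_compLinearMap (curvature connForm p) (psiP p) (tangentSubmodule p).subtype
  rw [hB, psiP_compLinearMap (OmP_compLinearMap h) (d := DxDual p) fun i v => rfl,
    vwedge_psiForm_eq_zero] at h0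
  have h1 := DFunLike.congr_fun h0 fun i : Fin (2 + 4) => (⟨v i, hv i⟩ : tangentSubmodule p)
  exact h1

/-! ### The connection -/

theorem hopfForm_act (p v : Amb) (h : unitary ℍ) :
    hopfForm (act p h) (act v h) = star (h : ℍ) * hopfForm p v * h := by
  simp only [hopfForm_apply, act, star_mul, mul_add, add_mul, mul_assoc]

theorem conj_mul_conj (x y : ℍ) (h : unitary ℍ) :
    (star (h : ℍ) * x * h) * (star (h : ℍ) * y * h) = star (h : ℍ) * (x * y) * h := by
  calc _ = star (h : ℍ) * x * (h * star (h : ℍ)) * y * h := by simp only [mul_assoc]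
    _ = _ := by rw [mul_star_self_unitary]; simp only [mul_assoc, one_mul]

theorem covDeriv_act (p v : Amb) (h : unitary ℍ) :
    covDeriv (act p h) (act v h) = star (h : ℍ) * covDeriv p v * h := by
  have e : ∀ q : Amb, (act q h).2.2 = star (h : ℍ) * q.2.2 * h := fun q => rfl
  simp only [covDeriv_apply, hopfForm_act, e, conj_mul_conj]
  simp only [mul_add, add_mul, mul_sub, sub_mul]

theorem norm_conj (x : ℍ) (h : unitary ℍ) : ‖star (h : ℍ) * x * h‖ = ‖x‖ := by
  rw [← sq_eq_sq₀ (norm_nonneg _) (norm_nonneg _), ← real_inner_self_eq_norm_sq, inner_conj,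
    real_inner_self_eq_norm_sq]

theorem connForm_act (p v : Amb) (h : unitary ℍ) :
    connForm (act p h) (act v h) = star (h : ℍ) * connForm p v * h := by
  have e : (act p h).2.2 = star (h : ℍ) * p.2.2 * h := rfl
  simp only [connForm_apply, hopfForm_act, covDeriv_act, e, conj_mul_conj, norm_conj]
  simp only [mul_add, add_mul, mul_sub, sub_mul, mul_smul_comm, smul_mul_assoc]

theorem hopfForm_fundamental {p : Amb} (hp : p ∈ P) (ζ : ℍ) :
    hopfForm p (fundamental p ζ) = ζ := by
  simp only [hopfForm_apply, fundamental, ← mul_assoc, Quaternion.star_mul_self, ← add_mul,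
    ← Quaternion.coe_add, hp.1, Quaternion.coe_one, one_mul]

/-- The bracket [ζ, x] cancels the infinitesimal action on x. Adding a multiple of [x, Dx] to θ
therefore leaves its values on vertical vectors unchanged. -/
theorem covDeriv_fundamental {p : Amb} (hp : p ∈ P) (ζ : ℍ) :
    covDeriv p (fundamental p ζ) = 0 := by
  rw [covDeriv_apply, hopfForm_fundamental hp]
  simp [fundamental]

theorem connForm_fundamental {p : Amb} (hp : p ∈ P) (ζ : ℍ) :
    connForm p (fundamental p ζ) = ζ := by
  rw [connForm_apply, hopfForm_fundamental hp, covDeriv_fundamental hp]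
  simp

/-- The connection `q^* dq + c(|x|²) [x, Dx]` on `P`. -/
noncomputable def instantonConnection : Connection where
  form := connForm
  smooth := contDiff_connForm
  imaginary p hp v hv := by
    have h1 : (hopfForm p v).re = 0 := hv.1
    rw [connForm_apply, Quaternion.re_add, h1, Quaternion.re_smul, Quaternion.re_sub,
      re_mul_comm p.2.2, sub_self]
    simp
  equivariant p _ v _ h := connForm_act p v h
  fundamental p hp ζ _ := connForm_fundamental hp ζ

set_option maxRecDepth 10000 in
theorem instantonConnection_isG2Instanton : instantonConnection.IsG2Instanton :=
  fun _ hp _ hv => vwedge_curvature_connForm hp hv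

/-! ### Irreducibility -/

/-- With q fixed θ vanishes, and on a segment between commuting elements dx commutes with x, so [x,
Dx] = 0. -/
theorem horizontallyJoined_radial {p : Amb} (hp : p ∈ P) {x : ℍ} (hx : x.re = 0)
    (hc : p.2.2 * x = x * p.2.2) :
    instantonConnection.HorizontallyJoined p (p.1, p.2.1, x) := by
  have hd : ∀ τ : ℝ, HasDerivAt (fun τ : ℝ => ((p.1, p.2.1, p.2.2 + τ • (x - p.2.2)) : Amb))
      (0, 0, x - p.2.2) τ := fun τ =>
    (hasDerivAt_const τ p.1).prodMk ((hasDerivAt_const τ p.2.1).prodMk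
      (by simpa using ((hasDerivAt_id τ).smul_const (x - p.2.2)).const_add p.2.2))
  refine ⟨fun τ => (p.1, p.2.1, p.2.2 + τ • (x - p.2.2)), ?_, by simp, by simp, fun τ _ => ⟨?_, ?_⟩⟩
  · exact contDiff_const.prodMk (contDiff_const.prodMk
      (contDiff_const.add (contDiff_id.smul contDiff_const)))
  · exact ⟨hp.1, by simp [hx, hp.2]⟩
  · rw [(hd τ).deriv]
    change connForm _ _ = 0
    have h0 : hopfForm (p.1, p.2.1, p.2.2 + τ • (x - p.2.2)) (0, 0, x - p.2.2) = 0 := by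
      simp [hopfForm_apply]
    rw [connForm_apply, covDeriv_apply, h0]
    simp only [zero_mul, mul_zero, sub_zero, add_zero, zero_add]
    rw [add_mul, mul_add, smul_mul_assoc, mul_smul_comm, add_sub_add_right_eq_sub, mul_sub, sub_mul,
      hc, sub_sub_sub_cancel_right, sub_self, smul_zero]

/-- On the zero section the connection is θ, and q^*dq vanishes along the great circle through two
quaternionically orthogonal unit vectors. -/
theorem horizontallyJoined_circle {a b n₁ n₂ : ℍ}
    (hq : Quaternion.normSq a + Quaternion.normSq b = 1)
    (hn : Quaternion.normSq n₁ + Quaternion.normSq n₂ = 1) (h : star a * n₁ + star b * n₂ = 0) :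
    instantonConnection.HorizontallyJoined (a, b, 0) (n₁, n₂, 0) := by
  have h' : star n₁ * a + star n₂ * b = 0 := by simpa using congrArg star h
  have hC : ∀ τ : ℝ, HasDerivAt (fun τ : ℝ => Real.cos (Real.pi / 2 * τ))
      (-Real.sin (Real.pi / 2 * τ) * (Real.pi / 2)) τ := fun τ => by
    simpa using ((hasDerivAt_id τ).const_mul (Real.pi / 2)).cos
  have hS : ∀ τ : ℝ, HasDerivAt (fun τ : ℝ => Real.sin (Real.pi / 2 * τ))
      (Real.cos (Real.pi / 2 * τ) * (Real.pi / 2)) τ := fun τ => by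
    simpa using ((hasDerivAt_id τ).const_mul (Real.pi / 2)).sin
  have hd := fun τ => (((hC τ).smul_const a).add ((hS τ).smul_const n₁)).prodMk
    ((((hC τ).smul_const b).add ((hS τ).smul_const n₂)).prodMk (hasDerivAt_const τ (0 : ℍ)))
  have cC : ContDiff ℝ 1 fun τ : ℝ => Real.cos (Real.pi / 2 * τ) :=
    Real.contDiff_cos.comp (contDiff_const.mul contDiff_id)
  have cS : ContDiff ℝ 1 fun τ : ℝ => Real.sin (Real.pi / 2 * τ) :=
    Real.contDiff_sin.comp (contDiff_const.mul contDiff_id)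
  -- Serves twice: with equal coefficient pairs it shows that the curve stays in S⁷, and with the
  -- derivatives of cosine and sine that it is horizontal.
  have key : ∀ C S C' S' : ℝ, star (C • a + S • n₁) * (C' • a + S' • n₁)
      + star (C • b + S • n₂) * (C' • b + S' • n₂) = ((C * C' + S * S' : ℝ) : ℍ) := by
    intro C S C' S'
    have e1 : star a * a + star b * b = 1 := by
      rw [Quaternion.star_mul_self, Quaternion.star_mul_self, ← Quaternion.coe_add, hq,
        Quaternion.coe_one]
    have e2 : star n₁ * n₁ + star n₂ * n₂ = 1 := by
      rw [Quaternion.star_mul_self, Quaternion.star_mul_self, ← Quaternion.coe_add, hn,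
        Quaternion.coe_one]
    calc _ = (C * C') • (star a * a + star b * b) + (S * S') • (star n₁ * n₁ + star n₂ * n₂)
          + (C * S') • (star a * n₁ + star b * n₂) + (S * C') • (star n₁ * a + star n₂ * b) := by
          simp only [star_add, Quaternion.star_smul, mul_add, add_mul, smul_mul_assoc,
            mul_smul_comm, smul_add, smul_smul]
          simp only [mul_comm C', mul_comm S']
          abel
      _ = _ := by
          rw [e1, e2, h, h', smul_zero, smul_zero, add_zero, add_zero, ← add_smul,
            ← mul_one ((C * C' + S * S' : ℝ) : ℍ), Quaternion.coe_mul_eq_smul]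
  refine ⟨fun τ => (Real.cos (Real.pi / 2 * τ) • a + Real.sin (Real.pi / 2 * τ) • n₁,
    Real.cos (Real.pi / 2 * τ) • b + Real.sin (Real.pi / 2 * τ) • n₂, 0), ?_, by simp, by simp,
    fun τ _ => ⟨⟨?_, by simp⟩, ?_⟩⟩
  · exact ((cC.smul contDiff_const).add (cS.smul contDiff_const)).prodMk
      (((cC.smul contDiff_const).add (cS.smul contDiff_const)).prodMk contDiff_const)
  · apply Quaternion.coe_injective
    rw [Quaternion.coe_add, ← Quaternion.star_mul_self, ← Quaternion.star_mul_self]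
    refine (key _ _ _ _).trans ?_
    rw [← sq, ← sq, Real.cos_sq_add_sin_sq]
  · have := (hd τ).deriv
    erw [this]
    change connForm _ _ = 0
    rw [connForm_apply, hopfForm_apply]
    simp only [zero_mul, mul_zero, sub_self, smul_zero, add_zero]
    refine (key _ _ _ _).trans ?_
    rw [← Quaternion.coe_zero]
    congr 1
    ring

/-- Go down to the zero section, along a great circle to some n orthogonal to q, along another from
n to qh, which is also orthogonal to n, and back up radially. -/
theorem instantonConnection_isIrreducible : instantonConnection.IsIrreducible := by
  intro p hp
  refine Set.eq_univ_of_forall fun h => ?_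
  obtain ⟨n₁, n₂, -, hn, ho⟩ := exists_isFrame hp.1
  have hp0 : ((p.1, p.2.1, 0) : Amb) ∈ P := ⟨hp.1, by simp⟩
  have hph := act_mem_P hp h
  have hq0 : (((act p h).1, (act p h).2.1, 0) : Amb) ∈ P := ⟨hph.1, by simp⟩
  have ho' : star n₁ * p.1 + star n₂ * p.2.1 = 0 := by simpa using congrArg star ho
  have e1 := horizontallyJoined_radial hp (x := 0) (by simp) (by simp)
  have e2 := horizontallyJoined_circle hp.1 hn ho
  have e3 := horizontallyJoined_circle (n₁ := p.1 * h) (n₂ := p.2.1 * h) hn hph.1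
    (by rw [← mul_assoc, ← mul_assoc, ← add_mul, ho', zero_mul])
  have e4 := horizontallyJoined_radial hq0 (x := (act p h).2.2) hph.2 (by simp)
  exact (((Relation.ReflTransGen.single e1).tail e2).tail e3).tail e4

/-! ### The Bryant-Salamon structure on `ℝ⁺ × Sp(2)` -/

section Homogeneous

theorem maurerCartan_apply (a b : Fin 2) (p w : ℝ × Mat) :
    maurerCartan a b p w = star (p.2 0 a) * w.2 0 b + star (p.2 1 a) * w.2 1 b := by
  simp [maurerCartan, Fin.sum_univ_two]

theorem om_apply (i : Fin 3) (p w : ℝ × Mat) :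
    om i p w = inner ℝ (T i) (maurerCartan 1 1 p w) := rfl

theorem isFrame_of_mem_Sp2 {g : Mat} (hg : g ∈ Sp2) : IsFrame (g 0 1) (g 1 1) (g 0 0) (g 1 0) := by
  have h := fun i j => congrFun (congrFun (Unitary.mem_iff.1 hg).2 i) j
  simp only [Matrix.star_eq_conjTranspose, Matrix.mul_apply, Fin.sum_univ_two,
    Matrix.conjTranspose_apply, Matrix.of_apply] at h
  refine ⟨?_, ?_, ?_⟩ <;> rw [add_comm]
  · exact h 0 0
  · exact h 0 1
  · exact h 1 1

theorem normSq_of_mem_Sp2 {g : Mat} (hg : g ∈ Sp2) :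
    Quaternion.normSq (g 0 1) + Quaternion.normSq (g 1 1) = 1 := by
  have h := congrFun (congrFun (Unitary.mem_iff.1 hg).1 1) 1
  simp only [Matrix.star_eq_conjTranspose, Matrix.mul_apply, Fin.sum_univ_two,
    Matrix.conjTranspose_apply, Matrix.of_apply, Quaternion.star_mul_self] at h
  exact Quaternion.coe_injective (by rw [Quaternion.coe_add]; exact h)

/-- The tangent space of `ℝ⁺ × Sp(2)` as a subspace. -/
def tangentSpSubmodule (p : ℝ × Mat) : Submodule ℝ (ℝ × Mat) where
  carrier := tangentSp p
  add_mem' {v w} hv hw := by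
    have hv' : (Matrix.of p.2)ᴴ * Matrix.of v.2 + (Matrix.of v.2)ᴴ * Matrix.of p.2 = 0 := hv
    have hw' : (Matrix.of p.2)ᴴ * Matrix.of w.2 + (Matrix.of w.2)ᴴ * Matrix.of p.2 = 0 := hw
    change (Matrix.of p.2)ᴴ * (Matrix.of v.2 + Matrix.of w.2)
      + (Matrix.of v.2 + Matrix.of w.2)ᴴ * Matrix.of p.2 = 0
    rw [Matrix.conjTranspose_add, mul_add, add_mul, add_add_add_comm, hv', hw', add_zero]
  zero_mem' := by
    change (Matrix.of p.2)ᴴ * (0 : Matrix (Fin 2) (Fin 2) ℍ)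
      + (0 : Matrix (Fin 2) (Fin 2) ℍ)ᴴ * Matrix.of p.2 = 0
    simp
  smul_mem' c v hv := by
    have hv' : (Matrix.of p.2)ᴴ * Matrix.of v.2 + (Matrix.of v.2)ᴴ * Matrix.of p.2 = 0 := hv
    have e : (c • Matrix.of v.2)ᴴ = c • (Matrix.of v.2)ᴴ :=
      Matrix.ext fun i j => Quaternion.star_smul c _
    change (Matrix.of p.2)ᴴ * (c • Matrix.of v.2) + (c • Matrix.of v.2)ᴴ * Matrix.of p.2 = 0
    rw [e, Matrix.mul_smul, Matrix.smul_mul, ← smul_add, hv', smul_zero]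

theorem maurerCartan_re {p w : ℝ × Mat} (hw : w ∈ tangentSp p) :
    (maurerCartan 1 1 p w).re = 0 := by
  have h := congrFun (congrFun hw 1) 1
  simp only [Matrix.add_apply, Matrix.mul_apply, Fin.sum_univ_two, Matrix.conjTranspose_apply,
    Matrix.of_apply, Matrix.zero_apply] at h
  have h2 : maurerCartan 1 1 p w + star (maurerCartan 1 1 p w) = 0 := by
    rw [maurerCartan_apply, star_add, star_mul, star_mul, star_star, star_star]
    exact h
  have h3 := congrArg QuaternionAlgebra.re h2
  simp at h3
  exact h3

theorem om_eq (i : Fin 3) (p w : ℝ × Mat) : om i p w =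
    ![(maurerCartan 1 1 p w).imI, (maurerCartan 1 1 p w).imJ, (maurerCartan 1 1 p w).imK] i := by
  rw [om_apply, inner_T]

/-- The coframe `e¹, e², σ e³, σ e⁴`. -/
noncomputable def spA (σ : ℝ) (p : ℝ × Mat) : Fin 4 → Module.Dual ℝ (ℝ × Mat) :=
  ![(e 0 p : ℝ × Mat →ₗ[ℝ] ℝ), (e 1 p : ℝ × Mat →ₗ[ℝ] ℝ), σ • (e 2 p : ℝ × Mat →ₗ[ℝ] ℝ),
    σ • (e 3 p : ℝ × Mat →ₗ[ℝ] ℝ)]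

/-- The coframe `ds, 2σs ω³, -2σs ω²`. -/
noncomputable def spD (σ : ℝ) (p : ℝ × Mat) : Fin 3 → Module.Dual ℝ (ℝ × Mat) :=
  ![(ds : ℝ × Mat →ₗ[ℝ] ℝ), (2 * σ * p.1) • (om 2 p : ℝ × Mat →ₗ[ℝ] ℝ),
    (-(2 * σ * p.1)) • (om 1 p : ℝ × Mat →ₗ[ℝ] ℝ)]

theorem ds_apply (w : ℝ × Mat) : ds w = w.1 := rfl

/-- Replacing e³, e⁴ by σe³, σe⁴ has the same effect on the triple Ωᵢ as conjugation by an element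
with `ConjSign σ`. -/
theorem asdForm_spA_apply {σ : ℝ} (hσ : σ ^ 2 = 1) (p : ℝ × Mat) (i : Fin 3) (v : Fin 2 → ℝ × Mat) :
    asdForm (spA σ p) i v = ![1, σ, σ] i * Om i p v := by
  fin_cases i <;>
    simp [asdForm, Om, ee, spA, rwedge_one_one_apply, covec_apply, oneForm_apply]
  · linear_combination (e 2 p (v 0) * e 3 p (v 1) - e 2 p (v 1) * e 3 p (v 0)) * hσ
  · ring
  · ring

theorem f_pow_four (s : ℝ) : f s ^ 4 = (1 + s ^ 2)⁻¹ := by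
  have h : 0 ≤ 1 + s ^ 2 := by positivity
  rw [f, ← Real.rpow_natCast, ← Real.rpow_mul h]
  norm_num [Real.rpow_neg_one]

theorem f_pos (s : ℝ) : 0 < f s := Real.rpow_pos_of_pos (by positivity) _

theorem bcoef_pow_four (s : ℝ) : bcoef s ^ 4 = 4 * (1 + s ^ 2) := by
  rw [bcoef, mul_pow, inv_pow, f_pow_four, inv_inv, show (√2 : ℝ) ^ 4 = (√2 ^ 2) ^ 2 by ring,
    Real.sq_sqrt (by norm_num)]
  norm_num

theorem acoef_sq_mul_bcoef_sq (s : ℝ) : acoef s ^ 2 * bcoef s ^ 2 = 8 * s ^ 2 := by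
  have := (f_pos s).ne'
  rw [acoef, bcoef, mul_pow (√2), Real.sq_sqrt (by norm_num)]
  field_simp
  ring

theorem acoef_mul_bcoef_sq_mul_f (s : ℝ) : acoef s * bcoef s ^ 2 * f s = 4 * s := by
  have := (f_pos s).ne'
  rw [acoef, bcoef, mul_pow (√2), Real.sq_sqrt (by norm_num)]
  field_simp
  ring

/-- The coefficients 4(1+s²), 8s² and 4s are b⁴, a²b² and ab² · dt/ds. The first is -⅔ · 3 · (-2)
times 1 + s², from three equal squares. The signs σ enter in pairs and disappear. -/
theorem psiElt_coframe {M : Type*} [AddCommGroup M] [Module ℝ M] {σ : ℝ} (hσ : σ ^ 2 = 1) (s : ℝ)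
    (a : Fin 4 → M) (r w₂ w₃ : M) :
    psiElt (1 + s ^ 2) ![a 0, a 1, σ • a 2, σ • a 3]
        ![r, (2 * σ * s) • w₃, (-(2 * σ * s)) • w₂] =
      (4 * (1 + s ^ 2)) • ((ExteriorAlgebra.ι ℝ (a 0) * ExteriorAlgebra.ι ℝ (a 1)) *
          (ExteriorAlgebra.ι ℝ (a 2) * ExteriorAlgebra.ι ℝ (a 3)))
        - (8 * s ^ 2) • ((ExteriorAlgebra.ι ℝ w₂ * ExteriorAlgebra.ι ℝ w₃) * asdElt a 0)
        - (4 * s) • (ExteriorAlgebra.ι ℝ r * (ExteriorAlgebra.ι ℝ w₂ * asdElt a 1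
          + ExteriorAlgebra.ι ℝ w₃ * asdElt a 2)) := by
  have h0 : asdElt ![a 0, a 1, σ • a 2, σ • a 3] 0 = asdElt a 0 := by
    simp [asdElt, smul_smul, ← sq, hσ]
  have h1 : asdElt ![a 0, a 1, σ • a 2, σ • a 3] 1 = σ • asdElt a 1 := by
    simp [asdElt, smul_sub]
  have h2 : asdElt ![a 0, a 1, σ • a 2, σ • a 3] 2 = σ • asdElt a 2 := by
    simp [asdElt, smul_sub]
  have s0 : ((0 : Fin 3) + 1) = 1 := rfl
  have s1 : ((0 : Fin 3) + 2) = 2 := rfl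
  have s2 : ((1 : Fin 3) + 1) = 2 := rfl
  have s3 : ((1 : Fin 3) + 2) = 0 := rfl
  have s4 : ((2 : Fin 3) + 1) = 0 := rfl
  have s5 : ((2 : Fin 3) + 2) = 1 := rfl
  rw [psiElt, Fin.sum_univ_three, Fin.sum_univ_three, h0, h1, h2]
  simp only [bivec, s0, s1, s2, s3, s4, s5, smul_mul_assoc, mul_smul_comm, smul_smul,
    asdElt_mul, if_true, Matrix.cons_val_zero, Matrix.cons_val_one, Matrix.cons_val, map_smul,
    mul_add, smul_add, mul_assoc, ι_swap w₃ w₂, ι_swap w₂ r,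
    smul_neg, neg_mul, mul_neg]
  match_scalars
  · linear_combination (8 / 3 * (1 + s ^ 2)) * hσ
  · linear_combination (-(8 * s ^ 2)) * hσ
  · linear_combination (-(4 * s)) * hσ
  · linear_combination (-(4 * s)) * hσ

theorem psi_eq_psiForm {σ : ℝ} (hσ : σ ^ 2 = 1) (p : ℝ × Mat) :
    psi p = psiForm (1 + p.1 ^ 2) (spA σ p) (spD σ p) := by
  have he : ∀ i, Represents (ExteriorAlgebra.ι ℝ (e i p : ℝ × Mat →ₗ[ℝ] ℝ)) (oneForm (e i p)) :=
    fun i => Represents.one _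
  have ho : ∀ i, Represents (ExteriorAlgebra.ι ℝ (om i p : ℝ × Mat →ₗ[ℝ] ℝ)) (oneForm (om i p)) :=
    fun i => Represents.one _
  have hee : ∀ i j, Represents (ExteriorAlgebra.ι ℝ (e i p : ℝ × Mat →ₗ[ℝ] ℝ) *
      ExteriorAlgebra.ι ℝ (e j p : ℝ × Mat →ₗ[ℝ] ℝ)) (ee i j p) := fun i j => (he i).mul (he j)
  have hOm : ∀ i, Represents (asdElt (fun i => (e i p : ℝ × Mat →ₗ[ℝ] ℝ)) i) (Om i p) :=
    fun i => represents_asdForm (fun i => (e i p : ℝ × Mat →ₗ[ℝ] ℝ)) i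
  have hdt : Represents (ExteriorAlgebra.ι ℝ (f p.1 • (ds : ℝ × Mat →ₗ[ℝ] ℝ))) (oneForm (dt p)) :=
    Represents.one _
  refine Represents.eq (((((hee 0 1).mul (hee 2 3)).smul _).sub
    ((((ho 1).mul (ho 2)).mul (hOm 0)).smul _)).sub
    ((hdt.mul (((ho 1).mul (hOm 1)).add ((ho 2).mul (hOm 2)))).smul _)) (represents_psiForm _ _ _) ?_
  refine Eq.trans ?_ (psiElt_coframe hσ p.1 (fun i => (e i p : ℝ × Mat →ₗ[ℝ] ℝ))
    (ds : ℝ × Mat →ₗ[ℝ] ℝ) (om 1 p : ℝ × Mat →ₗ[ℝ] ℝ) (om 2 p : ℝ × Mat →ₗ[ℝ] ℝ)).symm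
  rw [bcoef_pow_four, acoef_sq_mul_bcoef_sq, map_smul, smul_mul_assoc, smul_smul,
    acoef_mul_bcoef_sq_mul_f]

end Homogeneous

/-! ### Curvature of the invariant connections on ℝ⁺ × Sp(2). -/

section Homogeneous

theorem rpow_neg_half (s : ℝ) : (1 + s ^ 2) ^ (-(1 / 2) : ℝ) = (√(1 + s ^ 2))⁻¹ := by
  rw [Real.rpow_neg (by positivity), Real.sqrt_eq_rpow]

theorem rpow_three_halves (s : ℝ) : (1 + s ^ 2) ^ (3 / 2 : ℝ) = √(1 + s ^ 2) ^ 3 := by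
  rw [Real.sqrt_eq_rpow, ← Real.rpow_mul_natCast (by positivity)]
  norm_num

theorem hasDerivAt_inv_sqrt (s : ℝ) :
    HasDerivAt (fun s : ℝ => (√(1 + s ^ 2))⁻¹) (-(s / √(1 + s ^ 2) ^ 3)) s := by
  have h0 : (0 : ℝ) < 1 + s ^ 2 := by positivity
  have hr : 0 < √(1 + s ^ 2) := Real.sqrt_pos.2 h0
  have h := ((((hasDerivAt_id s).pow 2).const_add 1).sqrt (by simpa using h0.ne')).inv
    (by simpa using hr.ne')
  refine (h.congr_deriv ?_ : HasDerivAt (fun s : ℝ => (√(1 + s ^ 2))⁻¹) _ s)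
  simp
  field_simp

theorem contDiff_maurerCartan (a b : Fin 2) : ContDiff ℝ ∞ (maurerCartan a b) := by
  have h : ∀ k, ContDiff ℝ ∞ (fun p : ℝ × Mat => star (p.2 k a)) := fun k =>
    contDiff_quaternion_star (contDiff_apply_apply ℝ ℍ k a |>.comp contDiff_snd)
  exact ContDiff.sum fun k _ =>
    ((ContinuousLinearMap.mul ℝ ℍ).contDiff.comp (h k)).clm_comp contDiff_const

theorem instantonForm_apply (ε : ℝ) (p w : ℝ × Mat) : instantonForm ε p w =
    inner ℝ (T 0) (maurerCartan 1 1 p w) • T 0 + (ε * (√(1 + p.1 ^ 2))⁻¹) •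
      (inner ℝ (T 1) (maurerCartan 1 1 p w) • T 1 + inner ℝ (T 2) (maurerCartan 1 1 p w) • T 2) := by
  rw [← rpow_neg_half]
  rfl

theorem contDiff_instantonForm (ε : ℝ) : ContDiff ℝ ∞ (instantonForm ε) := by
  refine contDiff_clm_apply_iff.2 fun w => ?_
  simp only [instantonForm_apply]
  have hs : ContDiff ℝ ∞ (fun p : ℝ × Mat => √(1 + p.1 ^ 2)) :=
    (contDiff_const.add (contDiff_fst.pow 2)).sqrt fun p => by positivity
  have hc : ContDiff ℝ ∞ (fun p : ℝ × Mat => ε * (√(1 + p.1 ^ 2))⁻¹) :=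
    contDiff_const.mul (hs.inv fun p => by positivity)
  have hm : ∀ i, ContDiff ℝ ∞ (fun p : ℝ × Mat => inner ℝ (T i) (maurerCartan 1 1 p w) • T i) :=
    fun i => (contDiff_const.inner ℝ ((contDiff_maurerCartan 1 1).clm_apply contDiff_const)).smul
      contDiff_const
  exact (hm 0).add (hc.smul ((hm 1).add (hm 2)))

theorem hasDerivAt_maurerCartan_line (a b : Fin 2) (p v w : ℝ × Mat) (t₀ : ℝ) :
    HasDerivAt (fun t : ℝ => maurerCartan a b (p + t • v) w)
      (star (v.2 0 a) * w.2 0 b + star (v.2 1 a) * w.2 1 b) t₀ := by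
  have h : (fun t : ℝ => maurerCartan a b (p + t • v) w) = fun t : ℝ =>
      maurerCartan a b p w + t • (star (v.2 0 a) * w.2 0 b + star (v.2 1 a) * w.2 1 b) := by
    funext t
    simp only [maurerCartan_apply, Prod.snd_add, Prod.smul_snd, Pi.add_apply, Pi.smul_apply,
      star_add, Quaternion.star_smul, add_mul, smul_mul_assoc, smul_add]
    abel
  rw [h]
  simpa using (((hasDerivAt_id t₀).smul_const
    (star (v.2 0 a) * w.2 0 b + star (v.2 1 a) * w.2 1 b)).const_add (maurerCartan a b p w))

theorem fderiv_instantonForm (ε : ℝ) (p v w : ℝ × Mat) {S μ : ℍ}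
    (hS : S = star (v.2 0 1) * w.2 0 1 + star (v.2 1 1) * w.2 1 1) (hμ : μ = maurerCartan 1 1 p w) :
    fderiv ℝ (instantonForm ε) p v w =
      inner ℝ (T 0) S • T 0
        + (ε * (√(1 + p.1 ^ 2))⁻¹) • (inner ℝ (T 1) S • T 1 + inner ℝ (T 2) S • T 2)
        + (-(ε * p.1 / √(1 + p.1 ^ 2) ^ 3) * v.1) •
          (inner ℝ (T 1) μ • T 1 + inner ℝ (T 2) μ • T 2) := by
  refine fderiv_apply_eq_of_hasDerivAt ((contDiff_instantonForm ε).differentiable (by simp) p) ?_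
  simp only [instantonForm_apply]
  have hm := hasDerivAt_maurerCartan_line 1 1 p v w 0
  rw [← hS] at hm
  have hi : ∀ i, HasDerivAt (fun t : ℝ => inner ℝ (T i) (maurerCartan 1 1 (p + t • v) w))
      (inner ℝ (T i) S) 0 := fun i =>
    (innerSL ℝ (T i)).hasFDerivAt.comp_hasDerivAt (0 : ℝ) hm
  have hl : HasDerivAt (fun t : ℝ => (p + t • v).1) v.1 0 := by
    simpa using ((hasDerivAt_id (0 : ℝ)).mul_const v.1).const_add p.1
  have hc : HasDerivAt (fun t : ℝ => (√(1 + (p + t • v).1 ^ 2))⁻¹)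
      (-((p + (0 : ℝ) • v).1 / √(1 + (p + (0 : ℝ) • v).1 ^ 2) ^ 3) * v.1) 0 :=
    HasDerivAt.comp (0 : ℝ) (h₂ := fun s : ℝ => (√(1 + s ^ 2))⁻¹)
      (hasDerivAt_inv_sqrt (p + (0 : ℝ) • v).1) hl
  have h := ((hi 0).smul_const (T 0)).add ((hc.const_mul ε).smul
    (((hi 1).smul_const (T 1)).add ((hi 2).smul_const (T 2))))
  refine h.congr_deriv ?_
  rw [zero_smul, add_zero, Pi.add_apply]
  simp only [zero_smul, add_zero, ← hμ]
  module

theorem instantonCurvature_apply (ε : ℝ) (p : ℝ × Mat) (v : Fin 2 → ℝ × Mat) :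
    instantonCurvature ε p v =
      (1 / 2 * Om 0 p v - 2 * p.1 ^ 2 / (1 + p.1 ^ 2) *
          (om 1 p (v 0) * om 2 p (v 1) - om 1 p (v 1) * om 2 p (v 0))) • T 0
        + (ε / (2 * √(1 + p.1 ^ 2))) • (Om 1 p v • T 1 + Om 2 p v • T 2)
        - (ε * p.1 / √(1 + p.1 ^ 2) ^ 3) •
          (((v 0).1 * om 1 p (v 1) - (v 1).1 * om 1 p (v 0)) • T 1
            + ((v 0).1 * om 2 p (v 1) - (v 1).1 * om 2 p (v 0)) • T 2) := by
  have h23 : om23 p v = om 1 p (v 0) * om 2 p (v 1) - om 1 p (v 1) * om 2 p (v 0) :=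
    rwedge_one_one_apply _ _ v
  have hs : ∀ i, rwedge (oneForm ds) (oneForm (om i p)) v =
      (v 0).1 * om i p (v 1) - (v 1).1 * om i p (v 0) := fun i => rwedge_one_one_apply _ _ v
  rw [← h23, ← hs, ← hs, ← rpow_three_halves]
  rfl

theorem Om_apply (i : Fin 3) (p : ℝ × Mat) (v : Fin 2 → ℝ × Mat) : Om i p v =
    2 * inner ℝ (T i) (star (maurerCartan 0 1 p (v 0)) * maurerCartan 0 1 p (v 1)
      - star (maurerCartan 0 1 p (v 1)) * maurerCartan 0 1 p (v 0)) :=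
  (congrArg (fun φ : (ℝ × Mat) [⋀^Fin 2]→ₗ[ℝ] ℝ => φ v) (by rfl)).trans
    (asdForm_quatCovec (maurerCartan 0 1 p : ℝ × Mat →ₗ[ℝ] ℍ) v i)

/-- By the Maurer–Cartan equation dωⁱ consists of ½Ωᵢ and -2ωʲᵏ. Along T₁ the bracket changes the
coefficient -2 of ω²³ to -2 + 2ε²/(1+s²) = -2s²/(1+s²). Along T₂ and T₃ it cancels the products of
the ωⁱ, and differentiating (1+s²)^(-1/2) gives the ds terms. -/
theorem curvature_instantonForm {ε : ℝ} (hε : ε ^ 2 = 1) {p : ℝ × Mat} (hp : p.2 ∈ Sp2)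
    {v : Fin 2 → ℝ × Mat} (hv : ∀ i, v i ∈ tangentSp p) :
    curvature (instantonForm ε) p v = instantonCurvature ε p v := by
  rw [curvature_apply ((contDiff_instantonForm ε).differentiable (by simp) p),
    fderiv_instantonForm ε p _ _ rfl rfl, fderiv_instantonForm ε p _ _ rfl rfl,
    instantonForm_apply, instantonForm_apply, instantonCurvature_apply, Om_apply, Om_apply, Om_apply,
    (isFrame_of_mem_Sp2 hp).star_mul_add_star_mul ((v 0).2 0 1) ((v 0).2 1 1) ((v 1).2 0 1),
    (isFrame_of_mem_Sp2 hp).star_mul_add_star_mul ((v 1).2 0 1) ((v 1).2 1 1) ((v 0).2 0 1)]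
  simp only [← maurerCartan_apply, om_apply]
  have h0 := maurerCartan_re (hv 0)
  have h1 := maurerCartan_re (hv 1)
  rw [star_eq_neg_of_re h0, star_eq_neg_of_re h1]
  generalize maurerCartan 1 1 p (v 0) = α at *
  generalize maurerCartan 1 1 p (v 1) = β at *
  generalize maurerCartan 0 1 p (v 0) = μ
  generalize maurerCartan 0 1 p (v 1) = ν
  obtain ⟨r, hr, hr2⟩ : ∃ r : ℝ, 0 < r ∧ √(1 + p.1 ^ 2) = r :=
    ⟨√(1 + p.1 ^ 2), Real.sqrt_pos.2 (by positivity), rfl⟩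
  have hr3 : 1 + p.1 ^ 2 = r ^ 2 := by rw [← hr2, Real.sq_sqrt (by positivity)]
  rw [hr2, hr3]
  simp only [inner_T]
  have hs : p.1 ^ 2 = r ^ 2 - 1 := by linarith
  refine Quaternion.ext _ _ ?_ ?_ ?_ ?_ <;>
    simp [T_re, T_imI, T_imJ, T_imK, h0, h1]
  · ring
  · rw [hs]
    field_simp
    linear_combination (2 * (α.imJ * β.imK - α.imK * β.imJ)) * hε
  · field_simp
    ring
  · field_simp
    ring

end Homogeneous

/-! ### The instanton equation for the invariant connections. -/

section Homogeneous

theorem bivForm_spD_apply {σ : ℝ} (hσ : σ ^ 2 = 1) (p : ℝ × Mat) (v : Fin 2 → ℝ × Mat) :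
    bivForm (spD σ p) 0 v =
        4 * p.1 ^ 2 * (om 1 p (v 0) * om 2 p (v 1) - om 1 p (v 1) * om 2 p (v 0)) ∧
      bivForm (spD σ p) 1 v =
        2 * σ * p.1 * ((v 0).1 * om 1 p (v 1) - (v 1).1 * om 1 p (v 0)) ∧
      bivForm (spD σ p) 2 v =
        2 * σ * p.1 * ((v 0).1 * om 2 p (v 1) - (v 1).1 * om 2 p (v 0)) := by
  refine ⟨?_, ?_, ?_⟩
  · change rwedge (covec (spD σ p 1)) (covec (spD σ p 2)) v = _
    simp [spD, rwedge_one_one_apply, covec_apply]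
    linear_combination (4 * p.1 ^ 2 * (om 1 p (v 0) * om 2 p (v 1)
      - om 1 p (v 1) * om 2 p (v 0))) * hσ
  · change rwedge (covec (spD σ p 2)) (covec (spD σ p 0)) v = _
    simp [spD, rwedge_one_one_apply, covec_apply, ds_apply]
    ring
  · change rwedge (covec (spD σ p 0)) (covec (spD σ p 1)) v = _
    simp [spD, rwedge_one_one_apply, covec_apply, ds_apply]
    ring

/-- The coefficients are determined by the Ωᵢ terms: -(1+s²)B must be 1/2 along T₁ and 1/(2√(1+s²))
along T₂ and T₃, the sign σ being carried by the coframe. The terms in ω and ds then agree. -/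
theorem instantonCurvature_eq_sum {σ : ℝ} (hσ : σ ^ 2 = 1) (p : ℝ × Mat) :
    instantonCurvature σ p = ∑ j, tens (bivForm (spD σ p) j - (1 + p.1 ^ 2) • asdForm (spA σ p) j)
      ((![-(2 * (1 + p.1 ^ 2))⁻¹, -(2 * √(1 + p.1 ^ 2) ^ 3)⁻¹, -(2 * √(1 + p.1 ^ 2) ^ 3)⁻¹] j : ℝ) •
        T j) := by
  refine AlternatingMap.ext fun v => ?_
  obtain ⟨h0, h1, h2⟩ := bivForm_spD_apply hσ p v
  have ht : ∀ (φ : (ℝ × Mat) [⋀^Fin 2]→ₗ[ℝ] ℝ) (q : ℍ), tens φ q v = φ v • q := fun _ _ => rfl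
  rw [instantonCurvature_apply, Fin.sum_univ_three]
  simp only [AlternatingMap.add_apply, ht, AlternatingMap.sub_apply, AlternatingMap.smul_apply,
    h0, h1, h2, asdForm_spA_apply hσ, Matrix.cons_val_zero, Matrix.cons_val_one, Matrix.cons_val,
    smul_eq_mul]
  obtain ⟨r, hr, hr2⟩ : ∃ r : ℝ, 0 < r ∧ √(1 + p.1 ^ 2) = r :=
    ⟨√(1 + p.1 ^ 2), Real.sqrt_pos.2 (by positivity), rfl⟩
  have hr3 : 1 + p.1 ^ 2 = r ^ 2 := by rw [← hr2, Real.sq_sqrt (by positivity)]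
  rw [hr2, hr3]
  match_scalars <;> field_simp <;> ring

set_option maxRecDepth 10000 in
theorem vwedge_curvature_instantonForm {ε : ℝ} (hε : ε ^ 2 = 1) {p : ℝ × Mat} (hp : p.2 ∈ Sp2)
    {v : Fin 6 → ℝ × Mat} (hv : ∀ i, v i ∈ tangentSp p) :
    vwedge (curvature (instantonForm ε) p) (psi p) v = 0 := by
  have h0 := vwedge_compLinearMap (curvature (instantonForm ε) p) (psi p)
    (tangentSpSubmodule p).subtype
  have h1 : (curvature (instantonForm ε) p).compLinearMap (tangentSpSubmodule p).subtype =
      (instantonCurvature ε p).compLinearMap (tangentSpSubmodule p).subtype :=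
    AlternatingMap.ext fun v =>
      curvature_instantonForm hε hp (v := fun i => ((v i : ℝ × Mat))) fun i => (v i).2
  rw [h1, ← vwedge_compLinearMap, instantonCurvature_eq_sum hε, psi_eq_psiForm hε,
    vwedge_psiForm_eq_zero] at h0
  have h2 := DFunLike.congr_fun h0 fun i : Fin (2 + 4) => (⟨v i, hv i⟩ : tangentSpSubmodule p)
  rw [psi_eq_psiForm hε]
  exact h2

/-! ### The bundle isomorphism away from the zero section -/

/-- The linear map `(s, g) ↦ (q, s T₁) · h`, where `q` is the second column of `g`. -/
noncomputable def bundleIso (h : unitary ℍ) : ℝ × Mat →L[ℝ] Amb :=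
  LinearMap.toContinuousLinearMap
    { toFun := fun p => act (p.2 0 1, p.2 1 1, p.1 • T 0) h
      map_add' := fun p p' => by simp [act, add_mul, mul_add, add_smul]
      map_smul' := fun c p => by simp [act, mul_smul] }

theorem bundleIso_apply (h : unitary ℍ) (p : ℝ × Mat) :
    bundleIso h p = act (p.2 0 1, p.2 1 1, p.1 • T 0) h := rfl

theorem bundleIso_mem_P (h : unitary ℍ) (s : ℝ) {g : Mat} (hg : g ∈ Sp2) :
    bundleIso h (s, g) ∈ P :=
  act_mem_P ⟨normSq_of_mem_Sp2 hg, by simp [T_re]⟩ h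

/-- Acting by a fixed `h` stays in the fibres, so the projection is unaffected. For equivariance,
`h` has to commute with the U(1) of unit quaternions commuting with `T 0`. -/
theorem isBundleIso_bundleIso {h : unitary ℍ} (hh : ∀ z : unitary ℍ, Commute (z : ℍ) (T 0) →
    Commute (z : ℍ) (h : ℍ)) : IsBundleIso (bundleIso h) where
  smooth := (bundleIso h).contDiff.contDiffOn
  mem s _ g hg := bundleIso_mem_P h s hg
  equivariant s _ g _ k z hz := by
    have hz' := hh z hz
    have e : star (z : ℍ) * T 0 * z = T 0 := by
      rw [mul_assoc, ← hz.eq, ← mul_assoc, star_mul_self_unitary, one_mul]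
    have e1 : (z : ℍ) * h = h * z := hz'
    have e2 : star (h : ℍ) * star (z : ℍ) = star (z : ℍ) * star (h : ℍ) := by
      simpa using congrArg star e1
    refine Prod.ext ?_ (Prod.ext ?_ ?_)
    · change g 0 1 * z * h = g 0 1 * h * z
      rw [mul_assoc, e1, mul_assoc]
    · change g 1 1 * z * h = g 1 1 * h * z
      rw [mul_assoc, e1, mul_assoc]
    change star (h : ℍ) * (s • T 0) * h = star (z : ℍ) * (star (h : ℍ) * (s • T 0) * h) * z
    simp only [mul_assoc]
    change star (h : ℍ) * (s • T 0 * h) = star (z : ℍ) * (star (h : ℍ) * (s • T 0 * (h * z)))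
    rw [← e1, ← mul_assoc (star (z : ℍ)), ← e2]
    simp only [smul_mul_assoc, mul_smul_comm]
    congr 1
    calc star (h : ℍ) * (T 0 * h) = star (h : ℍ) * ((star (z : ℍ) * T 0 * z) * h) := by rw [e]
      _ = _ := by simp only [mul_assoc]
  covers s _ g _ := proj_act _ h

/-- Conjugation by `h` fixes `T₁` and multiplies `T₂`, `T₃` by `σ`. -/
def ConjSign (σ : ℝ) (h : unitary ℍ) : Prop :=
  ∀ (i : Fin 3) (q : ℍ), inner ℝ (T i) (star (h : ℍ) * q * h) = ![1, σ, σ] i * inner ℝ (T i) q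

/-- The element is 1 for the plus sign and T₁ for the minus sign: conjugation by T₁ is the half-turn
about the T₁ axis. -/
theorem exists_conjSign {ε : ℝ} (hε : ε = 1 ∨ ε = -1) : ∃ h : unitary ℍ, ConjSign ε h ∧
    ∀ z : unitary ℍ, Commute (z : ℍ) (T 0) → Commute (z : ℍ) (h : ℍ) := by
  rcases hε with rfl | rfl
  · exact ⟨1, fun i q => by fin_cases i <;> simp, fun z _ => by simp⟩
  · have hT : star (T 0) * T 0 = 1 := by
      ext <;> simp [T_re, T_imI, T_imJ, T_imK]
    have hT' : T 0 * star (T 0) = 1 := by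
      ext <;> simp [T_re, T_imI, T_imJ, T_imK]
    refine ⟨⟨T 0, hT, hT'⟩, fun i q => ?_, fun z hz => hz⟩
    rw [inner_T, inner_T]
    fin_cases i <;> simp [T_re, T_imI, T_imJ, T_imK]

/-- Origin of `spD`: the bracket with sT₁ doubles the ω², ω³ components, scales them by s and
rotates them by a quarter turn. -/
theorem covDeriv_column (p w : ℝ × Mat) :
    covDeriv (p.2 0 1, p.2 1 1, p.1 • T 0) (w.2 0 1, w.2 1 1, w.1 • T 0) =
      w.1 • T 0 + (2 * p.1 * om 2 p w) • T 1 - (2 * p.1 * om 1 p w) • T 2 := by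
  have e : hopfForm (p.2 0 1, p.2 1 1, p.1 • T 0) (w.2 0 1, w.2 1 1, w.1 • T 0) =
      maurerCartan 1 1 p w := (maurerCartan_apply 1 1 p w).symm
  rw [covDeriv_apply, e, om_eq, om_eq]
  ext <;> simp [T_re, T_imI, T_imJ, T_imK] <;> ring

theorem norm_smul_T_sq (s : ℝ) : ‖s • T 0‖ ^ 2 = s ^ 2 := by
  rw [norm_smul, mul_pow, Real.norm_eq_abs, sq_abs, ← real_inner_self_eq_norm_sq, inner_T, T_imI]
  simp

theorem connForm_bundleIso {σ : ℝ} {h : unitary ℍ} (hσ : ConjSign σ h) {p w : ℝ × Mat}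
    (hw : w ∈ tangentSp p) : connForm (bundleIso h p) (bundleIso h w) = instantonForm σ p w := by
  have hre := maurerCartan_re hw
  have e : hopfForm (p.2 0 1, p.2 1 1, p.1 • T 0) (w.2 0 1, w.2 1 1, w.1 • T 0) =
      maurerCartan 1 1 p w := (maurerCartan_apply 1 1 p w).symm
  rw [bundleIso_apply, bundleIso_apply, connForm_act, connForm_apply, e, covDeriv_column,
    norm_smul_T_sq, instantonForm_apply, om_eq, om_eq, connCoef]
  simp only [inner_T]
  obtain ⟨r, hr, hr2⟩ : ∃ r : ℝ, 0 < r ∧ √(1 + p.1 ^ 2) = r :=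
    ⟨√(1 + p.1 ^ 2), Real.sqrt_pos.2 (by positivity), rfl⟩
  have hr3 : p.1 ^ 2 = r ^ 2 - 1 := by rw [← hr2, Real.sq_sqrt (by positivity)]; ring
  rw [hr2]
  simp only [ConjSign, inner_T] at hσ
  have hI : ∀ q : ℍ, (star (h : ℍ) * q * h).imI = q.imI := fun q => by simpa using hσ 0 q
  have hJ : ∀ q : ℍ, (star (h : ℍ) * q * h).imJ = σ * q.imJ := hσ 1
  have hK : ∀ q : ℍ, (star (h : ℍ) * q * h).imK = σ * q.imK := hσ 2
  -- This is 1 + 4s²c(s²) = 1/r, the relation that determines `connCoef`.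
  have hr4 : p.1 ^ 2 * ((1 + r)⁻¹ * r⁻¹) = 1 - r⁻¹ := by
    rw [hr3]
    field_simp
    ring
  refine Quaternion.ext _ _ ?_ ?_ ?_ ?_
  · rw [re_conj]
    simp [T_re, T_imI, T_imJ, T_imK, hre]
  · rw [hI]
    simp [T_re, T_imI, T_imJ, T_imK]
  · rw [hJ]
    simp [T_re, T_imI, T_imJ, T_imK]
    linear_combination (-σ * (maurerCartan 1 1 p w).imJ) * hr4
  · rw [hK]
    simp [T_re, T_imI, T_imJ, T_imK]
    linear_combination (-σ * (maurerCartan 1 1 p w).imK) * hr4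

theorem curvature_hopfForm_act (p : Amb) (v : Fin 2 → Amb) (h : unitary ℍ) :
    curvature hopfForm (act p h) (fun i => act (v i) h) =
      star (h : ℍ) * curvature hopfForm p v * h := by
  rw [curvature_hopfForm_apply, curvature_hopfForm_apply, hopfForm_act, hopfForm_act, conj_mul_conj,
    conj_mul_conj]
  simp only [act, star_mul, mul_add, add_mul, mul_sub, sub_mul, mul_assoc]

theorem asdForm_compLinearMap {V V' : Type*} [AddCommGroup V] [Module ℝ V] [AddCommGroup V']
    [Module ℝ V'] (a : Fin 4 → Module.Dual ℝ V) (L : V' →ₗ[ℝ] V) (i : Fin 3) :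
    (asdForm a i).compLinearMap L = asdForm (fun j => a j ∘ₗ L) i := by
  refine AlternatingMap.ext fun v => ?_
  rw [AlternatingMap.compLinearMap_apply]
  fin_cases i <;> simp [asdForm, rwedge_one_one_apply, covec_apply]

theorem psiForm_compLinearMap {V V' : Type*} [AddCommGroup V] [Module ℝ V] [AddCommGroup V']
    [Module ℝ V'] (c : ℝ) (a : Fin 4 → Module.Dual ℝ V) (d : Fin 3 → Module.Dual ℝ V)
    (L : V' →ₗ[ℝ] V) : (psiForm c a d).compLinearMap L =
      psiForm c (fun j => a j ∘ₗ L) (fun j => d j ∘ₗ L) := by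
  have hb : ∀ i, (bivForm d i).compLinearMap L = bivForm (fun j => d j ∘ₗ L) i := fun i =>
    rwedge_compLinearMap _ _ L
  have e1 : (psiForm c a d).compLinearMap L =
      (-(2 / 3) * c : ℝ) • ∑ i : Fin 3, (rwedge (asdForm a i) (asdForm a i)).compLinearMap L
      - (2 : ℝ) • ∑ i : Fin 3, (rwedge (bivForm d i) (asdForm a i)).compLinearMap L := by
    rw [← compLinearMap_sum, ← compLinearMap_sum]
    rfl
  rw [e1]
  simp only [rwedge_compLinearMap, asdForm_compLinearMap, hb]
  rfl

theorem OmP_bundleIso {σ : ℝ} (hσ1 : σ ^ 2 = 1) {h : unitary ℍ} (hσ : ConjSign σ h) {p : ℝ × Mat}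
    (hp : p.2 ∈ Sp2) {v : Fin 2 → ℝ × Mat} (hv : ∀ i, v i ∈ tangentSp p) (i : Fin 3) :
    OmP i (bundleIso h p) (fun k => bundleIso h (v k)) = asdForm (spA σ p) i v := by
  have hθ : ∀ w : ℝ × Mat, hopfForm (p.2 0 1, p.2 1 1, p.1 • T 0) (w.2 0 1, w.2 1 1, w.1 • T 0) =
      maurerCartan 1 1 p w := fun w => (maurerCartan_apply 1 1 p w).symm
  have hν : ∀ w : ℝ × Mat, frameForm (p.2 0 0) (p.2 1 0) (w.2 0 1, w.2 1 1, w.1 • T 0) =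
      maurerCartan 0 1 p w := fun w => (maurerCartan_apply 0 1 p w).symm
  have hF := curvature_hopfForm_eq_frame (p := (p.2 0 1, p.2 1 1, p.1 • T 0))
    (isFrame_of_mem_Sp2 hp) (v := fun k => ((v k).2 0 1, (v k).2 1 1, (v k).1 • T 0))
    fun k => by rw [hθ]; exact maurerCartan_re (hv k)
  rw [hν, hν] at hF
  simp only [OmP_apply, bundleIso_apply]
  rw [curvature_hopfForm_act, hF, hσ, asdForm_spA_apply hσ1, Om_apply]
  ring

theorem Dx_bundleIso {σ : ℝ} {h : unitary ℍ} (hσ : ConjSign σ h) (p w : ℝ × Mat) (i : Fin 3) :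
    Dx i (bundleIso h p) (bundleIso h w) = spD σ p i w := by
  rw [Dx_apply, bundleIso_apply, bundleIso_apply, covDeriv_act, covDeriv_column, hσ, inner_T]
  fin_cases i <;> simp [spD, T_imI, T_imJ, T_imK, ds_apply] <;> ring

/-- Confirms that the globally defined four-form extends ψ: both equal `psiForm` in the coframe
`spA`, `spD`, to which the Ωᵢ and Dxⁱ pull back. -/
theorem psiP_bundleIso {σ : ℝ} (hσ1 : σ ^ 2 = 1) {h : unitary ℍ} (hσ : ConjSign σ h)
    {p : ℝ × Mat} (hp : p.2 ∈ Sp2) {w : Fin 4 → ℝ × Mat} (hw : ∀ i, w i ∈ tangentSp p) :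
    psiP (bundleIso h p) (fun i => bundleIso h (w i)) = psi p w := by
  have hn : ‖(bundleIso h p).2.2‖ ^ 2 = p.1 ^ 2 := by
    rw [← norm_smul_T_sq p.1, ← norm_conj (p.1 • T 0) h]
    rfl
  have h1 := psiP_compLinearMap (p := bundleIso h p)
    (L := (bundleIso h : ℝ × Mat →ₗ[ℝ] Amb) ∘ₗ (tangentSpSubmodule p).subtype)
    (a := fun j => spA σ p j ∘ₗ (tangentSpSubmodule p).subtype)
    (d := fun j => spD σ p j ∘ₗ (tangentSpSubmodule p).subtype)
    (fun i => by
      rw [← asdForm_compLinearMap]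
      refine AlternatingMap.ext fun v => ?_
      exact OmP_bundleIso hσ1 hσ hp (v := fun k => ((v k : ℝ × Mat))) (fun k => (v k).2) i)
    (fun i v => Dx_bundleIso hσ p v i)
  rw [hn, ← psiForm_compLinearMap, ← psi_eq_psiForm hσ1] at h1
  exact DFunLike.congr_fun h1 fun i => (⟨w i, hw i⟩ : tangentSpSubmodule p)

end Homogeneous

/-! ### Asymptotics -/

/-- Derivatives along the slice do not act on the scalar `c s`, and those of `L` are bounded on the
compact set. -/
theorem tendstoUniformlyOn_iteratedFDeriv_smul {E F : Type*} [NormedAddCommGroup E]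
    [NormedSpace ℝ E] [NormedAddCommGroup F] [NormedSpace ℝ F] {L : E → F} (hL : ContDiff ℝ ∞ L)
    {c : ℝ → ℝ} (hc : Filter.Tendsto c Filter.atTop (nhds 0)) {K S : Set E} (hK : IsCompact K)
    (hS : S ⊆ K) (k : ℕ) :
    TendstoUniformlyOn (fun s g => iteratedFDeriv ℝ k (fun g' => c s • L g') g) (fun _ => 0)
      Filter.atTop S := by
  have hLk : ContDiff ℝ k L := hL.of_le (by exact_mod_cast le_top)
  have hcont : Continuous (iteratedFDeriv ℝ k L) := hLk.continuous_iteratedFDeriv le_rfl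
  obtain ⟨C, hC⟩ := hK.exists_bound_of_continuousOn hcont.continuousOn
  rw [Metric.tendstoUniformlyOn_iff]
  intro δ hδ
  have hC0 : 0 < |C| + 1 := by positivity
  filter_upwards [Metric.tendsto_nhds.1 hc (δ / (|C| + 1)) (by positivity)] with s hs g hg
  have e : iteratedFDeriv ℝ k (fun g' => c s • L g') g = c s • iteratedFDeriv ℝ k L g :=
    iteratedFDeriv_const_smul_apply hLk.contDiffAt
  rw [dist_zero_left, e, norm_smul]
  rw [dist_zero_right] at hs
  calc ‖c s‖ * ‖iteratedFDeriv ℝ k L g‖ ≤ ‖c s‖ * (|C| + 1) := by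
        gcongr
        exact (hC g (hS hg)).trans ((le_abs_self C).trans (by linarith))
    _ < δ / (|C| + 1) * (|C| + 1) := by gcongr
    _ = δ := by field_simp

theorem norm_entry_le {g : Mat} (hg : g ∈ Sp2) (i j : Fin 2) : ‖g i j‖ ≤ 1 := by
  have h := congrFun (congrFun (Unitary.mem_iff.1 hg).1 j) j
  simp only [Matrix.star_eq_conjTranspose, Matrix.mul_apply, Fin.sum_univ_two,
    Matrix.conjTranspose_apply, Matrix.of_apply, Quaternion.star_mul_self,
    Matrix.one_apply_eq] at h
  rw [← Quaternion.coe_add, ← Quaternion.coe_one] at h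
  have h' := Quaternion.coe_injective h
  have h0 : 0 ≤ Quaternion.normSq (g 0 j) := Quaternion.normSq_nonneg
  have h1 : 0 ≤ Quaternion.normSq (g 1 j) := Quaternion.normSq_nonneg
  have h2 : Quaternion.normSq (g i j) ≤ 1 := by
    fin_cases i <;> simp <;> linarith
  rw [Quaternion.normSq_eq_norm_mul_self] at h2
  nlinarith [norm_nonneg (g i j)]

theorem Sp2_subset_closedBall : Sp2 ⊆ Metric.closedBall 0 1 := fun g hg => by
  rw [mem_closedBall_zero_iff, pi_norm_le_iff_of_nonneg zero_le_one]
  intro i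
  rw [pi_norm_le_iff_of_nonneg zero_le_one]
  exact fun j => norm_entry_le hg i j

theorem instantonForm_sub_canonicalForm (ε : ℝ) (p : ℝ × Mat) :
    instantonForm ε p - canonicalForm p = (ε * (√(1 + p.1 ^ 2))⁻¹) •
      ((om 1 p).smulRight (T 1) + (om 2 p).smulRight (T 2)) := by
  rw [instantonForm, rpow_neg_half, add_sub_cancel_left]

theorem tendsto_inv_sqrt (ε : ℝ) :
    Filter.Tendsto (fun s : ℝ => ε * (√(1 + s ^ 2))⁻¹) Filter.atTop (nhds 0) := by
  have h : Filter.Tendsto (fun s : ℝ => √(1 + s ^ 2)) Filter.atTop Filter.atTop :=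
    Filter.tendsto_atTop_mono (fun s => Real.le_sqrt_of_sq_le (by simp)) Filter.tendsto_id
  simpa using h.inv_tendsto_atTop.const_mul ε

theorem tendstoUniformlyOn_instantonForm (ε : ℝ) (k : ℕ) : TendstoUniformlyOn
    (fun (s : ℝ) (g : Mat) => iteratedFDeriv ℝ k
      (fun g' : Mat => instantonForm ε (s, g') - canonicalForm (s, g')) g)
    (fun _ => 0) Filter.atTop Sp2 := by
  -- The forms ωⁱ do not depend on s, so their restriction at s = 0 represents every slice.
  have hL : ContDiff ℝ ∞ fun g : Mat =>
      (om 1 (0, g)).smulRight (T 1) + (om 2 (0, g)).smulRight (T 2) := by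
    refine contDiff_clm_apply_iff.2 fun w => ?_
    have hm : ∀ i, ContDiff ℝ ∞ (fun g : Mat =>
        inner ℝ (T i) (maurerCartan 1 1 (0, g) w) • T i) := fun i =>
      (contDiff_const.inner ℝ (((contDiff_maurerCartan 1 1).comp
        (contDiff_const.prodMk contDiff_id)).clm_apply contDiff_const)).smul contDiff_const
    exact (hm 1).add (hm 2)
  have : ProperSpace Mat := FiniteDimensional.proper ℝ Mat
  have h := tendstoUniformlyOn_iteratedFDeriv_smul hL (tendsto_inv_sqrt ε)
    (isCompact_closedBall (0 : Mat) 1) Sp2_subset_closedBall k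
  simp only [instantonForm_sub_canonicalForm]
  exact h

theorem f_le_rpow {u : ℝ} (hu : 0 < u) : f u ≤ u ^ (-(1 / 2) : ℝ) := by
  have e : u ^ (-(1 / 2) : ℝ) = (u ^ 2) ^ (-(1 / 4) : ℝ) := by
    rw [← Real.rpow_natCast, ← Real.rpow_mul hu.le]
    norm_num
  rw [e]
  exact Real.rpow_le_rpow_of_nonpos (by positivity) (by linarith) (by norm_num)

theorem continuous_f : Continuous f :=
  (continuous_const.add (continuous_id.pow 2)).rpow_const fun u => Or.inl (by
    change 1 + u ^ 2 ≠ 0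
    positivity)

theorem geodesicDist_pos {s : ℝ} (hs : 0 < s) : 0 < geodesicDist s :=
  intervalIntegral.intervalIntegral_pos_of_pos (continuous_f.intervalIntegrable 0 s)
    f_pos hs

theorem geodesicDist_le {s : ℝ} (hs : 0 < s) : geodesicDist s ≤ 2 * √s := by
  have h : geodesicDist s ≤ ∫ u in (0 : ℝ)..s, u ^ (-(1 / 2) : ℝ) :=
    intervalIntegral.integral_mono_on_of_le_Ioo hs.le (continuous_f.intervalIntegrable 0 s)
      (intervalIntegral.intervalIntegrable_rpow' (by norm_num)) fun u hu => f_le_rpow hu.1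
  refine h.trans_eq ?_
  rw [integral_rpow (Or.inl (by norm_num)), Real.sqrt_eq_rpow]
  norm_num
  ring

theorem sqrt_mul_f_le {s : ℝ} (hs : 0 < s) : √s * f s ≤ 1 := by
  calc √s * f s ≤ √s * s ^ (-(1 / 2) : ℝ) := by gcongr; exact f_le_rpow hs
    _ = 1 := by rw [Real.sqrt_eq_rpow, ← Real.rpow_add hs]; norm_num

theorem f_sq (s : ℝ) : f s ^ 2 = (√(1 + s ^ 2))⁻¹ := by
  rw [← rpow_neg_half, f, ← Real.rpow_mul_natCast (by positivity)]
  norm_num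

theorem norm_smul_T_add (a b : ℝ) : ‖a • T 1 + b • T 2‖ = √(a ^ 2 + b ^ 2) := by
  rw [eq_comm, Real.sqrt_eq_iff_mul_self_eq (by positivity) (norm_nonneg _), ← sq,
    ← real_inner_self_eq_norm_sq, quaternion_inner_eq]
  simp [T_re, T_imI, T_imJ, T_imK, ← sq]

/-- The difference has size f²N, while the metric controls 2sfN, a quotient of f/(2s). From t ≤ 2√s
and f ≤ s^(-1/2) follows t³f ≤ 8s, whence the constant 4. -/
theorem norm_instantonForm_sub_le {ε : ℝ} (hε : |ε| = 1) {s : ℝ} (hs : 0 < s) (g : Mat)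
    (w : ℝ × Mat) : ‖instantonForm ε (s, g) w - canonicalForm (s, g) w‖ ≤
      4 * geodesicDist s ^ (-3 : ℤ) * √(metric (s, g) w) := by
  have hf := f_pos s
  have ht := geodesicDist_pos hs
  set N := √(om 1 (s, g) w ^ 2 + om 2 (s, g) w ^ 2) with hN
  have hN0 : 0 ≤ N := Real.sqrt_nonneg _
  have h1 : ‖instantonForm ε (s, g) w - canonicalForm (s, g) w‖ = f s ^ 2 * N := by
    rw [← _root_.sub_apply, instantonForm_sub_canonicalForm]
    change ‖(ε * (√(1 + s ^ 2))⁻¹) • (om 1 (s, g) w • T 1 + om 2 (s, g) w • T 2)‖ = _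
    rw [norm_smul, norm_smul_T_add, ← f_sq, norm_mul, Real.norm_eq_abs, hε, one_mul,
      Real.norm_of_nonneg (by positivity)]
  have h2 : 2 * s * f s * N ≤ √(metric (s, g) w) := by
    apply Real.le_sqrt_of_sq_le
    rw [mul_pow, hN, Real.sq_sqrt (by positivity)]
    have h3 : 0 ≤ dt (s, g) w ^ 2 := sq_nonneg _
    have h4 : 0 ≤ bcoef s ^ 2 * ∑ i : Fin 4, e i (s, g) w ^ 2 := by positivity
    rw [metric]
    change (acoef s) ^ 2 * _ ≤ dt (s, g) w ^ 2 + acoef s ^ 2 * _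
      + bcoef s ^ 2 * ∑ i : Fin 4, e i (s, g) w ^ 2
    linarith
  have h5 : geodesicDist s ^ 3 * f s ≤ 8 * s := by
    calc geodesicDist s ^ 3 * f s ≤ (2 * √s) ^ 3 * f s := by
          gcongr
          exact geodesicDist_le hs
      _ = 8 * √s ^ 2 * (√s * f s) := by ring
      _ ≤ 8 * √s ^ 2 * 1 := by gcongr; exact sqrt_mul_f_le hs
      _ = 8 * s := by rw [Real.sq_sqrt hs.le, mul_one]
  rw [h1]
  calc f s ^ 2 * N = geodesicDist s ^ (-3 : ℤ) * ((geodesicDist s ^ 3 * f s) * (f s * N)) := by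
        rw [zpow_neg]
        have : geodesicDist s ^ (3 : ℤ) = geodesicDist s ^ 3 := by norm_cast
        rw [this]
        field_simp
    _ ≤ geodesicDist s ^ (-3 : ℤ) * ((8 * s) * (f s * N)) := by gcongr
    _ = 4 * geodesicDist s ^ (-3 : ℤ) * (2 * s * f s * N) := by ring
    _ ≤ _ := by gcongr

end BryantSalamon

theorem mainTheorem6 (ε : ℝ) (hε : ε = 1 ∨ ε = -1) :
    IsPrincipalBundle ∧
    -- the connection extends over the zero section to an irreducible instanton
    (∃ (A : Connection) (j : ℝ × Mat → Amb), IsBundleIso j ∧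
      (∀ s : ℝ, 0 < s → ∀ g ∈ Sp2, ∀ w ∈ tangentSp (s, g),
        A.form (j (s, g)) (fderiv ℝ j (s, g) w) = instantonForm ε (s, g) w) ∧
      (∀ s : ℝ, 0 < s → ∀ g ∈ Sp2, ∀ w : Fin 4 → ℝ × Mat, (∀ i, w i ∈ tangentSp (s, g)) →
        psiP (j (s, g)) (fun i => fderiv ℝ j (s, g) (w i)) = psi (s, g) w) ∧
      A.IsG2Instanton ∧ A.IsIrreducible) ∧
    -- the curvature and the instanton equation away from the zero section
    (∀ s : ℝ, 0 < s → ∀ g ∈ Sp2, ∀ w : Fin 2 → ℝ × Mat, (∀ i, w i ∈ tangentSp (s, g)) →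
      curvature (instantonForm ε) (s, g) w = instantonCurvature ε (s, g) w) ∧
    (∀ s : ℝ, 0 < s → ∀ g ∈ Sp2, ∀ w : Fin 6 → ℝ × Mat, (∀ i, w i ∈ tangentSp (s, g)) →
      vwedge (curvature (instantonForm ε) (s, g)) (psi (s, g)) w = 0) ∧
    -- the connection is asymptotic to the canonical connection
    (∀ k : ℕ, TendstoUniformlyOn
      (fun (s : ℝ) (g : Mat) => iteratedFDeriv ℝ k
        (fun g' : Mat => instantonForm ε (s, g') - canonicalForm (s, g')) g)
      (fun _ => 0) Filter.atTop Sp2) ∧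
    (∃ C : ℝ, ∀ s : ℝ, 1 ≤ s → ∀ g ∈ Sp2, ∀ w ∈ tangentSp (s, g),
      ‖instantonForm ε (s, g) w - canonicalForm (s, g) w‖
        ≤ C * geodesicDist s ^ (-3 : ℤ) * √(metric (s, g) w)) := by
  have hε2 : ε ^ 2 = 1 := by rcases hε with rfl | rfl <;> norm_num
  have hε1 : |ε| = 1 := by rcases hε with rfl | rfl <;> norm_num
  -- Only the bundle isomorphism depends on the sign; the connection on `P` does not.
  obtain ⟨h, hh, hc⟩ := exists_conjSign hε
  refine ⟨isPrincipalBundle, ⟨instantonConnection, bundleIso h, isBundleIso_bundleIso hc, ?_, ?_,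
    instantonConnection_isG2Instanton, instantonConnection_isIrreducible⟩, ?_, ?_,
    tendstoUniformlyOn_instantonForm ε, 4, ?_⟩
  · intro s _ g _ w hw
    rw [ContinuousLinearMap.fderiv]
    exact connForm_bundleIso hh hw
  · intro s _ g hg w hw
    rw [ContinuousLinearMap.fderiv]
    exact psiP_bundleIso hε2 hh (p := (s, g)) hg hw
  · intro s _ g hg w hw
    exact curvature_instantonForm hε2 (p := (s, g)) hg hw
  · intro s _ g hg w hw
    exact vwedge_curvature_instantonForm hε2 (p := (s, g)) hg hw
  · intro s hs g _ w _
    exact norm_instantonForm_sub_le hε1 (by linarith) g w
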